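/- Manifolds are smooth, Hausdorff and second countable. A Lie groupoid $\Sigma\rightrightarrows\mathbf X$ over a finite-dimensional manifold $\mathbf X$ (source $s$, target $t$) is either an ordinary one or a strict pro-finite dimensional one, i.e. the limit of a tower of ordinary Lie groupoids $\Sigma_k\rightrightarrows\mathbf X$ along groupoid morphisms over $\mathrm{id}_{\mathbf X}$ which are surjective submersions; in the second case tangent vectors are compatible families of tangent vectors at the levels $k$, and an object (function, vector field, form, projection onto a sub-bundle) is smooth if each of its components comes from a smooth object at some finite level. A principal $\Sigma$-bundle $\pi:P\to M$ over a finite-dimensional manifold $M$, with moment map $\mu:P\to\mathbf X$ and left action $(g,p)\mapsto gp$ defined for $s(g)=\mu(p)$, is accordingly a principal bundle in the usual sense ($\pi$ is a surjective submersion and $(g,p)\mapsto(gp,p)$ is a diffeomorphism $\Sigma\ltimes P\to P\times_M P$), or the limit of a tower of principal $\Sigma_k$-bundles $P_k\to M$ along equivariant surjective submersions. A Cartan groupoid $(\Sigma,\mathcal C)$ is a Lie groupoid with a sub-bundle $\mathcal C\subset T\Sigma$ that is complementary to $\ker(dt)$ and is a full subgroupoid of $T\Sigma\rightrightarrows T\mathbf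 X$. Let $A=\ker(ds)|_{\mathbf X}$ be the Lie algebroid of $\Sigma$, with anchor $\rho=dt|_A$ and bracket $[\alpha,\beta]^R=[\alpha^R,\beta^R]$ (right-invariant vector fields), let $\nabla_V\alpha=[\mathrm{hor}(V),\alpha^R]|_{\mathbf X}$ be the connection on $A$ induced by $\mathcal C$ ($\mathrm{hor}(V)$ is the section of $\mathcal C$ which is $s$-projectable to $V\in\mathfrak X(\mathbf X)$), and let $$\{\alpha,\beta\}_{\mathrm{pt}}=[\alpha,\beta]-\nabla_{\rho(\alpha)}\beta+\nabla_{\rho(\beta)}\alpha ,$$ which is $C^\infty(\mathbf X)$-bilinear. Let $a:\mu^*A\to TP$ be the infinitesimal action. A sub-bundle $\mathcal C_P\subset TP$ makes $P$ into a flat $(\Sigma,\mathcal C)$-structure if it is complementary to $\ker(d\pi)$, satisfies $\mathcal C\cdot\mathcal C_P\subset\mathcal C_P$ (for the action of $T\Sigma$ on $TP$ by the differential of the action map), and both $\ker(d\mu)\cap\mathcal C_P$ and $\mathcal C_P$ are involutive. **Proposition.** Let $(\Sigma,\mathcal C)$ be a Cartan groupoid over $\mathbf X$ and $\pi:P\to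 M$ a principal $\Sigma$-bundle. Then every sub-bundle $\mathcal C_P\subset TP$ that makes $P$ into a flat $(\Sigma,\mathcal C)$-structure is the kernel of a 1-form $\theta\in\Omega^1(P,\mu^*A)$ with the two properties $$\theta(a(\alpha))=\alpha\quad\text{for all }\alpha ,\qquad d_{\mu^*A}\theta+\tfrac12\{\theta,\theta\}_{\mathrm{pt}}=0 .$$ Here, with $\mu^*\nabla$ the pull-back connection on $\mu^*A$, $(d_{\mu^*A}\theta)(Y,Z)=(\mu^*\nabla)_Y(\theta(Z))-(\mu^*\nabla)_Z(\theta(Y))-\theta([Y,Z])$ and $\tfrac12\{\theta,\theta\}_{\mathrm{pt}}(Y,Z)=\{\theta(Y),\theta(Z)\}_{\mathrm{pt}}$ for $Y,Z\in\mathfrak X(P)$. If moreover the $s$-fibers of $\Sigma$ (of all $\Sigma_k$, in the pro-finite case) are connected, then $\theta\mapsto\ker\theta$ is a bijection from the 1-forms $\theta\in\Omega^1(P,\mu^*A)$ with these two properties onto the sub-bundles $\mathcal C_P\subset TP$ that make $P$ into a flat $(\Sigma,\mathcal C)$-structure. -/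

import Mathlib

open Set Manifold
open scoped ContDiff

universe u v w z

noncomputable section

/-! ## Finite-dimensional smooth manifolds -/

/-- A finite-dimensional smooth manifold (without boundary, Hausdorff, second countable). -/
structure Mfd where
  carrier : Type u
  dim : ℕ
  [top : TopologicalSpace carrier]
  [charted : ChartedSpace (EuclideanSpace ℝ (Fin dim)) carrier]
  [smooth : IsManifold (𝓡 dim) ∞ carrier]
  [t2 : T2Space carrier]
  [sc : SecondCountableTopology carrier]

namespace Mfd

instance : CoeSort Mfd.{u} (Type u) := ⟨Mfd.carrier⟩

attribute [instance] Mfd.top Mfd.charted Mfd.smooth Mfd.t2 Mfd.sc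

/-- The model vector space. All tangent spaces `T_x M` are copies of it (Mathlib's convention:
`TangentSpace` is a type synonym of the model space, through the preferred chart at `x`), so that
vectors which are tangent at two points known to be equal can be compared in it. -/
abbrev E (M : Mfd.{u}) : Type := EuclideanSpace ℝ (Fin M.dim)

/-- The tangent space `T_x M`. -/
abbrev T (M : Mfd.{u}) (x : M) : Type := TangentSpace (𝓡 M.dim) x

/-- The tangent bundle `TM`. -/
abbrev TB (M : Mfd.{u}) : Type u := TangentBundle (𝓡 M.dim) M

/-- Smooth maps between manifolds. -/
def Smooth {M : Mfd.{u}} {N : Mfd.{v}} (f : M → N) : Prop := ContMDiff (𝓡 M.dim) (𝓡 N.dim) ∞ f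

/-- The differential of a map at a point. -/
def d {M : Mfd.{u}} {N : Mfd.{v}} (f : M → N) (x : M) : M.T x →L[ℝ] N.T (f x) :=
  mfderiv (𝓡 M.dim) (𝓡 N.dim) f x

/-- Surjective submersions. -/
structure IsSurjSubmersion {M : Mfd.{u}} {N : Mfd.{v}} (f : M → N) : Prop where
  smooth : Smooth f
  surj : Function.Surjective f
  submersion : ∀ x, Function.Surjective (d f x)

/-- Smoothness of a map of two variables along a subset `S` of the product, e.g. along a
fibre product `S = {(x, y) | f x = g y}` of submersions, an embedded submanifold. -/
def SmoothOn₂ {M : Mfd.{u}} {N : Mfd.{v}} {L : Mfd.{w}} (f : M → N → L) (S : Set (M × N)) : Prop :=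
  ContMDiffOn ((𝓡 M.dim).prod (𝓡 N.dim)) (𝓡 L.dim) ∞ (fun q : M × N => f q.1 q.2) S

/-- The differential at `(x, y)` of a map of two variables which is smooth along `S`. If `S` is a
submanifold, the value is determined (independently of the behaviour of `f` off `S`) on the vectors
`(a, b)` that are tangent to `S`; it is only used for such vectors. -/
def d₂ {M : Mfd.{u}} {N : Mfd.{v}} {L : Mfd.{w}} (f : M → N → L) (S : Set (M × N)) (x : M) (y : N)
    (a : M.T x) (b : N.T y) : L.T (f x y) :=
  mfderivWithin ((𝓡 M.dim).prod (𝓡 N.dim)) (𝓡 L.dim) (fun q : M × N => f q.1 q.2) S (x, y) (a, b)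

/-- A smooth vector field on a finite-dimensional manifold. -/
def IsVectorField {M : Mfd.{u}} (V : ∀ x : M, M.T x) : Prop :=
  ContMDiff (𝓡 M.dim) (𝓡 M.dim).tangent ∞ (fun x => (⟨x, V x⟩ : M.TB))

end Mfd

/-! ## Pro-finite dimensional (pf) manifolds

A pf-manifold is given by a tower of surjective submersions between finite-dimensional manifolds;
its points are those of the inverse limit. A finite-dimensional manifold is a constant tower. -/

structure Tower where
  M : ℕ → Mfd.{u}
  proj : ∀ k, M (k + 1) → M k
  proj_subm : ∀ k, Mfd.IsSurjSubmersion (proj k)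

namespace Tower

variable (T : Tower.{u})

/-- The points of the pf-manifold. -/
def Pt : Type u := {p : ∀ k, T.M k // ∀ k, T.proj k (p (k + 1)) = p k}

variable {T}

/-- The `k`-th component of a point. -/
abbrev Pt.at (p : T.Pt) (k : ℕ) : T.M k := p.1 k

/-- Families of tangent vectors at the components of a point. -/
abbrev Vec (p : T.Pt) : Type := ∀ k, (T.M k).T (p.at k)

/-- The tangent space of the pf-manifold: the limit of the tangent spaces of the tower. -/
def Tan (p : T.Pt) : Submodule ℝ (Vec p) where
  carrier := {v | ∀ k, (Mfd.d (T.proj k) (p.at (k + 1)) (v (k + 1)) : (T.M k).E) = v k}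
  add_mem' := by
    intro a b ha hb k
    have h1 := ha k
    have h2 := hb k
    have h3 := (Mfd.d (T.proj k) (p.at (k + 1))).map_add (a (k + 1)) (b (k + 1))
    exact h3.trans (congrArg₂ (fun x y : (T.M k).E => x + y) h1 h2)
  zero_mem' := fun k => (Mfd.d (T.proj k) (p.at (k + 1))).map_zero
  smul_mem' := by
    intro c a ha k
    have h1 := ha k
    have h3 := (Mfd.d (T.proj k) (p.at (k + 1))).map_smul c (a (k + 1))
    exact h3.trans (congrArg (fun x : (T.M k).E => c • x) h1)

/-- A smooth function on a pf-manifold: it comes from a smooth function on some `T.M m`. -/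
def IsSmoothFun (f : T.Pt → ℝ) : Prop :=
  ∃ (m : ℕ) (F : T.M m → ℝ), ContMDiff (𝓡 (T.M m).dim) 𝓘(ℝ, ℝ) ∞ F ∧ ∀ p : T.Pt, f p = F (p.at m)

open Classical in
/-- The derivative of a smooth function `f` in the direction of a tangent vector `v`. -/
def deriv (f : T.Pt → ℝ) {p : T.Pt} (v : Vec p) : ℝ :=
  if h : IsSmoothFun f then
    mfderiv (𝓡 (T.M h.choose).dim) 𝓘(ℝ, ℝ) h.choose_spec.choose (p.at h.choose) (v h.choose)
  else 0

/-- A smooth vector field on a pf-manifold: each of its components `V_k` comes from a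
smooth map `T.M m → T (T.M k)`, for some `m`. -/
def IsVectorField (V : ∀ p : T.Pt, Vec p) : Prop :=
  (∀ p, V p ∈ Tan p) ∧
  ∀ k, ∃ (m : ℕ) (F : T.M m → (T.M k).TB),
    ContMDiff (𝓡 (T.M m).dim) (𝓡 (T.M k).dim).tangent ∞ F ∧
    ∀ p : T.Pt, F (p.at m) = ⟨p.at k, V p k⟩

open Classical in
/-- The Lie bracket of vector fields, characterized by `[V, W] f = V (W f) - W (V f)`. -/
def lieBracket (V W : ∀ p : T.Pt, Vec p) (p : T.Pt) : Tan p :=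
  if h : ∃ u : Tan p, ∀ f : T.Pt → ℝ, IsSmoothFun f →
      deriv f u.1 = deriv (fun q => deriv f (W q)) (V p) - deriv (fun q => deriv f (V q)) (W p)
  then h.choose else 0

/-- A distribution (a family of subspaces of the tangent spaces, possibly of non-constant rank) is
involutive if its vector fields are closed under the Lie bracket. -/
def IsInvolutive (D : ∀ p : T.Pt, Submodule ℝ (Vec p)) : Prop :=
  ∀ V W : ∀ p : T.Pt, Vec p, IsVectorField V → IsVectorField W →
    (∀ p, V p ∈ D p) → (∀ p, W p ∈ D p) → ∀ p, (lieBracket V W p : Vec p) ∈ D p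

/-- `D` is a (smooth) sub-bundle of the tangent bundle complementary to the sub-bundle `K`:
fibrewise `T_p = D p ⊕ K p`, and the projection onto `D` along `K` is smooth, i.e. each of its
components comes from a smooth map `T (T.M m) → T (T.M k)`, for some `m`. -/
def IsComplement (D K : ∀ p : T.Pt, Submodule ℝ (Vec p)) : Prop :=
  (∀ p, D p ⊓ K p = ⊥ ∧ D p ⊔ K p = Tan p) ∧
  ∀ k, ∃ (m : ℕ) (F : (T.M m).TB → (T.M k).TB),
    ContMDiff (𝓡 (T.M m).dim).tangent (𝓡 (T.M k).dim).tangent ∞ F ∧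
    ∀ p, ∀ c ∈ D p, ∀ e ∈ K p, F ⟨p.at m, (c + e) m⟩ = ⟨p.at k, c k⟩

end Tower

/-! ## Lie groupoids -/

/-- A (finite-dimensional) Lie groupoid over `X`. The product `mul g h` is only meaningful for
composable pairs, i.e. when `src g = tgt h`. -/
structure LieGroupoid (X : Mfd.{u}) where
  arr : Mfd.{v}
  src : arr → X
  tgt : arr → X
  one : X → arr
  inv : arr → arr
  mul : arr → arr → arr
  src_subm : Mfd.IsSurjSubmersion src
  tgt_subm : Mfd.IsSurjSubmersion tgt
  one_smooth : Mfd.Smooth one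
  inv_smooth : Mfd.Smooth inv
  mul_smooth : Mfd.SmoothOn₂ mul {q | src q.1 = tgt q.2}
  src_one : ∀ x, src (one x) = x
  tgt_one : ∀ x, tgt (one x) = x
  src_mul : ∀ g h, src g = tgt h → src (mul g h) = src h
  tgt_mul : ∀ g h, src g = tgt h → tgt (mul g h) = tgt g
  mul_assoc : ∀ g h l, src g = tgt h → src h = tgt l → mul (mul g h) l = mul g (mul h l)
  one_mul : ∀ g, mul (one (tgt g)) g = g
  mul_one : ∀ g, mul g (one (src g)) = g
  src_inv : ∀ g, src (inv g) = tgt g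
  tgt_inv : ∀ g, tgt (inv g) = src g
  inv_mul : ∀ g, mul (inv g) g = one (src g)
  mul_inv : ∀ g, mul g (inv g) = one (tgt g)

namespace LieGroupoid

variable {X : Mfd.{u}} (G : LieGroupoid.{u, v} X)

/-- The multiplication `dm(a, b)` of composable tangent vectors. -/
def dmul (g h : G.arr) (a : G.arr.T g) (b : G.arr.T h) : G.arr.T (G.mul g h) :=
  Mfd.d₂ G.mul {q | G.src q.1 = G.tgt q.2} g h a b

end LieGroupoid

/-- A (left) principal `G`-bundle over `M`: a surjective submersion `π : P → M` and a smooth action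
of `G` on `P` along `μ : P → X`, such that `(g, p) ↦ (g p, p)` is a diffeomorphism from
`{(g, p) | src g = μ p}` onto `P ×_M P`. The inverse diffeomorphism is `(p, q) ↦ (div p q, q)`.
The value `act g p` is only meaningful when `src g = μ p`, and `div p q` when `π p = π q`. -/
structure PrincipalBundle {X : Mfd.{u}} (G : LieGroupoid.{u, v} X) (M : Mfd.{w}) where
  tot : Mfd.{z}
  pr : tot → M
  mom : tot → X
  act : G.arr → tot → tot
  div : tot → tot → G.arr
  pr_subm : Mfd.IsSurjSubmersion pr
  mom_smooth : Mfd.Smooth mom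
  act_smooth : Mfd.SmoothOn₂ act {q | G.src q.1 = mom q.2}
  mom_act : ∀ g p, G.src g = mom p → mom (act g p) = G.tgt g
  one_act : ∀ p, act (G.one (mom p)) p = p
  mul_act : ∀ g h p, G.src g = G.tgt h → G.src h = mom p → act (G.mul g h) p = act g (act h p)
  pr_act : ∀ g p, G.src g = mom p → pr (act g p) = pr p
  div_smooth : Mfd.SmoothOn₂ div {q | pr q.1 = pr q.2}
  src_div : ∀ p q, pr p = pr q → G.src (div p q) = mom q
  div_act : ∀ p q, pr p = pr q → act (div p q) q = p
  act_div : ∀ g p, G.src g = mom p → div (act g p) p = g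

namespace PrincipalBundle

variable {X : Mfd.{u}} {G : LieGroupoid.{u, v} X} {M : Mfd.{w}} (P : PrincipalBundle.{u, v, w, z} G M)

/-- The action `da(a, b)` of tangent vectors of `G` on tangent vectors of `P`. -/
def dact (g : G.arr) (p : P.tot) (a : G.arr.T g) (b : P.tot.T p) : P.tot.T (P.act g p) :=
  Mfd.d₂ P.act {q | G.src q.1 = P.mom q.2} g p a b

end PrincipalBundle

/-! ## Strict pf Lie groupoids and their Lie algebroids

A strict pf Lie groupoid over a finite-dimensional base `X` is the limit of a tower of Lie groupoids
over `X`. Ordinary Lie groupoids are the constant towers. -/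

structure PfGroupoid (X : Mfd.{u}) where
  lev : ℕ → LieGroupoid.{u, v} X
  proj : ∀ k, (lev (k + 1)).arr → (lev k).arr
  proj_subm : ∀ k, Mfd.IsSurjSubmersion (proj k)
  src_proj : ∀ k g, (lev k).src (proj k g) = (lev (k + 1)).src g
  tgt_proj : ∀ k g, (lev k).tgt (proj k g) = (lev (k + 1)).tgt g
  proj_one : ∀ k x, proj k ((lev (k + 1)).one x) = (lev k).one x
  proj_inv : ∀ k g, proj k ((lev (k + 1)).inv g) = (lev k).inv (proj k g)
  proj_mul : ∀ k g h, (lev (k + 1)).src g = (lev (k + 1)).tgt h →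
    proj k ((lev (k + 1)).mul g h) = (lev k).mul (proj k g) (proj k h)

namespace PfGroupoid

variable {X : Mfd.{u}} (G : PfGroupoid.{u, v} X)

/-- The pf-manifold of arrows. -/
abbrev toTower : Tower.{v} where
  M k := (G.lev k).arr
  proj := G.proj
  proj_subm := G.proj_subm

/-- The arrows of a strict pf Lie groupoid. -/
abbrev Arr : Type v := G.toTower.Pt

variable {G}

/-- The source of an arrow. -/
def src (g : G.Arr) : X := (G.lev 0).src (g.at 0)

/-- The target of an arrow. -/
def tgt (g : G.Arr) : X := (G.lev 0).tgt (g.at 0)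

theorem src_at (g : G.Arr) (k : ℕ) : (G.lev k).src (g.at k) = src g := by
  induction k with
  | zero => rfl
  | succ k ih => exact ((G.src_proj k _).symm.trans (congrArg (G.lev k).src (g.2 k))).trans ih

theorem tgt_at (g : G.Arr) (k : ℕ) : (G.lev k).tgt (g.at k) = tgt g := by
  induction k with
  | zero => rfl
  | succ k ih => exact ((G.tgt_proj k _).symm.trans (congrArg (G.lev k).tgt (g.2 k))).trans ih

/-- The unit at `x`. -/
def one (G : PfGroupoid.{u, v} X) (x : X) : G.Arr := ⟨fun k => (G.lev k).one x, fun k => G.proj_one k x⟩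

/-- The inverse of an arrow. -/
def inv (g : G.Arr) : G.Arr :=
  ⟨fun k => (G.lev k).inv (g.at k),
    fun k => (G.proj_inv k _).trans (congrArg (G.lev k).inv (g.2 k))⟩

/-- The product of two composable arrows. -/
def mul (g h : G.Arr) (c : src g = tgt h) : G.Arr :=
  ⟨fun k => (G.lev k).mul (g.at k) (h.at k), fun k =>
    (G.proj_mul k _ _ ((src_at g _).trans (c.trans (tgt_at h _).symm))).trans
      (congrArg₂ (G.lev k).mul (g.2 k) (h.2 k))⟩

/-- The differential of the source map. -/
def dsrc (g : G.Arr) : Tower.Vec g →ₗ[ℝ] X.T (src g) :=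
  (Mfd.d (G.lev 0).src (g.at 0)).toLinearMap ∘ₗ LinearMap.proj 0

/-- The differential of the target map. -/
def dtgt (g : G.Arr) : Tower.Vec g →ₗ[ℝ] X.T (tgt g) :=
  (Mfd.d (G.lev 0).tgt (g.at 0)).toLinearMap ∘ₗ LinearMap.proj 0

/-- The multiplication `dm(v, w)` of composable tangent vectors, level by level. -/
def dmul (g h : G.Arr) (c : src g = tgt h) (v : Tower.Vec g) (w : Tower.Vec h) :
    Tower.Vec (mul g h c) :=
  fun k => (G.lev k).dmul (g.at k) (h.at k) (v k) (w k)

/-- The differential of the inversion. -/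
def dinv (g : G.Arr) (v : Tower.Vec g) : Tower.Vec (inv g) :=
  fun k => Mfd.d (G.lev k).inv (g.at k) (v k)

/-- The differential of the unit map. -/
def done (G : PfGroupoid.{u, v} X) (x : X) (v : X.T x) : Tower.Vec (one G x) :=
  fun k => Mfd.d (G.lev k).one x v

/-- The vertical bundle `Ker(dt)`. -/
def tgtVert (g : G.Arr) : Submodule ℝ (Tower.Vec g) :=
  Tower.Tan g ⊓ LinearMap.ker (dtgt g)

/-- The fibre at `x` of the Lie algebroid `A = Ker(ds)|_X`. -/
def A (G : PfGroupoid.{u, v} X) (x : X) : Submodule ℝ (Tower.Vec (one G x)) :=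
  Tower.Tan (one G x) ⊓ LinearMap.ker (dsrc (one G x))

/-- Smooth sections of `A`: each component is a smooth section of `A_k = Ker(ds_k)|_X`, viewed
as a map into the tangent bundle of the `k`-th groupoid. -/
def IsSection (α : ∀ x, G.A x) : Prop :=
  ∀ k, ContMDiff (𝓡 X.dim) (𝓡 (G.lev k).arr.dim).tangent ∞
    (fun x => (⟨(one G x).at k, (α x).1 k⟩ : (G.lev k).arr.TB))

/-- The anchor `ρ = dt|_A`, on sections. -/
def anchor (α : ∀ x, G.A x) (x : X) : X.T x :=
  (dtgt (one G x) (α x).1 : X.E)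

/-- The right-invariant vector field `α^R` on the arrows, `α^R_g = dR_g(α_{t(g)})`; the right
translation of an `s`-vertical vector `a` by `g` is `dm(a, 0_g)`. -/
def rightInv (α : ∀ x, G.A x) (g : G.Arr) : Tower.Vec g :=
  fun k => ((G.lev k).dmul ((one G (tgt g)).at k) (g.at k) ((α (tgt g)).1 k) 0 : (G.lev k).arr.E)

/-- The Lie bracket on sections of `A`, determined by `[α, β]^R = [α^R, β^R]`. -/
def bracket (α β : ∀ x, G.A x) (x : X) : Tower.Tan (one G x) :=
  Tower.lieBracket (rightInv α) (rightInv β) (one G x)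

/-- `(G, C)` is a Cartan groupoid: `C` is an Ehresmann connection on `t : G → X` which is
multiplicative, i.e. it is a full subgroupoid of the tangent groupoid `TG ⇉ TX`. -/
structure IsCartan (C : ∀ g : G.Arr, Submodule ℝ (Tower.Vec g)) : Prop where
  ehresmann : Tower.IsComplement C tgtVert
  dsrc_surj : ∀ g, ∀ x : X.T (src g), ∃ v ∈ C g, dsrc g v = x
  dmul_mem : ∀ (g h : G.Arr) (c : src g = tgt h), ∀ v ∈ C g, ∀ w ∈ C h,
    (dsrc g v : X.E) = dtgt h w → dmul g h c v w ∈ C (mul g h c)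
  done_mem : ∀ (x : X) (v : X.T x), done G x v ∈ C (one G x)
  dinv_mem : ∀ g, ∀ v ∈ C g, dinv g v ∈ C (inv g)

/-- The horizontal lift of a vector field on `X` along `s : G → X`: the vector field with values in
`C` which is `s`-projectable to `V`. -/
def hor (C : ∀ g : G.Arr, Submodule ℝ (Tower.Vec g)) (V : ∀ x, X.T x) (g : G.Arr) : Tower.Vec g :=
  Classical.epsilon fun v => v ∈ C g ∧ dsrc g v = V (src g)

/-- The connection on `A` of a Cartan groupoid: `∇_V α = [hor V, α^R]|_X`. -/
def nabla (C : ∀ g : G.Arr, Submodule ℝ (Tower.Vec g)) (V : ∀ x, X.T x) (α : ∀ x, G.A x) (x : X) :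
    Tower.Tan (one G x) :=
  Tower.lieBracket (hor C V) (rightInv α) (one G x)

/-- The pointwise bracket `{α, β}_pt = [α, β] - ∇_{ρ α} β + ∇_{ρ β} α`. -/
def ptBracket (C : ∀ g : G.Arr, Submodule ℝ (Tower.Vec g)) (α β : ∀ x, G.A x) (x : X) :
    Tower.Tan (one G x) :=
  bracket α β x - nabla C (anchor α) β x + nabla C (anchor β) α x

end PfGroupoid

/-! ## Principal bundles of strict pf Lie groupoids -/

/-- A strict principal bundle over `M` for a strict pf Lie groupoid: a tower of principal bundles
over `M` for the Lie groupoids of the tower, with equivariant projections. -/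
structure PfPrincipalBundle {X : Mfd.{u}} (G : PfGroupoid.{u, v} X) (M : Mfd.{w}) where
  lev : ∀ k, PrincipalBundle.{u, v, w, z} (G.lev k) M
  proj : ∀ k, (lev (k + 1)).tot → (lev k).tot
  proj_subm : ∀ k, Mfd.IsSurjSubmersion (proj k)
  pr_proj : ∀ k p, (lev k).pr (proj k p) = (lev (k + 1)).pr p
  mom_proj : ∀ k p, (lev k).mom (proj k p) = (lev (k + 1)).mom p
  proj_act : ∀ k g p, (G.lev (k + 1)).src g = (lev (k + 1)).mom p →
    proj k ((lev (k + 1)).act g p) = (lev k).act (G.proj k g) (proj k p)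

namespace PfPrincipalBundle

variable {X : Mfd.{u}} {G : PfGroupoid.{u, v} X} {M : Mfd.{w}}
variable (P : PfPrincipalBundle.{u, v, w, z} G M)

/-- The total space, a pf-manifold. -/
abbrev toTower : Tower.{z} where
  M k := (P.lev k).tot
  proj := P.proj
  proj_subm := P.proj_subm

/-- The points of the total space. -/
abbrev Pt : Type z := P.toTower.Pt

variable {P}

/-- The moment map `μ : P → X`. -/
def mom (p : P.Pt) : X := (P.lev 0).mom (p.at 0)

theorem mom_at (p : P.Pt) (k : ℕ) : (P.lev k).mom (p.at k) = mom p := by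
  induction k with
  | zero => rfl
  | succ k ih => exact ((P.mom_proj k _).symm.trans (congrArg (P.lev k).mom (p.2 k))).trans ih

/-- The differential of `μ`. -/
def dmom (p : P.Pt) : Tower.Vec p →ₗ[ℝ] X.T (mom p) :=
  (Mfd.d (P.lev 0).mom (p.at 0)).toLinearMap ∘ₗ LinearMap.proj 0

/-- The differential of `π : P → M`. -/
def dpr (p : P.Pt) : Tower.Vec p →ₗ[ℝ] M.T ((P.lev 0).pr (p.at 0)) :=
  (Mfd.d (P.lev 0).pr (p.at 0)).toLinearMap ∘ₗ LinearMap.proj 0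

/-- The action of an arrow. -/
def act (g : G.Arr) (p : P.Pt) (c : PfGroupoid.src g = mom p) : P.Pt :=
  ⟨fun k => (P.lev k).act (g.at k) (p.at k), fun k =>
    (P.proj_act k _ _ ((PfGroupoid.src_at g _).trans (c.trans (mom_at p _).symm))).trans
      (congrArg₂ (P.lev k).act (g.2 k) (p.2 k))⟩

/-- The action `da(v, w)` of a tangent vector of the groupoid on a tangent vector of `P`. -/
def dact (g : G.Arr) (p : P.Pt) (c : PfGroupoid.src g = mom p) (v : Tower.Vec g)
    (w : Tower.Vec p) : Tower.Vec (act g p c) :=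
  fun k => (P.lev k).dact (g.at k) (p.at k) (v k) (w k)

/-- The infinitesimal action `a : μ^*A → TP`. -/
def infAct (p : P.Pt) (a : G.A (mom p)) : Tower.Vec p :=
  fun k => ((P.lev k).dact ((PfGroupoid.one G (mom p)).at k) (p.at k) (a.1 k) 0 : (P.lev k).tot.E)

variable (P) in
/-- The vertical bundle `Ker(dπ)`. -/
def vert (p : P.Pt) : Submodule ℝ (Tower.Vec p) :=
  Tower.Tan p ⊓ LinearMap.ker (dpr p)

variable (P) in
/-- The distribution `Ker(dμ)` (of possibly non-constant rank). -/
def momKer (p : P.Pt) : Submodule ℝ (Tower.Vec p) :=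
  Tower.Tan p ⊓ LinearMap.ker (dmom p)

/-- `D` makes `P` into a flat `(G, C)`-structure: `D` is an Ehresmann connection on `π : P → M` with
`C · D ⊆ D`, the distribution `Ker(dμ) ∩ D` is involutive, and `D` is involutive. -/
structure IsFlatStructure (C : ∀ g : G.Arr, Submodule ℝ (Tower.Vec g))
    (D : ∀ p : P.Pt, Submodule ℝ (Tower.Vec p)) : Prop where
  ehresmann : Tower.IsComplement D P.vert
  dact_mem : ∀ (g : G.Arr) (p : P.Pt) (c : PfGroupoid.src g = mom p), ∀ v ∈ C g, ∀ w ∈ D p,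
    (PfGroupoid.dsrc g v : X.E) = dmom p w → dact g p c v w ∈ D (act g p c)
  momKer_involutive : Tower.IsInvolutive (fun p => P.momKer p ⊓ D p)
  flat : Tower.IsInvolutive D

/-- Smooth sections of `μ^*A`: each component comes from a smooth map `P_m → T G_k`
(with values in `A_k`), for some `m`. -/
def IsSection (σ : ∀ p : P.Pt, G.A (mom p)) : Prop :=
  ∀ k, ∃ (m : ℕ) (F : (P.lev m).tot → (G.lev k).arr.TB),
    ContMDiff (𝓡 (P.lev m).tot.dim) (𝓡 (G.lev k).arr.dim).tangent ∞ F ∧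
    ∀ p : P.Pt, F (p.at m) = ⟨(PfGroupoid.one G (mom p)).at k, (σ p).1 k⟩

variable (P) in
/-- Fibrewise linear maps `TP → μ^*A`. -/
abbrev PreForm : Type z := ∀ p : P.Pt, Tower.Tan p →ₗ[ℝ] G.A (mom p)

/-- `θ` is a smooth 1-form, `θ ∈ Ω¹(P, μ^*A)`: each component comes from a smooth map
`T P_m → T G_k` (with values in `A_k`), for some `m`. -/
def IsForm (θ : P.PreForm) : Prop :=
  ∀ k, ∃ (m : ℕ) (F : (P.lev m).tot.TB → (G.lev k).arr.TB),
    ContMDiff (𝓡 (P.lev m).tot.dim).tangent (𝓡 (G.lev k).arr.dim).tangent ∞ F ∧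
    ∀ (p : P.Pt) (v : Tower.Tan p),
      F ⟨p.at m, v.1 m⟩ = ⟨(PfGroupoid.one G (mom p)).at k, (θ p v).1 k⟩

/-- The kernel of a 1-form, a family of subspaces of the tangent spaces. -/
def ker (θ : P.PreForm) (p : P.Pt) : Submodule ℝ (Tower.Vec p) :=
  (LinearMap.ker (θ p)).map (Tower.Tan p).subtype

/-- `θ(a(α)) = α`. -/
def Reproduces (θ : P.PreForm) : Prop :=
  ∀ (p : P.Pt) (α : G.A (mom p)), ∃ h : infAct p α ∈ Tower.Tan p, θ p ⟨infAct p α, h⟩ = α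

/-- `Δ : Γ(μ^*A) → Ω¹(P, μ^*A)` is the pull-back along `μ` of the connection `∇` of `(G, C)`: the
connection on `μ^*A` (a derivation, continuous in the sense that each component of `Δ σ` depends
only on some component of `σ`) with `Δ_v (μ^*α) = ∇_{dμ(v)} α`. It is unique on smooth sections. -/
structure IsPullbackConnection (C : ∀ g : G.Arr, Submodule ℝ (Tower.Vec g))
    (Δ : (∀ p : P.Pt, G.A (mom p)) → P.PreForm) : Prop where
  smooth : ∀ σ, IsSection σ → IsForm (Δ σ)
  add : ∀ σ τ, IsSection σ → IsSection τ → ∀ p, Δ (fun q => σ q + τ q) p = Δ σ p + Δ τ p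
  leibniz : ∀ (f : P.Pt → ℝ) (σ), Tower.IsSmoothFun f → IsSection σ → ∀ p (v : Tower.Tan p),
    Δ (fun q => f q • σ q) p v = Tower.deriv f v.1 • σ p + f p • Δ σ p v
  cont : ∀ k, ∃ m, ∀ σ, IsSection σ → (∀ p, (σ p).1 m = 0) →
    ∀ p (v : Tower.Tan p), (Δ σ p v).1 k = 0
  natural : ∀ (α : ∀ x, G.A x) (V : ∀ x, X.T x), PfGroupoid.IsSection α → Mfd.IsVectorField V →
    ∀ p (v : Tower.Tan p), dmom p v.1 = V (mom p) →
      (Δ (fun q => α (mom q)) p v : Tower.Vec (PfGroupoid.one G (mom p)))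
        = PfGroupoid.nabla C V α (mom p)

/-- The Maurer-Cartan equation `d_{μ^*A} θ + ½ {θ, θ}_pt = 0`. For vector fields `Y`, `Z` on `P`,
`(d_{μ^*A} θ)(Y, Z) = Δ_Y (θ Z) - Δ_Z (θ Y) - θ [Y, Z]`, where `Δ` is the pull-back connection, and
`(½ {θ, θ}_pt)(Y, Z) = {θ Y, θ Z}_pt`, which at `p` is evaluated by means of sections `α`, `β` of `A`
that take the values `θ Y` and `θ Z` at `μ p`. -/
def MaurerCartan (C : ∀ g : G.Arr, Submodule ℝ (Tower.Vec g)) (θ : P.PreForm) : Prop :=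
  ∃ Δ : (∀ p : P.Pt, G.A (mom p)) → P.PreForm, IsPullbackConnection C Δ ∧
    ∀ Y Z : ∀ p : P.Pt, Tower.Tan p,
      Tower.IsVectorField (fun p => (Y p : Tower.Vec p)) →
      Tower.IsVectorField (fun p => (Z p : Tower.Vec p)) →
      ∀ (p : P.Pt) (α β : ∀ x, G.A x), PfGroupoid.IsSection α → PfGroupoid.IsSection β →
        α (mom p) = θ p (Y p) → β (mom p) = θ p (Z p) →
        ((Δ (fun q => θ q (Z q)) p (Y p) - Δ (fun q => θ q (Y q)) p (Z p)
            - θ p (Tower.lieBracket (fun q => (Y q : Tower.Vec q)) (fun q => (Z q : Tower.Vec q)) p) :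
            G.A (mom p)) : Tower.Vec (PfGroupoid.one G (mom p)))
          + (PfGroupoid.ptBracket C α β (mom p) : Tower.Vec (PfGroupoid.one G (mom p))) = 0

end PfPrincipalBundle

end

/-! A complement of ker(dπ) and a form that reproduces the infinitesimal action are the same datum:
fundamental vectors fill the vertical bundle, so a tangent vector is uniquely the sum of a vector of
the complement and a fundamental vector, and `θ` reads off the generator of the latter
(`exists_form`, `isComplement_ker`, `Reproduces.ext`). The substance is the relation between the
Maurer-Cartan equation on one side and invariance under `C` together with involutivity on the other.

Everything is tested on scalar 1-forms at finite levels. For a function `F` on the `k`-th groupoid,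
η = dF ∘ θ is a 1-form on some level of `P`, and ζ, the composite of dF with the right-trivialized
projection of TG to ker(ds) along `C`, is a 1-form on some level of `G`. Cartan's formula on
horizontal and right-invariant fields expresses the connection, the bracket and the pointwise
bracket at the units through dζ (`D_nabla`, `D_bracket`, `D_ptBracket`). The Maurer-Cartan equation
thereby becomes a pointwise formula for dη in terms of dζ.

The bridge is `IsScalarForm.hasDerivAt_dact`. A tangent vector v of `G` differs from the vector of
`C` with the same image under ds by an s-vertical one, which acts as a fundamental vector; hence
η(v·w) = η(hor·w) + ζ(v), by `IsScalarForm.dact_eq`. In a two-parameter family e(s, ε) q(s) with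
e(0, 0) a unit, the mixed derivatives of η and ζ yield dη and dζ, and the difference dζ - dη is the
ε-derivative of the transport term η(hor·w).

From flat to Maurer-Cartan (`maurerCartan_of_flat`): if the kernel is invariant under `C`, the
transport term of a kernel vector is zero, which gives dη on all pairs with a fundamental argument;
involutivity gives dη = 0 on pairs of kernel vectors. By bilinearity dη is known, and its value is
the one that the equation demands. Connectedness plays no role here.

From Maurer-Cartan to flat (`isFlatStructure_ker`): dη vanishes on the kernel, which is therefore
involutive. For invariance, let w in the kernel be transported by the vectors of `C` along a curve
in an s-fibre. The bridge and the formula for dη show that `θ` of the transported vector solves a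
homogeneous linear differential equation (`hasDerivAt_transport`), which closes up in the `k`-th
component (`transportDeriv_eq_sum`). Vanishing thus propagates along curves; the arrows at which it
holds form an open and closed subset of the s-fibre which contains the unit, and connectedness
finishes the proof (`dact_mem_ker`). -/

noncomputable section

/-! ### Tangent vectors tested on functions, and smoothness of maps into tangent bundles. -/

section

namespace Mfd

variable {M : Mfd.{u}} {N : Mfd.{v}} {L : Mfd.{w}} {B : Mfd.{z}}

/-- The differential of a real function, as a function on the tangent bundle. -/
def D (f : N → ℝ) (u : N.TB) : ℝ := mfderiv (𝓡 N.dim) 𝓘(ℝ, ℝ) f u.1 u.2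

/-- The tangent map of a map between manifolds. -/
def TM (f : M → N) (u : M.TB) : N.TB := ⟨f u.1, d f u.1 u.2⟩

/-- Smooth real functions. -/
def SmoothFn (f : N → ℝ) : Prop := ContMDiff (𝓡 N.dim) 𝓘(ℝ, ℝ) ∞ f

theorem SmoothFn.mdiff {f : N → ℝ} (hf : SmoothFn f) (x : N) :
    MDifferentiableAt (𝓡 N.dim) 𝓘(ℝ, ℝ) f x :=
  (hf x).mdifferentiableAt (by simp)

theorem Smooth.mdiff {f : M → N} (hf : Smooth f) (x : M) :
    MDifferentiableAt (𝓡 M.dim) (𝓡 N.dim) f x :=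
  (hf x).mdifferentiableAt (by simp)

theorem TB_ext {u u' : N.TB} (h : u.1 = u'.1) (h2 : (u.2 : N.E) = u'.2) : u = u' := by
  cases u; cases u'; cases h; cases h2; rfl

theorem Smooth.TM {f : M → N} (hf : Smooth f) :
    ContMDiff (𝓡 M.dim).tangent (𝓡 N.dim).tangent ∞ (TM f) :=
  ContMDiff.contMDiff_tangentMap hf (by simp)

theorem SmoothFn.D {f : N → ℝ} (hf : SmoothFn f) :
    ContMDiff (𝓡 N.dim).tangent 𝓘(ℝ, ℝ) ∞ (D f) :=
  (contMDiff_snd_tangentBundle_modelSpace ℝ 𝓘(ℝ, ℝ)).comp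
    (ContMDiff.contMDiff_tangentMap (m := ∞) hf (by simp))

theorem D_comp {F : N → ℝ} {f : M → N} (hF : SmoothFn F) (hf : Smooth f) (u : M.TB) :
    D (F ∘ f) u = D F (TM f u) := by
  have := mfderiv_comp u.1 (hF.mdiff (f u.1)) (hf.mdiff u.1)
  exact congrArg (fun l => l u.2) this

theorem TM_comp {g : N → L} {f : M → N} (hg : Smooth g) (hf : Smooth f) (u : M.TB) :
    TM (g ∘ f) u = TM g (TM f u) := by
  have := mfderiv_comp u.1 (hg.mdiff (f u.1)) (hf.mdiff u.1)
  exact TB_ext rfl (congrArg (fun l => l u.2) this)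

theorem D_add_vec (f : N → ℝ) (x : N) (v w : N.T x) : D f ⟨x, v + w⟩ = D f ⟨x, v⟩ + D f ⟨x, w⟩ :=
  (mfderiv (𝓡 N.dim) 𝓘(ℝ, ℝ) f x).map_add v w

theorem D_sub_vec (f : N → ℝ) (x : N) (v w : N.T x) : D f ⟨x, v - w⟩ = D f ⟨x, v⟩ - D f ⟨x, w⟩ :=
  (mfderiv (𝓡 N.dim) 𝓘(ℝ, ℝ) f x).map_sub v w

theorem D_smul_vec (f : N → ℝ) (x : N) (c : ℝ) (v : N.T x) : D f ⟨x, c • v⟩ = c * D f ⟨x, v⟩ :=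
  (mfderiv (𝓡 N.dim) 𝓘(ℝ, ℝ) f x).map_smul c v

theorem D_zero_vec (f : N → ℝ) (x : N) : D f ⟨x, (0 : N.T x)⟩ = 0 :=
  (mfderiv (𝓡 N.dim) 𝓘(ℝ, ℝ) f x).map_zero

theorem D_congr {f g : N → ℝ} {u : N.TB} (h : f =ᶠ[nhds u.1] g) : D f u = D g u := by
  unfold D
  exact congrArg (fun l : N.E →L[ℝ] ℝ => l u.2) h.mfderiv_eq

open Bundle in
/-- Local coordinates and frames, by functions and vector fields defined globally. -/
theorem exists_coords (y : N) : ∃ (Φ : Fin N.dim → N → ℝ) (V : Fin N.dim → ∀ x : N, N.T x),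
    (∀ i, SmoothFn (Φ i)) ∧ (∀ i, IsVectorField (V i)) ∧
    ∀ᶠ x in nhds y, ∀ v : N.T x, v = ∑ i, D (Φ i) ⟨x, v⟩ • V i x := by
  -- The chart and its frame exist only near `y`; multiplying both by `χ` makes them global and
  -- changes nothing where `χ = 1`.
  let χ : SmoothBumpFunction (𝓡 N.dim) y := Classical.choice inferInstance
  let e := trivializationAt (N.E) (TangentSpace (𝓡 N.dim) (M := N)) y
  let b := (EuclideanSpace.basisFun (Fin N.dim) ℝ).toBasis
  refine ⟨fun i x => (χ x • extChartAt (𝓡 N.dim) y x : N.E) i,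
    fun i x => χ x • e.localFrame b i x, ?_, ?_, ?_⟩
  · intro i
    have h1 : ContMDiff (𝓡 N.dim) 𝓘(ℝ, N.E) ∞ (fun x => χ x • extChartAt (𝓡 N.dim) y x) :=
      χ.contMDiff_smul contMDiffOn_extChartAt
    exact (EuclideanSpace.proj (𝕜 := ℝ) i).contMDiff.comp h1
  · intro i
    refine ContMDiffOn.smul_section_of_tsupport (u := e.baseSet) χ.contMDiff.contMDiffOn e.open_baseSet ?_
      (e.contMDiffOn_localFrame_baseSet ∞ b i)
    exact χ.tsupport_subset_chartAt_source
  · have h0 : ∀ᶠ x in nhds y, x ∈ (chartAt N.E y).source :=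
      (chartAt N.E y).open_source.mem_nhds (mem_chart_source _ _)
    filter_upwards [χ.eventuallyEq_one.eventuallyEq_nhds, h0] with x hx hx0 v
    have hb : x ∈ e.baseSet := hx0
    have hD : ∀ i, D (fun x => (χ x • extChartAt (𝓡 N.dim) y x : N.E) i) ⟨x, v⟩
        = b.repr (e.continuousLinearMapAt ℝ x v) i := by
      intro i
      have h2 : (fun x => (χ x • extChartAt (𝓡 N.dim) y x : N.E) i) =ᶠ[nhds x]
          (fun x => EuclideanSpace.proj (𝕜 := ℝ) i (extChartAt (𝓡 N.dim) y x)) := by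
        filter_upwards [hx] with z hz
        rw [hz]; simp
      rw [D_congr h2]
      have h3 := (EuclideanSpace.proj i : N.E →L[ℝ] ℝ).hasMFDerivAt
        (x := extChartAt (𝓡 N.dim) y x)
      have h4 := (mdifferentiableAt_extChartAt (I := 𝓡 N.dim) hx0).hasMFDerivAt
      have h5 := (h3.comp x h4).mfderiv
      rw [TangentBundle.continuousLinearMapAt_trivializationAt hx0]
      exact congrArg (fun l : N.E →L[ℝ] ℝ => l v) h5
    have hx1 : χ x = 1 := hx.self_of_nhds
    have key := (e.basisAt b hb).sum_repr v
    refine key.symm.trans (Finset.sum_congr rfl fun i _ => ?_)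
    rw [hD i]
    simp only [hx1, one_smul, e.localFrame_apply_of_mem_baseSet b hb]
    congr 1
    have h6 : e.continuousLinearMapAt ℝ x v = e.linearEquivAt ℝ x hb v := by
      simp [Trivialization.linearMapAt_apply, hb]
    rw [h6]
    rfl

/-- This reduces vector identities to identities between the scalars `D F`, the form in which all
later computations are made. -/
theorem vec_ext_D {y : N} {v w : N.T y} (h : ∀ F : N → ℝ, SmoothFn F → D F ⟨y, v⟩ = D F ⟨y, w⟩) :
    v = w := by
  obtain ⟨Φ, V, hΦ, -, hc⟩ := exists_coords y
  rw [hc.self_of_nhds v, hc.self_of_nhds w]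
  exact Finset.sum_congr rfl fun i _ => by rw [h _ (hΦ i)]

theorem TB_ext_D {u u' : N.TB} (h : u.1 = u'.1) (h2 : ∀ F : N → ℝ, SmoothFn F → D F u = D F u') :
    u = u' := by
  obtain ⟨x, v⟩ := u
  obtain ⟨x', v'⟩ := u'
  obtain rfl : x = x' := h
  exact TB_ext rfl (vec_ext_D h2)

theorem exists_vectorField (y : N) (v : N.T y) :
    ∃ V : ∀ x : N, N.T x, IsVectorField V ∧ V y = v := by
  obtain ⟨Φ, V, -, hV, hc⟩ := exists_coords y
  refine ⟨fun x => ∑ i, D (Φ i) ⟨y, v⟩ • V i x, ?_, (hc.self_of_nhds v).symm⟩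
  refine ContMDiff.sum_section fun i _ => ?_
  exact ContMDiff.smul_section (f := fun _ => D (Φ i) ⟨y, v⟩) contMDiff_const (hV i)

variable {EK : Type*} [NormedAddCommGroup EK] [NormedSpace ℝ EK] {HK : Type*} [TopologicalSpace HK]
  {I : ModelWithCorners ℝ EK HK} {K : Type*} [TopologicalSpace K] [ChartedSpace HK K]

open Bundle in
/-- A map into a tangent bundle is smooth if its base point and its pairings with the differentials
of smooth functions are. -/
theorem contMDiffAt_TB {F : K → N.TB} {k : K}
    (h1 : ContMDiffAt I (𝓡 N.dim) ∞ (fun k => (F k).1) k)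
    (h2 : ∀ f : N → ℝ, SmoothFn f → ContMDiffAt I 𝓘(ℝ, ℝ) ∞ (fun k => D f (F k)) k) :
    ContMDiffAt I (𝓡 N.dim).tangent ∞ F k := by
  obtain ⟨Φ, V, hΦ, hV, hc⟩ := exists_coords (F k).1
  refine contMDiffAt_totalSpace.mpr ⟨h1, ?_⟩
  set e := trivializationAt (N.E) (TangentSpace (𝓡 N.dim) (M := N)) (F k).1 with he
  have h3 : ∀ i, ContMDiffAt I 𝓘(ℝ, N.E) ∞ (fun l => (e ⟨(F l).1, V i (F l).1⟩).2) k := fun i =>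
    (contMDiffAt_totalSpace.mp ((hV i).contMDiffAt.comp k h1)).2
  -- The vector is recovered as ∑ dΦᵢ(F l) Vᵢ, whose coefficients are smooth by hypothesis.
  have h4 : ContMDiffAt I 𝓘(ℝ, N.E) ∞
      (fun l => ∑ i, D (Φ i) (F l) • (e ⟨(F l).1, V i (F l).1⟩).2) k :=
    ContMDiffAt.sum fun i _ => (h2 _ (hΦ i)).smul (h3 i)
  refine h4.congr_of_eventuallyEq ?_
  have hb : ∀ᶠ x in nhds (F k).1, x ∈ e.baseSet :=
    e.open_baseSet.mem_nhds (mem_baseSet_trivializationAt _ _ _)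
  filter_upwards [h1.continuousAt.eventually hc, h1.continuousAt.eventually hb] with l hl hl'
  have h5 : ∀ v : N.T (F l).1, (e ⟨(F l).1, v⟩).2 = e.continuousLinearMapAt ℝ (F l).1 v := by
    intro v
    simp [Trivialization.linearMapAt_apply, hl']
  have h6 := hl (F l).2
  have h7 : (e (F l)).2 = e.continuousLinearMapAt ℝ (F l).1 (∑ i, D (Φ i) (F l) • V i (F l).1) :=
    (h5 (F l).2).trans (congrArg _ h6)
  rw [h7, map_sum]
  refine Finset.sum_congr rfl fun i _ => ?_
  rw [map_smul, h5]

theorem contMDiff_TB {F : K → N.TB} (h1 : ContMDiff I (𝓡 N.dim) ∞ (fun k => (F k).1))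
    (h2 : ∀ f : N → ℝ, SmoothFn f → ContMDiff I 𝓘(ℝ, ℝ) ∞ (fun k => D f (F k))) :
    ContMDiff I (𝓡 N.dim).tangent ∞ F :=
  fun k => contMDiffAt_TB (h1 k) fun f hf => h2 f hf k

theorem contMDiff_proj {F : K → N.TB} (h : ContMDiff I (𝓡 N.dim).tangent ∞ F) :
    ContMDiff I (𝓡 N.dim) ∞ (fun k => (F k).1) :=
  (Bundle.contMDiff_proj (TangentSpace (𝓡 N.dim) (M := N))).comp h

end Mfd

end

/-! ### Retractions onto the fibres of submersions. -/

section

namespace Mfd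

/-- Submersions between vector spaces have smooth local retractions onto their fibres. -/
theorem exists_fibre_retraction {E F : Type*} [NormedAddCommGroup E] [NormedSpace ℝ E] [FiniteDimensional ℝ E]
    [NormedAddCommGroup F] [NormedSpace ℝ F] [FiniteDimensional ℝ F] {f : E → F} {W : Set E}
    (hW : IsOpen W) (hf : ContDiffOn ℝ ∞ f W) {x₀ : E} (hx₀ : x₀ ∈ W)
    (hs : Function.Surjective (fderiv ℝ f x₀)) :
    ∃ (U : Set (F × E)) (R : F × E → E), IsOpen U ∧ (f x₀, x₀) ∈ U ∧ ContDiffOn ℝ ∞ R U ∧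
      (∀ q ∈ U, R q ∈ W ∧ f (R q) = q.1) ∧ ∀ x, (f x, x) ∈ U → R (f x, x) = x := by
  obtain ⟨B, hB⟩ : ∃ B : F →L[ℝ] E, (fderiv ℝ f x₀).comp B = ContinuousLinearMap.id ℝ F := by
    obtain ⟨g, hg⟩ := (fderiv ℝ f x₀).toLinearMap.exists_rightInverse_of_surjective
      (LinearMap.range_eq_top.mpr hs)
    exact ⟨LinearMap.toContinuousLinearMap g, by ext x; exact congrArg (fun l => l x) hg⟩
  -- Since `B` splits the differential, moving `x` by `B z` changes `f` by `z` to first order. So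
  -- `Ξ` is a local diffeomorphism at `(x₀, 0)`, and solving `Ξ (x, z) = (x, value)` tells how to
  -- move `x` into the prescribed fibre.
  let Ξ : E × F → E × F := fun p => (p.1, f (p.1 + B p.2))
  let W' : Set (E × F) := (fun p : E × F => p.1 + B p.2) ⁻¹' W
  have hW' : IsOpen W' := hW.preimage (by fun_prop)
  have hΞ : ContDiffOn ℝ ∞ Ξ W' :=
    contDiffOn_fst.prodMk (hf.comp (t := W) (by fun_prop) fun p hp => hp)
  have h0 : (x₀, (0 : F)) ∈ W' := by simpa [W'] using hx₀
  have hΞ0 : ContDiffAt ℝ ∞ Ξ (x₀, 0) := hΞ.contDiffAt (hW'.mem_nhds h0)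
  have hfd : HasFDerivAt f (fderiv ℝ f x₀) x₀ :=
    ((hf.contDiffAt (hW.mem_nhds hx₀)).differentiableAt (by simp)).hasFDerivAt
  let A : (E × F) ≃L[ℝ] (E × F) := ContinuousLinearEquiv.equivOfInverse
    ((ContinuousLinearMap.fst ℝ E F).prod
      ((fderiv ℝ f x₀).comp (ContinuousLinearMap.fst ℝ E F) + ContinuousLinearMap.snd ℝ E F))
    ((ContinuousLinearMap.fst ℝ E F).prod
      (ContinuousLinearMap.snd ℝ E F - (fderiv ℝ f x₀).comp (ContinuousLinearMap.fst ℝ E F)))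
    (fun p => by simp) (fun p => by simp)
  have hA : HasFDerivAt Ξ (A : (E × F) →L[ℝ] (E × F)) (x₀, 0) := by
    have h1 : HasFDerivAt (fun p : E × F => p.1 + B p.2)
        (ContinuousLinearMap.fst ℝ E F + B.comp (ContinuousLinearMap.snd ℝ E F)) (x₀, 0) :=
      hasFDerivAt_fst.add (B.hasFDerivAt.comp _ hasFDerivAt_snd)
    have h2 := HasFDerivAt.comp (x := (x₀, (0 : F))) (g := f) (g' := fderiv ℝ f x₀)
      (f := fun p : E × F => p.1 + B p.2) (by simpa using hfd) h1
    have h3 := (hasFDerivAt_fst (𝕜 := ℝ) (p := (x₀, (0 : F)))).prodMk h2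
    convert! h3 using 1
    ext p
    · rfl
    · simp [A]
    · rfl
    · have := congrArg (fun l => l p) hB
      simpa [A] using this.symm
  let e := hΞ0.toOpenPartialHomeomorph Ξ hA (by simp)
  have he : ∀ p, e p = Ξ p := fun p => rfl
  -- The local inverse has to be smooth at all nearby points, which requires an invertible
  -- derivative at each of them and not only at the centre.
  have hinv : ∀ᶠ p in nhds (x₀, (0 : F)), ∃ A' : (E × F) ≃L[ℝ] (E × F),
      (A' : (E × F) →L[ℝ] (E × F)) = fderiv ℝ Ξ p := by
    have hc : ContinuousAt (fderiv ℝ Ξ) (x₀, 0) := hΞ0.continuousAt_fderiv (by simp)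
    have := ContinuousLinearEquiv.isOpen (𝕜 := ℝ) (E := E × F) (F := E × F)
    refine hc.eventually (this.mem_nhds ?_)
    rw [hA.fderiv]
    exact ⟨A, rfl⟩
  obtain ⟨G, hG, hGo, hG0⟩ := eventually_nhds_iff.mp
    (hinv.and ((hW'.mem_nhds h0 : ∀ᶠ p in nhds (x₀, (0 : F)), p ∈ W')))
  let U' : Set (E × F) := e.target ∩ e.symm ⁻¹' G
  have hU' : IsOpen U' := e.isOpen_inter_preimage_symm hGo
  -- The second condition puts `(x, 0)` into the source of the local diffeomorphism; this is what
  -- gives `R (f x, x) = x`.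
  let U : Set (F × E) := (fun q : F × E => (q.2, q.1)) ⁻¹' U' ∩ (fun q : F × E => (q.2, (0 : F))) ⁻¹' e.source
  have hes : (x₀, (0 : F)) ∈ e.source := hΞ0.mem_toOpenPartialHomeomorph_source hA (by simp)
  have hΞx : Ξ (x₀, 0) = (x₀, f x₀) := by simp [Ξ]
  refine ⟨U, fun q => q.2 + B (e.symm (q.2, q.1)).2, ?_, ?_, ?_, ?_, ?_⟩
  · exact (hU'.preimage (by fun_prop)).inter (e.open_source.preimage (by fun_prop))
  · refine ⟨⟨?_, ?_⟩, hes⟩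
    · have := e.map_source hes
      rwa [he, hΞx] at this
    · have := e.left_inv hes
      rw [he, hΞx] at this
      change e.symm (x₀, f x₀) ∈ G
      rw [this]; exact hG0
  · intro q hq
    refine ContDiffAt.contDiffWithinAt ?_
    obtain ⟨A', hA'⟩ := (hG _ hq.1.2).1
    have hd : ContDiffAt ℝ ∞ Ξ (e.symm (q.2, q.1)) :=
      hΞ.contDiffAt (hW'.mem_nhds (hG _ hq.1.2).2)
    have h1 : ContDiffAt ℝ ∞ e.symm (q.2, q.1) := by
      refine e.contDiffAt_symm (f₀' := A') hq.1.1 ?_ hd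
      rw [hA']
      exact (hd.differentiableAt (by simp)).hasFDerivAt
    have h2 : ContDiffAt ℝ ∞ (fun q : F × E => e.symm (q.2, q.1)) q :=
      ContDiffAt.comp q (f := fun q : F × E => (q.2, q.1)) h1 (by fun_prop)
    exact contDiffAt_snd.add (B.contDiff.contDiffAt.comp q (contDiffAt_snd.comp q h2))
  · intro q hq
    have h1 : Ξ (e.symm (q.2, q.1)) = (q.2, q.1) := e.right_inv hq.1.1
    have h2 : (e.symm (q.2, q.1)).1 = q.2 := congrArg Prod.fst h1
    have h3 := congrArg Prod.snd h1
    have h4 := (hG _ hq.1.2).2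
    simp only [Ξ, h2] at h3
    change (e.symm (q.2, q.1)).1 + B (e.symm (q.2, q.1)).2 ∈ W at h4
    rw [h2] at h4
    exact ⟨h4, h3⟩
  · intro x hx
    have := e.left_inv hx.2
    rw [he] at this
    simp only [Ξ, map_zero, add_zero] at this
    simp [this]

variable {M : Mfd.{u}} {N : Mfd.{v}} {L : Mfd.{w}} {B : Mfd.{z}}

/-- Local retractions onto the fibres of a map that is a submersion at `x₀`. -/
theorem exists_retraction {f : M → N} (hf : Smooth f) {x₀ : M} (hs : Function.Surjective (d f x₀)) :
    ∃ (U : Set (N × M)) (R : N × M → M), IsOpen U ∧ (f x₀, x₀) ∈ U ∧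
      ContMDiffOn ((𝓡 N.dim).prod (𝓡 M.dim)) (𝓡 M.dim) ∞ R U ∧
      (∀ q ∈ U, f (R q) = q.1) ∧ (∀ x, (f x, x) ∈ U → R (f x, x) = x) := by
  let ψ := extChartAt (𝓡 M.dim) x₀
  let φ := extChartAt (𝓡 N.dim) (f x₀)
  let fh : M.E → N.E := fun a => φ (f (ψ.symm a))
  let W : Set M.E := ψ.target ∩ ψ.symm ⁻¹' (f ⁻¹' φ.source)
  have hφ : IsOpen φ.source := isOpen_extChartAt_source _
  have hψ : IsOpen ψ.source := isOpen_extChartAt_source _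
  have hW : IsOpen W := (continuousOn_extChartAt_symm x₀).isOpen_inter_preimage
    (isOpen_extChartAt_target x₀) (hφ.preimage hf.continuous)
  have hfh : ContMDiffOn 𝓘(ℝ, M.E) 𝓘(ℝ, N.E) ∞ fh W := by
    have h1 : ContMDiffOn 𝓘(ℝ, M.E) (𝓡 N.dim) ∞ (fun a => f (ψ.symm a)) W :=
      hf.comp_contMDiffOn ((contMDiffOn_extChartAt_symm x₀).mono inter_subset_left)
    refine (contMDiffOn_extChartAt (x := f x₀)).comp h1 fun a ha => ?_
    have := ha.2
    simpa [φ] using this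
  have hx : ψ x₀ ∈ W := by
    refine ⟨mem_extChartAt_target x₀, ?_⟩
    simp only [mem_preimage]
    rw [(extChartAt_to_inv x₀ : ψ.symm (ψ x₀) = x₀)]
    exact mem_extChartAt_source (f x₀)
  have hsurj : Function.Surjective (fderiv ℝ fh (ψ x₀)) := by
    have h1 : d f x₀ = fderivWithin ℝ fh (range (𝓡 M.dim)) (ψ x₀) := (hf.mdiff x₀).mfderiv
    have h2 : range (𝓡 M.dim) = univ := by simp
    rw [h2, fderivWithin_univ] at h1
    rw [← h1]
    exact hs
  obtain ⟨U, R, hU, hU0, hR, hR1, hR2⟩ := exists_fibre_retraction hW hfh.contDiffOn hx hsurj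
  let U' : Set (N × M) := (φ.source ×ˢ (ψ.source ∩ f ⁻¹' φ.source)) ∩
    (fun q : N × M => (φ q.1, ψ q.2)) ⁻¹' U
  have hc : ContMDiffOn ((𝓡 N.dim).prod (𝓡 M.dim)) 𝓘(ℝ, N.E × M.E) ∞
      (fun q : N × M => (φ q.1, ψ q.2)) (φ.source ×ˢ (ψ.source ∩ f ⁻¹' φ.source)) := by
    refine ContMDiffOn.prodMk_space ?_ ?_
    · refine (contMDiffOn_extChartAt (x := f x₀)).comp contMDiffOn_fst fun q hq => ?_
      simpa [φ] using hq.1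
    · refine (contMDiffOn_extChartAt (x := x₀)).comp contMDiffOn_snd fun q hq => ?_
      simpa [ψ] using hq.2.1
  have hfx : ∀ x ∈ ψ.source, fh (ψ x) = φ (f x) := fun x hx => by
    simp only [fh]; rw [ψ.left_inv hx]
  refine ⟨U', fun q => ψ.symm (R (φ q.1, ψ q.2)), ?_, ?_, ?_, ?_, ?_⟩
  · exact hc.continuousOn.isOpen_inter_preimage
      (hφ.prod (hψ.inter (hφ.preimage hf.continuous))) hU
  · refine ⟨⟨mem_extChartAt_source _, mem_extChartAt_source _, mem_extChartAt_source _⟩, ?_⟩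
    have h := hU0
    rwa [hfx _ (mem_extChartAt_source _)] at h
  · refine (contMDiffOn_extChartAt_symm x₀).comp
      (hR.contMDiffOn.comp (hc.mono inter_subset_left) fun q hq => hq.2) fun q hq => ?_
    exact (hR1 _ hq.2).1.1
  · intro q hq
    have h1 := (hR1 _ hq.2).1.2
    have h2 := (hR1 _ hq.2).2
    exact φ.injOn h1 hq.1.1 h2
  · intro x hx
    have h1 := hfx x hx.1.2.1
    have h2 := hR2 (ψ x) (by rw [h1]; exact hx.2)
    rw [h1] at h2
    change ψ.symm (R (φ (f x), ψ x)) = x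
    rw [h2, ψ.left_inv hx.1.2.1]

/-- The differential of a retraction onto the fibres. -/
theorem mfderiv_retraction {f : M → N} (hf : Smooth f) {U : Set (N × M)} {R : N × M → M} (hU : IsOpen U)
    (hR : ContMDiffOn ((𝓡 N.dim).prod (𝓡 M.dim)) (𝓡 M.dim) ∞ R U)
    (h : ∀ x, (f x, x) ∈ U → R (f x, x) = x) {x : M} (hx : (f x, x) ∈ U) (v : M.T x) :
    (mfderiv ((𝓡 N.dim).prod (𝓡 M.dim)) (𝓡 M.dim) R (f x, x) (d f x v, v) : M.E) = v := by
  have h1 : HasMFDerivAt ((𝓡 N.dim).prod (𝓡 M.dim)) (𝓡 M.dim) R (f x, x) _ :=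
    ((hR.contMDiffAt (hU.mem_nhds hx)).mdifferentiableAt (by simp)).hasMFDerivAt
  have h2 : HasMFDerivAt (𝓡 M.dim) ((𝓡 N.dim).prod (𝓡 M.dim)) (fun x => (f x, x)) x _ :=
    (hf.mdiff x).hasMFDerivAt.prodMk (hasMFDerivAt_id x)
  have h3 := HasMFDerivAt.comp (g := R) (f := fun x => (f x, x)) x h1 h2
  have h4 : (R ∘ fun x => (f x, x)) =ᶠ[nhds x] id := by
    have hc : Continuous (fun x => (f x, x)) := hf.continuous.prodMk continuous_id
    filter_upwards [hc.continuousAt.preimage_mem_nhds (hU.mem_nhds hx)] with y hy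
    exact h y hy
  have h5 := (h3.congr_of_eventuallyEq h4.symm).mfderiv
  rw [mfderiv_id] at h5
  exact (congrArg (fun l : M.E →L[ℝ] M.E => l v) h5).symm

end Mfd

end

/-! ### Curves, two-parameter families, and differentials of maps along fibre products. -/

section

namespace Mfd

variable {M : Mfd.{u}} {N : Mfd.{v}} {L : Mfd.{w}} {B : Mfd.{z}}

/-- The directional derivative of a map from a vector space to a manifold. -/
def dir {E : Type*} [NormedAddCommGroup E] [NormedSpace ℝ E] (e : E → N) (z w : E) : N.TB :=
  ⟨e z, mfderiv 𝓘(ℝ, E) (𝓡 N.dim) e z w⟩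

section dir

variable {E : Type*} [NormedAddCommGroup E] [NormedSpace ℝ E]
  {E' : Type*} [NormedAddCommGroup E'] [NormedSpace ℝ E']

/-- Smooth maps from a vector space to a manifold. -/
def Fam (e : E → N) : Prop := ContMDiff 𝓘(ℝ, E) (𝓡 N.dim) ∞ e

theorem Fam.mdiff {e : E → N} (he : Fam e) (z : E) : MDifferentiableAt 𝓘(ℝ, E) (𝓡 N.dim) e z :=
  (he z).mdifferentiableAt (by simp)

theorem Fam.comp {e : E → M} (he : Fam e) {f : M → N} (hf : Smooth f) : Fam (f ∘ e) :=
  ContMDiff.comp hf he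

theorem Fam.comp_left {e : E → M} (he : Fam e) {g : E' → E} (hg : ContDiff ℝ ∞ g) : Fam (e ∘ g) :=
  ContMDiff.comp he hg.contMDiff

theorem Fam.contDiff {e : E → M} (he : Fam e) {F : M → ℝ} (hF : SmoothFn F) :
    ContDiff ℝ ∞ (F ∘ e) :=
  (ContMDiff.comp hF he).contDiff

theorem dir_congr {e e' : E → N} {z : E} (h : e =ᶠ[nhds z] e') (w : E) : dir e z w = dir e' z w :=
  TB_ext h.self_of_nhds (congrArg (fun l : E →L[ℝ] N.E => l w) h.mfderiv_eq)

theorem D_dir {F : N → ℝ} (hF : SmoothFn F) {e : E → N} (he : Fam e) (z w : E) :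
    D F (dir e z w) = fderiv ℝ (F ∘ e) z w := by
  have h := mfderiv_comp z (hF.mdiff (e z)) (he.mdiff z)
  rw [mfderiv_eq_fderiv] at h
  exact (congrArg (fun l : E →L[ℝ] ℝ => l w) h).symm

theorem TM_dir {f : M → N} (hf : Smooth f) {e : E → M} (he : Fam e) (z w : E) :
    TM f (dir e z w) = dir (f ∘ e) z w := by
  have h := mfderiv_comp z (hf.mdiff (e z)) (he.mdiff z)
  exact TB_ext rfl (congrArg (fun l : E →L[ℝ] N.E => l w) h).symm

theorem dir_comp {e : E → N} (he : Fam e) {g : E' → E} {z : E'} (hg : DifferentiableAt ℝ g z)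
    (w : E') : dir (e ∘ g) z w = dir e (g z) (fderiv ℝ g z w) := by
  have h := mfderiv_comp z (he.mdiff (g z)) hg.mdifferentiableAt
  rw [mfderiv_eq_fderiv] at h
  exact TB_ext rfl (congrArg (fun l : E' →L[ℝ] N.E => l w) h)

theorem Fam.dir {e : E → N} (he : Fam e) (w : E) :
    ContMDiff 𝓘(ℝ, E) (𝓡 N.dim).tangent ∞ (fun z => dir e z w) := by
  refine contMDiff_TB he fun f hf => ?_
  have h : (fun z => D f (Mfd.dir e z w)) = fun z => fderiv ℝ (f ∘ e) z w :=
    funext fun z => D_dir hf he z w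
  rw [h]
  exact (((he.contDiff hf).fderiv_right (m := ∞) (by simp)).clm_apply contDiff_const).contMDiff

theorem fam_const (x : N) : Fam (fun _ : E => x) := contMDiff_const

theorem dir_const (x : N) (z w : E) : dir (fun _ : E => x) z w = ⟨x, (0 : N.T x)⟩ :=
  TB_ext rfl (congrArg (fun l : E →L[ℝ] N.E => l w) mfderiv_const)

theorem dir_smul_zero (e : E → N) (z : E) : dir e z 0 = ⟨e z, (0 : N.T (e z))⟩ :=
  TB_ext rfl (mfderiv 𝓘(ℝ, E) (𝓡 N.dim) e z).map_zero

end dir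

/-- Precomposition with `r` turns a map that is defined near `0` into one defined everywhere, with
the same germ at `0`. -/
theorem exists_bump_id {δ : ℝ} (hδ : 0 < δ) :
    ∃ r : ℝ → ℝ, ContDiff ℝ ∞ r ∧ (∀ᶠ t in nhds 0, r t = t) ∧ r 0 = 0 ∧ ∀ t, |r t| < δ := by
  let f : ContDiffBump (0 : ℝ) := ⟨δ / 2, δ, by positivity, by linarith⟩
  refine ⟨fun t => f t * t, f.contDiff.mul contDiff_id, ?_, by simp, fun t => ?_⟩
  · filter_upwards [f.eventuallyEq_one] with t ht
    simp [ht]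
  · rw [abs_mul, abs_of_nonneg f.nonneg]
    by_cases h : |t| < δ
    · exact (mul_le_of_le_one_left (abs_nonneg t) f.le_one).trans_lt h
    · have : f t = 0 := f.zero_of_le_dist (by simpa [f] using h)
      simp [this, hδ]

theorem fderiv_of_eventually_id {r : ℝ → ℝ} (h : ∀ᶠ t in nhds 0, r t = t) :
    HasFDerivAt r (ContinuousLinearMap.id ℝ ℝ) 0 :=
  (hasFDerivAt_id (𝕜 := ℝ) (0 : ℝ)).congr_of_eventuallyEq h

/-- Linear subspaces in a chart. -/
theorem hasMFDerivAt_chart_line {E : Type*} [NormedAddCommGroup E] [NormedSpace ℝ E] (y : M)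
    (b : E →L[ℝ] M.E) :
    HasMFDerivAt 𝓘(ℝ, E) (𝓡 M.dim)
      (fun s : E => (extChartAt (𝓡 M.dim) y).symm (extChartAt (𝓡 M.dim) y y + b s)) 0
      ((ContinuousLinearMap.id ℝ M.E).comp b) := by
  set ψ := extChartAt (𝓡 M.dim) y with hψ
  have hχ : HasMFDerivAt 𝓘(ℝ, M.E) (𝓡 M.dim) ψ.symm (ψ y) (ContinuousLinearMap.id ℝ M.E) := by
    have h3 := (mdifferentiableWithinAt_extChartAt_symm (I := 𝓡 M.dim)
      (mem_extChartAt_target (I := 𝓡 M.dim) y)).hasMFDerivWithinAt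
    rw [mfderivWithin_range_extChartAt_symm] at h3
    have h4 : range (𝓡 M.dim) = univ := by simp
    have h5 : HasMFDerivWithinAt 𝓘(ℝ, M.E) (𝓡 M.dim) ψ.symm univ (ψ y)
        (ContinuousLinearMap.id ℝ M.E) := by
      rw [← h4]; exact h3
    exact hasMFDerivWithinAt_univ.mp h5
  have hline : HasFDerivAt (fun s : E => ψ y + b s) b 0 := b.hasFDerivAt.const_add _
  have hl0 : ψ y + b 0 = ψ y := by simp
  refine HasMFDerivAt.comp (0 : E) (g := ψ.symm) ?_ hline.hasMFDerivAt
  rw [hl0]; exact hχ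

/-- Pairs of tangent vectors are realized by maps from the plane. -/
theorem exists_surface (y : M) (v w : M.T y) :
    ∃ σ : ℝ × ℝ → M, Fam σ ∧ dir σ 0 (1, 0) = ⟨y, v⟩ ∧ dir σ 0 (0, 1) = ⟨y, w⟩ := by
  let ψ := extChartAt (𝓡 M.dim) y
  let v' : M.E := v
  let w' : M.E := w
  let b : ℝ × ℝ →L[ℝ] M.E := (ContinuousLinearMap.fst ℝ ℝ ℝ).smulRight v' +
    (ContinuousLinearMap.snd ℝ ℝ ℝ).smulRight w'
  have hc : Continuous (fun s : ℝ × ℝ => ψ y + b s) := by fun_prop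
  obtain ⟨δ, hδ, hball⟩ := Metric.isOpen_iff.mp ((isOpen_extChartAt_target (I := 𝓡 M.dim) y).preimage hc)
    (0 : ℝ × ℝ) (by
      simp only [mem_preimage, map_zero, add_zero]
      exact mem_extChartAt_target (I := 𝓡 M.dim) y)
  obtain ⟨r, hr, hr1, -, hrδ⟩ := exists_bump_id hδ
  have hrr : ContDiff ℝ ∞ (fun p : ℝ × ℝ => (r p.1, r p.2)) :=
    (hr.comp contDiff_fst).prodMk (hr.comp contDiff_snd)
  refine ⟨fun t => ψ.symm (ψ y + b (r t.1, r t.2)), ?_, ?_⟩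
  · refine (contMDiffOn_extChartAt_symm y).comp_contMDiff (f := fun t : ℝ × ℝ => ψ y + b (r t.1, r t.2))
      (contDiff_const.add (b.contDiff.comp hrr)).contMDiff fun t => hball ?_
    rw [Metric.mem_ball, Prod.dist_eq]
    simpa using ⟨hrδ t.1, hrδ t.2⟩
  · have h2 : (fun t : ℝ × ℝ => ψ.symm (ψ y + b (r t.1, r t.2))) =ᶠ[nhds 0]
        fun s => ψ.symm (ψ y + b s) := by
      have h1 : ∀ᶠ t : ℝ × ℝ in nhds 0, r t.1 = t.1 := 
        (continuous_fst.tendsto (0 : ℝ × ℝ)).eventually (p := fun t => r t = t) hr1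
      have h2 : ∀ᶠ t : ℝ × ℝ in nhds 0, r t.2 = t.2 := 
        (continuous_snd.tendsto (0 : ℝ × ℝ)).eventually (p := fun t => r t = t) hr1
      filter_upwards [h1, h2] with s hs hs'
      rw [hs, hs']
    have key : ∀ z : ℝ × ℝ, dir (fun t : ℝ × ℝ => ψ.symm (ψ y + b (r t.1, r t.2))) 0 z
        = ⟨y, b z⟩ := by
      intro z
      rw [dir_congr h2]
      refine TB_ext ?_ ?_
      · change ψ.symm (ψ y + b 0) = y
        rw [map_zero, add_zero]
        exact extChartAt_to_inv y
      · exact congrArg (fun l : ℝ × ℝ →L[ℝ] M.E => l z) (hasMFDerivAt_chart_line y b).mfderiv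
    refine ⟨(key _).trans (TB_ext rfl ?_), (key _).trans (TB_ext rfl ?_)⟩
    · change b (1, 0) = v'
      simp [b]
    · change b (0, 1) = w'
      simp [b]

/-- Every tangent vector is the velocity of a curve. -/
theorem exists_curve (u : M.TB) : ∃ γ : ℝ → M, Fam γ ∧ dir γ 0 1 = u := by
  obtain ⟨σ, hσ, h, -⟩ := exists_surface u.1 u.2 u.2
  have hL : HasFDerivAt (fun s : ℝ => (s, (0 : ℝ)))
      ((ContinuousLinearMap.id ℝ ℝ).prod (0 : ℝ →L[ℝ] ℝ)) 0 :=
    (hasFDerivAt_id (0 : ℝ)).prodMk (hasFDerivAt_const (0 : ℝ) (0 : ℝ))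
  have h1 := dir_comp hσ hL.differentiableAt 1
  rw [hL.fderiv] at h1
  exact ⟨_, hσ.comp_left (contDiff_id.prodMk contDiff_const), h1.trans h⟩

/-- Two-parameter families lifting a curve along a submersion, with a prescribed
restriction to a fibre and a prescribed transversal derivative. -/
theorem exists_family {f : M → N} (hf : Smooth f) {x : ℝ → N} (hx : Fam x) {c : ℝ → M} (hc : Fam c)
    (hcx : ∀ t, f (c t) = x 0) (hs : Function.Surjective (d f (c 0))) (b : M.T (c 0))
    (hb : TM f ⟨c 0, b⟩ = dir x 0 1) :
    ∃ (r : ℝ → ℝ) (e : ℝ × ℝ → M), ContDiff ℝ ∞ r ∧ (∀ᶠ t in nhds 0, r t = t) ∧ r 0 = 0 ∧ Fam e ∧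
      (∀ p, f (e p) = x (r p.1)) ∧ (∀ t, e (0, t) = c (r t)) ∧ dir e 0 (1, 0) = ⟨c 0, b⟩ := by
  obtain ⟨U, R, hU, hU0, hR, hR1, hR2⟩ := exists_retraction hf hs
  let ψ := extChartAt (𝓡 M.dim) (c 0)
  let b' : M.E := b
  let O₁ : Set (ℝ × ℝ) := {p | c p.2 ∈ ψ.source}
  have hO₁ : IsOpen O₁ := (isOpen_extChartAt_source (c 0)).preimage (hc.continuous.comp continuous_snd)
  have hc2 : ContMDiff 𝓘(ℝ, ℝ × ℝ) (𝓡 M.dim) ∞ (fun p : ℝ × ℝ => c p.2) :=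
    ContMDiff.comp hc contDiff_snd.contMDiff
  -- In the chart the curve `c` is pushed in the direction `b`, and `R` brings the result back to
  -- the fibre over `x s`. At `s = 0` the point already lies in its fibre, and `R` leaves it in
  -- place.
  let k₁ : ℝ × ℝ → M.E := fun p => ψ (c p.2) + p.1 • b'
  have hk₁ : ContMDiffOn 𝓘(ℝ, ℝ × ℝ) 𝓘(ℝ, M.E) ∞ k₁ O₁ := by
    have h2 : ContDiff ℝ ∞ (fun p : ℝ × ℝ => p.1 • b') := contDiff_fst.smul contDiff_const
    refine ContMDiffOn.add (f := fun p : ℝ × ℝ => ψ (c p.2)) ?_ h2.contMDiff.contMDiffOn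
    refine (contMDiffOn_extChartAt (x := c 0)).comp hc2.contMDiffOn fun p hp => ?_
    simpa [O₁, ψ] using hp
  let O₂ : Set (ℝ × ℝ) := O₁ ∩ k₁ ⁻¹' ψ.target
  have hO₂ : IsOpen O₂ := hk₁.continuousOn.isOpen_inter_preimage hO₁ (isOpen_extChartAt_target (c 0))
  let k₂ : ℝ × ℝ → N × M := fun p => (x p.1, ψ.symm (k₁ p))
  have hk₂ : ContMDiffOn 𝓘(ℝ, ℝ × ℝ) ((𝓡 N.dim).prod (𝓡 M.dim)) ∞ k₂ O₂ :=
    (ContMDiff.comp hx contDiff_fst.contMDiff).contMDiffOn.prodMk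
      ((contMDiffOn_extChartAt_symm (c 0)).comp (hk₁.mono inter_subset_left) fun p hp => hp.2)
  let O : Set (ℝ × ℝ) := O₂ ∩ k₂ ⁻¹' U
  have hO : IsOpen O := hk₂.continuousOn.isOpen_inter_preimage hO₂ hU
  have hG : ContMDiffOn 𝓘(ℝ, ℝ × ℝ) (𝓡 M.dim) ∞ (R ∘ k₂) O :=
    hR.comp (hk₂.mono inter_subset_left) fun p hp => hp.2
  have hk0 : ∀ t, (0, t) ∈ O₁ → ψ.symm (k₁ (0, t)) = c t := fun t ht => by
    simp only [k₁, zero_smul, add_zero]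
    exact ψ.left_inv ht
  have h01 : ((0 : ℝ), (0 : ℝ)) ∈ O₁ := mem_extChartAt_source (c 0)
  have h0 : ((0 : ℝ), (0 : ℝ)) ∈ O := by
    refine ⟨⟨h01, ?_⟩, ?_⟩
    · simp only [mem_preimage, k₁, zero_smul, add_zero]
      exact mem_extChartAt_target (c 0)
    · simp only [mem_preimage, k₂, hk0 0 h01]
      rw [← hcx 0]; exact hU0
  obtain ⟨δ, hδ, hball⟩ := Metric.isOpen_iff.mp hO _ h0
  obtain ⟨r, hr, hr1, hr0, hrδ⟩ := exists_bump_id hδ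
  have hmem : ∀ p : ℝ × ℝ, (r p.1, r p.2) ∈ O := fun p => hball (by
    rw [Metric.mem_ball, Prod.dist_eq]
    simpa using ⟨hrδ p.1, hrδ p.2⟩)
  have hrr : ContDiff ℝ ∞ (fun p : ℝ × ℝ => (r p.1, r p.2)) :=
    (hr.comp contDiff_fst).prodMk (hr.comp contDiff_snd)
  have he : Fam (fun p : ℝ × ℝ => (R ∘ k₂) (r p.1, r p.2)) :=
    hG.comp_contMDiff hrr.contMDiff hmem
  refine ⟨r, fun p => (R ∘ k₂) (r p.1, r p.2), hr, hr1, hr0, he, fun p => hR1 _ (hmem p).2,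
    fun t => ?_, ?_⟩
  · have h1 := hmem (0, t)
    simp only [hr0] at h1
    have h2 := hk0 _ h1.1.1
    have h3 : k₂ (0, r t) = (f (c (r t)), c (r t)) := by
      simp only [k₂, h2, hcx]
    simp only [hr0, Function.comp_apply, h3]
    refine hR2 _ ?_
    rw [← h3]; exact h1.2
  · have hL : HasFDerivAt (fun s : ℝ => (s, (0 : ℝ)))
        ((ContinuousLinearMap.id ℝ ℝ).prod (0 : ℝ →L[ℝ] ℝ)) 0 :=
      (hasFDerivAt_id (0 : ℝ)).prodMk (hasFDerivAt_const (0 : ℝ) (0 : ℝ))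
    have h1 := dir_comp he hL.differentiableAt 1
    rw [hL.fderiv] at h1
    refine h1.symm.trans ?_
    have h2 : ((fun p : ℝ × ℝ => (R ∘ k₂) (r p.1, r p.2)) ∘ fun s : ℝ => (s, (0 : ℝ)))
        =ᶠ[nhds 0] fun s => R (x s, ψ.symm (ψ (c 0) + s • b')) := by
      filter_upwards [hr1] with s hs
      simp [hs, hr0, k₂, k₁]
    rw [dir_congr h2]
    have hκ := hasMFDerivAt_chart_line (c 0) ((ContinuousLinearMap.id ℝ ℝ).smulRight b')
    have hl0 : ψ (c 0) + (0 : ℝ) • b' = ψ (c 0) := by simp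
    have hx' := (hx.mdiff 0).hasMFDerivAt
    have hp := hx'.prodMk hκ
    have hpt : (x 0, ψ.symm (ψ (c 0) + (0 : ℝ) • b')) = (f (c 0), c 0) := by
      rw [hl0, hcx, (extChartAt_to_inv (c 0) : ψ.symm (ψ (c 0)) = c 0)]
    have hRd : HasMFDerivAt ((𝓡 N.dim).prod (𝓡 M.dim)) (𝓡 M.dim) R (f (c 0), c 0) _ :=
      ((hR.contMDiffAt (hU.mem_nhds hU0)).mdifferentiableAt (by simp)).hasMFDerivAt
    have hRd' : HasMFDerivAt ((𝓡 N.dim).prod (𝓡 M.dim)) (𝓡 M.dim) R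
        (x 0, ψ.symm (ψ (c 0) + (0 : ℝ) • b'))
        (mfderiv ((𝓡 N.dim).prod (𝓡 M.dim)) (𝓡 M.dim) R (f (c 0), c 0) : N.E × M.E →L[ℝ] M.E) := by
      rw [hpt]; exact hRd
    have hfin := (HasMFDerivAt.comp (0 : ℝ) (g := R)
      (f := fun s : ℝ => (x s, ψ.symm (ψ (c 0) + s • b'))) hRd' hp).mfderiv
    refine TB_ext ?_ ?_
    · change R (x 0, ψ.symm (ψ (c 0) + (0 : ℝ) • b')) = c 0
      rw [hpt]; exact hR2 _ hU0
    · have h5 := congrArg (fun l : ℝ →L[ℝ] M.E => l 1) hfin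
      refine h5.trans ?_
      have h6 := mfderiv_retraction hf hU hR hR2 hU0 b
      refine Eq.trans ?_ h6
      have h7 : (d f (c 0) b : N.E) = mfderiv 𝓘(ℝ, ℝ) (𝓡 N.dim) x 0 1 := by
        have h8 : ∀ u u' : N.TB, u = u' → (u.2 : N.E) = u'.2 := by rintro u _ rfl; rfl
        exact h8 _ _ hb
      have h9 : ((1 : ℝ) • b') = b := one_smul _ _
      exact congrArg (mfderiv ((𝓡 N.dim).prod (𝓡 M.dim)) (𝓡 M.dim) R (f (c 0), c 0) :
        N.E × M.E →L[ℝ] M.E) (Prod.ext h7.symm h9)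

/-- Curves lifting a curve along a submersion, with prescribed velocity. -/
theorem exists_curve_lift {f : M → N} (hf : Smooth f) {x : ℝ → N} (hx : Fam x) (b : M.TB)
    (hs : Function.Surjective (d f b.1)) (hb : TM f b = dir x 0 1) :
    ∃ (r : ℝ → ℝ) (c : ℝ → M), ContDiff ℝ ∞ r ∧ (∀ᶠ t in nhds 0, r t = t) ∧ r 0 = 0 ∧ Fam c ∧
      (∀ t, f (c t) = x (r t)) ∧ dir c 0 1 = b := by
  have hb1 : f b.1 = x 0 := congrArg (fun u : N.TB => u.1) hb
  obtain ⟨r, e, hr, hr1, hr0, he, he1, he2, he3⟩ :=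
    exists_family hf hx (fam_const (E := ℝ) b.1) (fun _ => hb1) hs b.2 hb
  have hL : HasFDerivAt (fun s : ℝ => (s, (0 : ℝ)))
      ((ContinuousLinearMap.id ℝ ℝ).prod (0 : ℝ →L[ℝ] ℝ)) 0 :=
    (hasFDerivAt_id (0 : ℝ)).prodMk (hasFDerivAt_const (0 : ℝ) (0 : ℝ))
  have h1 := dir_comp he hL.differentiableAt 1
  rw [hL.fderiv] at h1
  refine ⟨r, e ∘ fun s => (s, 0), hr, hr1, hr0, he.comp_left (contDiff_id.prodMk contDiff_const),
    fun t => he1 _, h1.trans he3⟩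

/-- The tangent map of a map of two variables which is smooth along `S`. -/
def T₂ (f : M → N → L) (S : Set (M × N)) (a : M.TB) (b : N.TB) : L.TB :=
  ⟨f a.1 b.1, d₂ f S a.1 b.1 a.2 b.2⟩

theorem SmoothOn₂.fam {f : M → N → L} {S : Set (M × N)} (hf : SmoothOn₂ f S) {E : Type*}
    [NormedAddCommGroup E] [NormedSpace ℝ E] {φ : E → M} {ψ : E → N} (hφ : Fam φ) (hψ : Fam ψ)
    (h : ∀ z, (φ z, ψ z) ∈ S) : Fam (fun z => f (φ z) (ψ z)) :=
  ContMDiffOn.comp_contMDiff hf (ContMDiff.prodMk hφ hψ) h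

theorem SmoothOn₂.hasMFDerivWithinAt {f : M → N → L} {S : Set (M × N)} (hf : SmoothOn₂ f S)
    {q : M × N} (hq : q ∈ S) :
    HasMFDerivWithinAt ((𝓡 M.dim).prod (𝓡 N.dim)) (𝓡 L.dim) (fun q : M × N => f q.1 q.2) S q
      (mfderivWithin ((𝓡 M.dim).prod (𝓡 N.dim)) (𝓡 L.dim) (fun q : M × N => f q.1 q.2) S q) :=
  ((hf q hq).mdifferentiableWithinAt (by simp)).hasMFDerivWithinAt

/-- The chain rule within `S`: only maps with values in `S` enter, so the behaviour of `f` off `S`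
is irrelevant. -/
theorem dir_T₂ {f : M → N → L} {S : Set (M × N)} (hf : SmoothOn₂ f S) {E : Type*}
    [NormedAddCommGroup E] [NormedSpace ℝ E] {φ : E → M} {ψ : E → N} (hφ : Fam φ) (hψ : Fam ψ)
    (h : ∀ z, (φ z, ψ z) ∈ S) (z w : E) :
    dir (fun z => f (φ z) (ψ z)) z w = T₂ f S (dir φ z w) (dir ψ z w) := by
  have h1 := hf.hasMFDerivWithinAt (h z)
  have h2 := (hφ.mdiff z).hasMFDerivAt.prodMk (hψ.mdiff z).hasMFDerivAt
  have h3 := HasMFDerivWithinAt.comp z (g := fun q : M × N => f q.1 q.2)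
    (f := fun z => (φ z, ψ z)) (u := S) (s := univ) h1 h2.hasMFDerivWithinAt (fun z _ => h z)
  have h4 := (hasMFDerivWithinAt_univ.mp h3).mfderiv
  exact TB_ext rfl (congrArg (fun l : E →L[ℝ] L.E => l w) h4)

theorem d₂_add (f : M → N → L) (S : Set (M × N)) {x : M} {y : N} (a a' : M.T x) (b b' : N.T y) :
    d₂ f S x y (a + a') (b + b') = d₂ f S x y a b + d₂ f S x y a' b' :=
  (mfderivWithin ((𝓡 M.dim).prod (𝓡 N.dim)) (𝓡 L.dim) (fun q : M × N => f q.1 q.2) S (x, y)).map_add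
    (a, b) (a', b')

theorem d₂_smul (f : M → N → L) (S : Set (M × N)) {x : M} {y : N} (c : ℝ) (a : M.T x) (b : N.T y) :
    d₂ f S x y (c • a) (c • b) = c • d₂ f S x y a b :=
  (mfderivWithin ((𝓡 M.dim).prod (𝓡 N.dim)) (𝓡 L.dim) (fun q : M × N => f q.1 q.2) S (x, y)).map_smul
    c (a, b)

variable {EK : Type*} [NormedAddCommGroup EK] [NormedSpace ℝ EK] {HK : Type*} [TopologicalSpace HK]
  {I : ModelWithCorners ℝ EK HK} {K : Type*} [TopologicalSpace K] [ChartedSpace HK K]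

theorem contMDiffAt_mfderiv_prod {G : M × N → ℝ} {W : Set (M × N)} (hW : IsOpen W)
    (hG : ContMDiffOn ((𝓡 M.dim).prod (𝓡 N.dim)) 𝓘(ℝ, ℝ) ∞ G W) {a : K → M.TB} {b : K → N.TB}
    {k : K} (ha : ContMDiffAt I (𝓡 M.dim).tangent ∞ a k) (hb : ContMDiffAt I (𝓡 N.dim).tangent ∞ b k)
    (hk : ((a k).1, (b k).1) ∈ W) :
    ContMDiffAt I 𝓘(ℝ, ℝ) ∞ (fun k => (mfderiv ((𝓡 M.dim).prod (𝓡 N.dim)) 𝓘(ℝ, ℝ) G ((a k).1, (b k).1) :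
      M.E × N.E →L[ℝ] ℝ) ((a k).2, (b k).2)) k := by
  have h1 := ContMDiffOn.contMDiffOn_tangentMapWithin (m := ∞) hG (by simp) hW.uniqueMDiffOn
  have h2 : ContMDiffAt I ((𝓡 M.dim).prod (𝓡 N.dim)).tangent ∞
      (fun k => (equivTangentBundleProd (𝓡 M.dim) M (𝓡 N.dim) N).symm (a k, b k)) k :=
    contMDiff_equivTangentBundleProd_symm.contMDiffAt.comp k (ha.prodMk hb)
  have hWo : IsOpen ((Bundle.TotalSpace.proj :
      TangentBundle ((𝓡 M.dim).prod (𝓡 N.dim)) (M × N) → M × N) ⁻¹' W) :=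
    hW.preimage (FiberBundle.continuous_proj _ _)
  have h3 := (h1.contMDiffAt (hWo.mem_nhds (x := (equivTangentBundleProd (𝓡 M.dim) M (𝓡 N.dim) N).symm
    (a k, b k)) hk)).comp k h2
  have h4 := (contMDiff_snd_tangentBundle_modelSpace ℝ 𝓘(ℝ, ℝ) (n := ∞)).contMDiffAt.comp k h3
  refine h4.congr_of_eventuallyEq ?_
  have h5 : ∀ᶠ l in nhds k, ((a l).1, (b l).1) ∈ W :=
    (h2.continuousAt.preimage_mem_nhds (hWo.mem_nhds hk))
  filter_upwards [h5] with l hl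
  have h6 := mfderivWithin_of_isOpen (I := (𝓡 M.dim).prod (𝓡 N.dim)) (I' := 𝓘(ℝ, ℝ)) (f := G) hW hl
  exact congrArg (fun L : M.E × N.E →L[ℝ] ℝ => L ((a l).2, (b l).2)) h6.symm

/-- Smooth dependence of `T₂ f` on tangent vectors along a fibre product. -/
theorem contMDiff_T₂ {s : M → B} {t : N → B} (hs : Smooth s) (hsub : ∀ x, Function.Surjective (d s x))
    (ht : Smooth t) {f : M → N → L} (hf : SmoothOn₂ f {q | s q.1 = t q.2})
    {a : K → M.TB} {b : K → N.TB} (ha : ContMDiff I (𝓡 M.dim).tangent ∞ a)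
    (hb : ContMDiff I (𝓡 N.dim).tangent ∞ b) (h : ∀ k, TM s (a k) = TM t (b k)) :
    ContMDiff I (𝓡 L.dim).tangent ∞ (fun k => T₂ f {q | s q.1 = t q.2} (a k) (b k)) := by
  have hS : ∀ k, ((a k).1, (b k).1) ∈ {q : M × N | s q.1 = t q.2} :=
    fun k => congrArg (fun u : B.TB => u.1) (h k)
  refine contMDiff_TB (hf.comp_contMDiff ((contMDiff_proj ha).prodMk (contMDiff_proj hb)) hS)
    fun F hF k => ?_
  obtain ⟨U, R, hU, hU0, hR, hR1, hR2⟩ := exists_retraction hs (hsub (a k).1)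
  let j : M × N → B × M := fun q => (t q.2, q.1)
  have hj : ContMDiff ((𝓡 M.dim).prod (𝓡 N.dim)) ((𝓡 B.dim).prod (𝓡 M.dim)) ∞ j :=
    (ContMDiff.comp ht contMDiff_snd).prodMk contMDiff_fst
  let W : Set (M × N) := j ⁻¹' U
  have hW : IsOpen W := hU.preimage hj.continuous
  -- `ret` retracts a neighbourhood onto the fibre product, so `f ∘ ret` is smooth on an open set
  -- and has an honest differential there. On compatible pairs of vectors the differential of `ret`
  -- is the identity, and the two differentials agree.
  let ret : M × N → M × N := fun q => (R (j q), q.2)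
  have hret : ContMDiffOn ((𝓡 M.dim).prod (𝓡 N.dim)) ((𝓡 M.dim).prod (𝓡 N.dim)) ∞ ret W :=
    (hR.comp hj.contMDiffOn fun q hq => hq).prodMk contMDiffOn_snd
  have hretS : ∀ q ∈ W, ret q ∈ {q : M × N | s q.1 = t q.2} := fun q hq => hR1 _ hq
  have hfr : ContMDiffOn ((𝓡 M.dim).prod (𝓡 N.dim)) (𝓡 L.dim) ∞
      (fun q => f (ret q).1 (ret q).2) W := ContMDiffOn.comp hf hret hretS
  have hG : ContMDiffOn ((𝓡 M.dim).prod (𝓡 N.dim)) 𝓘(ℝ, ℝ) ∞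
      (fun q => F (f (ret q).1 (ret q).2)) W := ContMDiff.comp_contMDiffOn hF hfr
  have hkW : ((a k).1, (b k).1) ∈ W := by
    change (t (b k).1, (a k).1) ∈ U
    rw [← hS k]; exact hU0
  refine (contMDiffAt_mfderiv_prod hW hG (ha k) (hb k) hkW).congr_of_eventuallyEq ?_
  have hev : ∀ᶠ l in nhds k, ((a l).1, (b l).1) ∈ W :=
    ((contMDiff_proj ha).prodMk (contMDiff_proj hb)).continuous.continuousAt.preimage_mem_nhds
      (hW.mem_nhds hkW)
  filter_upwards [hev] with l hl
  rcases hal : a l with ⟨x, va⟩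
  rcases hbl : b l with ⟨y, vb⟩
  have hxy : s x = t y := by simpa [hal, hbl] using hS l
  have hl' : (t y, x) ∈ U := by
    rw [hal, hbl] at hl
    exact hl
  have hRx : R (t y, x) = x := by rw [← hxy]; exact hR2 x (by rw [hxy]; exact hl')
  have hrx : ret (x, y) = (x, y) := Prod.ext hRx rfl
  have h1 : HasMFDerivAt ((𝓡 B.dim).prod (𝓡 M.dim)) (𝓡 M.dim) R (t y, x) _ :=
    ((hR.contMDiffAt (hU.mem_nhds hl')).mdifferentiableAt (by simp)).hasMFDerivAt
  have h2 : HasMFDerivAt ((𝓡 M.dim).prod (𝓡 N.dim)) ((𝓡 B.dim).prod (𝓡 M.dim)) j (x, y) _ :=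
    (HasMFDerivAt.comp (x, y) (g := t) (ht.mdiff y).hasMFDerivAt (hasMFDerivAt_snd (x, y))).prodMk
      (hasMFDerivAt_fst (x, y))
  have h3 := (HasMFDerivAt.comp (x, y) (g := R) (f := j) h1 h2).prodMk (hasMFDerivAt_snd (x, y))
  have h4 : HasMFDerivWithinAt ((𝓡 M.dim).prod (𝓡 N.dim)) (𝓡 L.dim) (fun q : M × N => f q.1 q.2)
      {q : M × N | s q.1 = t q.2} (ret (x, y))
      (mfderivWithin ((𝓡 M.dim).prod (𝓡 N.dim)) (𝓡 L.dim) (fun q : M × N => f q.1 q.2)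
        {q : M × N | s q.1 = t q.2} (x, y) : M.E × N.E →L[ℝ] L.E) := by
    rw [hrx]; exact hf.hasMFDerivWithinAt hxy
  have h5 := (HasMFDerivWithinAt.comp (x, y) (g := fun q : M × N => f q.1 q.2) (f := ret) (s := W)
    h4 h3.hasMFDerivWithinAt hretS).hasMFDerivAt (hW.mem_nhds hl')
  have h6 : HasMFDerivAt (𝓡 L.dim) 𝓘(ℝ, ℝ) F (f (ret (x, y)).1 (ret (x, y)).2)
      (mfderiv (𝓡 L.dim) 𝓘(ℝ, ℝ) F (f x y) : L.E →L[ℝ] ℝ) := by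
    rw [hrx]; exact (hF.mdiff _).hasMFDerivAt
  have h7 := (HasMFDerivAt.comp (x, y) (g := F) h6 h5).mfderiv
  have hT : (d s x va : B.E) = d t y vb := by
    have h8 : ∀ u u' : B.TB, u = u' → (u.2 : B.E) = u'.2 := by rintro u _ rfl; rfl
    have h9 := h l
    rw [hal, hbl] at h9
    exact h8 _ _ h9
  have h10 := mfderiv_retraction hs hU hR hR2 (x := x) (by rw [hxy]; exact hl') va
  have h11 : ((mfderiv ((𝓡 B.dim).prod (𝓡 M.dim)) (𝓡 M.dim) R (t y, x) :
      B.E × M.E →L[ℝ] M.E) (d t y vb, va)) = va := by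
    refine Eq.trans ?_ h10
    rw [← hxy]
    exact congrArg (mfderiv ((𝓡 B.dim).prod (𝓡 M.dim)) (𝓡 M.dim) R (s x, x) :
      B.E × M.E →L[ℝ] M.E) (Prod.ext hT.symm rfl)
  have h12 := congrArg (fun l : M.E × N.E →L[ℝ] ℝ => l (va, vb)) h7
  refine Eq.trans ?_ h12.symm
  exact congrArg (fun v : M.E => (mfderiv (𝓡 L.dim) 𝓘(ℝ, ℝ) F (f x y) : L.E →L[ℝ] ℝ)
    ((mfderivWithin ((𝓡 M.dim).prod (𝓡 N.dim)) (𝓡 L.dim) (fun q : M × N => f q.1 q.2)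
        {q : M × N | s q.1 = t q.2} (x, y) : M.E × N.E →L[ℝ] L.E) (v, vb))) h11.symm

end Mfd

end

/-! ### Lifting vector fields along submersions; the exterior derivative of 1-forms. -/

section

namespace Mfd

variable {M : Mfd.{u}} {N : Mfd.{v}} {L : Mfd.{w}} {B : Mfd.{z}}

theorem snd_eq_of_TB_eq {u u' : N.TB} (h : u = u') : (u.2 : N.E) = u'.2 := by cases h; rfl

/-- Local form of the lifting of vector fields along maps. -/
theorem exists_local_lift {h : L → M} (hh : Smooth h) {f : M → N} (hf : IsSurjSubmersion f)
    {w : L → N.TB} (hw : ContMDiff (𝓡 L.dim) (𝓡 N.dim).tangent ∞ w) (hwf : ∀ l, (w l).1 = f (h l))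
    (l₀ : L) (v₀ : M.T (h l₀)) :
    ∃ (U : Set L) (w' : ∀ l, M.T (h l)), IsOpen U ∧ l₀ ∈ U ∧
      ContMDiffOn (𝓡 L.dim) (𝓡 M.dim).tangent ∞ (fun l => (⟨h l, w' l⟩ : M.TB)) U ∧
      (∀ l ∈ U, TM f ⟨h l, w' l⟩ = w l) ∧ (TM f ⟨h l₀, v₀⟩ = w l₀ → w' l₀ = v₀) := by
  obtain ⟨V, hV, hV0⟩ := exists_vectorField (h l₀) v₀
  obtain ⟨U, R, hU, hU0, hR, hR1, hR2⟩ := exists_retraction hf.smooth (hf.submersion (h l₀))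
  let j : L → N × M := fun l => (f (h l), h l)
  have hj : Continuous j := (hf.smooth.continuous.comp hh.continuous).prodMk hh.continuous
  have hV' : ContMDiff (𝓡 L.dim) (𝓡 M.dim).tangent ∞ (fun l => (⟨h l, V (h l)⟩ : M.TB)) :=
    ContMDiff.comp hV hh
  -- As `f ∘ R` is the first projection, dR(w, V) lies over `w` for every `V`; the choice of `V`
  -- with value `v₀` at `h l₀` produces the prescribed value there.
  let w' : ∀ l, M.T (h l) := fun l =>
    (mfderiv ((𝓡 N.dim).prod (𝓡 M.dim)) (𝓡 M.dim) R (f (h l), h l) : N.E × M.E →L[ℝ] M.E)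
      ((w l).2, V (h l))
  have hRl : ∀ l, j l ∈ U → HasMFDerivAt ((𝓡 N.dim).prod (𝓡 M.dim)) (𝓡 M.dim) R (j l)
      (mfderiv ((𝓡 N.dim).prod (𝓡 M.dim)) (𝓡 M.dim) R (j l)) := fun l hl =>
    ((hR.contMDiffAt (hU.mem_nhds hl)).mdifferentiableAt (by simp)).hasMFDerivAt
  refine ⟨j ⁻¹' U, w', hU.preimage hj, hU0, ?_, ?_, ?_⟩
  · intro l hl
    refine (contMDiffAt_TB (hh l) fun F hF => ?_).contMDiffWithinAt
    have hG : ContMDiffOn ((𝓡 N.dim).prod (𝓡 M.dim)) 𝓘(ℝ, ℝ) ∞ (F ∘ R) U :=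
      ContMDiff.comp_contMDiffOn hF hR
    have hl1 : ((w l).1, h l) ∈ U := by rw [hwf]; exact hl
    refine (contMDiffAt_mfderiv_prod hU hG (hw l) (hV' l) hl1).congr_of_eventuallyEq ?_
    filter_upwards [(hU.preimage hj).mem_nhds hl] with k hk
    have h1 : HasMFDerivAt (𝓡 M.dim) 𝓘(ℝ, ℝ) F (R (j k))
        (mfderiv (𝓡 M.dim) 𝓘(ℝ, ℝ) F (h k) : M.E →L[ℝ] ℝ) := by
      rw [show R (j k) = h k from hR2 _ hk]; exact (hF.mdiff _).hasMFDerivAt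
    have h2 := (HasMFDerivAt.comp (j k) (g := F) h1 (hRl k hk)).mfderiv
    have h3 := congrArg (fun l : N.E × M.E →L[ℝ] ℝ => l ((w k).2, V (h k))) h2
    rw [hwf]
    exact h3.symm
  · intro l hl
    refine TB_ext (hwf l).symm ?_
    have h1 : HasMFDerivAt (𝓡 M.dim) (𝓡 N.dim) f (R (j l)) (d f (h l) : M.E →L[ℝ] N.E) := by
      rw [show R (j l) = h l from hR2 _ hl]; exact (hf.smooth.mdiff _).hasMFDerivAt
    have h2 := HasMFDerivAt.comp (j l) (g := f) h1 (hRl l hl)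
    have h3 : (f ∘ R) =ᶠ[nhds (j l)] Prod.fst := by
      filter_upwards [hU.mem_nhds hl] with q hq
      exact hR1 q hq
    have h4 := (h2.congr_of_eventuallyEq h3.symm).mfderiv
    rw [(hasMFDerivAt_fst (j l)).mfderiv] at h4
    exact (congrArg (fun l' : N.E × M.E →L[ℝ] N.E => l' ((w l).2, V (h l))) h4).symm
  · intro h0
    have h1 := mfderiv_retraction hf.smooth hU hR hR2 hU0 v₀
    refine Eq.trans ?_ h1
    have h2 : ((w l₀).2 : N.E) = d f (h l₀) v₀ := (snd_eq_of_TB_eq h0).symm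
    exact congrArg (mfderiv ((𝓡 N.dim).prod (𝓡 M.dim)) (𝓡 M.dim) R (f (h l₀), h l₀) :
        N.E × M.E →L[ℝ] M.E) (Prod.ext h2 hV0)

/-- Vector fields along maps lift along surjective submersions, with a prescribed value at a point. -/
theorem exists_lift {h : L → M} (hh : Smooth h) {f : M → N} (hf : IsSurjSubmersion f)
    {w : L → N.TB} (hw : ContMDiff (𝓡 L.dim) (𝓡 N.dim).tangent ∞ w) (hwf : ∀ l, (w l).1 = f (h l))
    (l₀ : L) (v₀ : M.T (h l₀)) (hv₀ : TM f ⟨h l₀, v₀⟩ = w l₀) :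
    ∃ w' : ∀ l, M.T (h l),
      ContMDiff (𝓡 L.dim) (𝓡 M.dim).tangent ∞ (fun l => (⟨h l, w' l⟩ : M.TB)) ∧
      (∀ l, TM f ⟨h l, w' l⟩ = w l) ∧ w' l₀ = v₀ := by
  classical
  have hloc : ∀ l₁ : L, ∃ (U : Set L) (w' : ∀ l, M.T (h l)), IsOpen U ∧ l₁ ∈ U ∧
      ContMDiffOn (𝓡 L.dim) (𝓡 M.dim).tangent ∞ (fun l => (⟨h l, w' l⟩ : M.TB)) U ∧
      (∀ l ∈ U, TM f ⟨h l, w' l⟩ = w l) ∧ (l₀ ∈ U → w' l₀ = v₀) := by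
    intro l₁
    by_cases hl : l₁ = l₀
    · subst hl
      obtain ⟨U, w', h1, h2, h3, h4, h5⟩ := exists_local_lift hh hf hw hwf l₁ v₀
      exact ⟨U, w', h1, h2, h3, h4, fun _ => h5 hv₀⟩
    · obtain ⟨U, w', h1, h2, h3, h4, -⟩ := exists_local_lift hh hf hw hwf l₁ 0
      -- With `l₀` removed from the other neighbourhoods, only local lifts with value `v₀`
      -- contribute to the average at `l₀`.
      exact ⟨U \ {l₀}, w', h1.sdiff isClosed_singleton, ⟨h2, hl⟩, h3.mono sdiff_subset,
        fun l hl => h4 l hl.1, fun h => absurd rfl h.2⟩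
  choose U w' hU hlU hsm hlift hval using hloc
  have : LocallyCompactSpace L := ChartedSpace.locallyCompactSpace L.E L
  obtain ⟨ρ, hρ⟩ := SmoothPartitionOfUnity.exists_isSubordinate (𝓡 L.dim) isClosed_univ U hU
    (fun l _ => mem_iUnion.mpr ⟨l, hlU l⟩)
  have hfin : ∀ l, {i | ρ i l ≠ 0}.Finite := fun l => ρ.locallyFinite.point_finite l
  have hmem : ∀ i l, ρ i l ≠ 0 → l ∈ U i := fun i l hi => hρ i (subset_tsupport _ hi)
  have hsum : ∀ (l : L) (V : Type) [AddCommGroup V] [Module ℝ V] (A : M.E →ₗ[ℝ] V) (c : V),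
      (∀ i, l ∈ U i → A (w' i l) = c) → A (∑ᶠ i, ρ i l • (w' i l : M.E)) = c := by
    intro l V _ _ A c hc
    have h1 : (Function.support fun i => ρ i l • (w' i l : M.E)).Finite :=
      (hfin l).subset fun i hi h0 => hi (by simp [h0])
    have h2 := A.toAddMonoidHom.map_finsum h1
    refine h2.trans ?_
    have h3 : ∀ i, A.toAddMonoidHom (ρ i l • (w' i l : M.E)) = ρ i l • c := by
      intro i
      by_cases hi : ρ i l = 0
      · exact (A.map_smul _ _).trans (by rw [hi, zero_smul, zero_smul])
      · exact (A.map_smul _ _).trans (by rw [hc i (hmem i l hi)])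
    rw [finsum_congr h3, ← finsum_smul, ρ.sum_eq_one (mem_univ l), one_smul]
  refine ⟨fun l => (∑ᶠ i, ρ i l • (w' i l : M.E) : M.E), ?_, ?_, ?_⟩
  · refine contMDiff_TB hh fun F hF => ?_
    have h1 : ContMDiff (𝓡 L.dim) 𝓘(ℝ, ℝ) ∞
        (fun l => ∑ᶠ i, ρ i l • D F (⟨h l, w' i l⟩ : M.TB)) := by
      refine ρ.contMDiff_finsum_smul fun i l hl => ?_
      exact hF.D.contMDiffAt.comp l ((hsm i).contMDiffAt ((hU i).mem_nhds (hρ i hl)))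
    convert h1 using 2 with l
    have h2 : (Function.support fun i => ρ i l • (w' i l : M.E)).Finite :=
      (hfin l).subset fun i hi h0 => hi (by simp [h0])
    have h3 := (mfderiv (𝓡 M.dim) 𝓘(ℝ, ℝ) F (h l) : M.E →L[ℝ] ℝ).toLinearMap.toAddMonoidHom.map_finsum h2
    refine h3.trans (finsum_congr fun i => ?_)
    exact (mfderiv (𝓡 M.dim) 𝓘(ℝ, ℝ) F (h l) : M.E →L[ℝ] ℝ).map_smul _ _
  · intro l
    refine TB_ext (hwf l).symm ?_
    refine hsum l N.E (d f (h l) : M.E →L[ℝ] N.E).toLinearMap _ fun i hi => ?_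
    exact snd_eq_of_TB_eq (hlift i l hi)
  · exact hsum l₀ M.E LinearMap.id _ fun i hi => hval i hi

theorem D_mul {f g : N → ℝ} (hf : SmoothFn f) (hg : SmoothFn g) (u : N.TB) :
    D (fun x => f x * g x) u = f u.1 * D g u + g u.1 * D f u := by
  have h := ((hf.mdiff u.1).hasMFDerivAt.mul (hg.mdiff u.1).hasMFDerivAt).mfderiv
  exact congrArg (fun l : N.E →L[ℝ] ℝ => l u.2) h

theorem D_add {f g : N → ℝ} (hf : SmoothFn f) (hg : SmoothFn g) (u : N.TB) :
    D (fun x => f x + g x) u = D f u + D g u := by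
  have h := ((hf.mdiff u.1).hasMFDerivAt.add (hg.mdiff u.1).hasMFDerivAt).mfderiv
  exact congrArg (fun l : N.E →L[ℝ] ℝ => l u.2) h

theorem D_const (c : ℝ) (u : N.TB) : D (fun _ : N => c) u = 0 :=
  congrArg (fun l : N.E →L[ℝ] ℝ => l u.2) (mfderiv_const (I := 𝓡 N.dim) (I' := 𝓘(ℝ, ℝ)) (c := c))

theorem SmoothFn.add {f g : N → ℝ} (hf : SmoothFn f) (hg : SmoothFn g) :
    SmoothFn (fun x => f x + g x) := ContMDiff.add hf hg

theorem SmoothFn.mul {f g : N → ℝ} (hf : SmoothFn f) (hg : SmoothFn g) :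
    SmoothFn (fun x => f x * g x) := ContMDiff.mul hf hg

theorem smoothFn_const (c : ℝ) : SmoothFn (fun _ : N => c) := contMDiff_const

theorem SmoothFn.comp {F : N → ℝ} (hF : SmoothFn F) {f : M → N} (hf : Smooth f) :
    SmoothFn (F ∘ f) := ContMDiff.comp hF hf

theorem SmoothFn.sum {ι : Type*} (s : Finset ι) {f : ι → N → ℝ} (hf : ∀ i, SmoothFn (f i)) :
    SmoothFn (fun x => ∑ i ∈ s, f i x) := ContMDiff.sum fun i _ => hf i

theorem D_sum {ι : Type*} (s : Finset ι) {f : ι → N → ℝ} (hf : ∀ i, SmoothFn (f i)) (u : N.TB) :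
    D (fun x => ∑ i ∈ s, f i x) u = ∑ i ∈ s, D (f i) u := by
  classical
  induction s using Finset.induction_on with
  | empty => simpa using D_const 0 u
  | insert a s ha ih =>
    simp only [Finset.sum_insert ha]
    rw [D_add (hf a) (SmoothFn.sum s hf), ih]

/-- Smooth functions on the tangent bundle which are linear on the fibres: smooth 1-forms. -/
structure IsOneForm (η : N.TB → ℝ) : Prop where
  smooth : ContMDiff (𝓡 N.dim).tangent 𝓘(ℝ, ℝ) ∞ η
  add : ∀ (x : N) (v w : N.T x), η ⟨x, v + w⟩ = η ⟨x, v⟩ + η ⟨x, w⟩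
  smul : ∀ (x : N) (c : ℝ) (v : N.T x), η ⟨x, c • v⟩ = c * η ⟨x, v⟩

theorem SmoothFn.isOneForm {F : N → ℝ} (hF : SmoothFn F) : IsOneForm (Mfd.D F) :=
  ⟨hF.D, D_add_vec F, D_smul_vec F⟩

theorem IsOneForm.sum {η : N.TB → ℝ} (hη : IsOneForm η) {ι : Type*} (s : Finset ι) (x : N)
    (v : ι → N.T x) : η ⟨x, ∑ i ∈ s, v i⟩ = ∑ i ∈ s, η ⟨x, v i⟩ := by
  classical
  have h0 : η ⟨x, (0 : N.T x)⟩ = 0 := by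
    have := hη.smul x 0 0
    rwa [zero_smul, zero_mul] at this
  induction s using Finset.induction_on with
  | empty => simpa using h0
  | insert a s ha ih => rw [Finset.sum_insert ha, Finset.sum_insert ha, hη.add, ih]

/-- Coordinate functions near `y`. -/
def crd (y : N) : Fin N.dim → N → ℝ := (exists_coords y).choose

/-- The frame of coordinate vector fields near `y`. -/
def frm (y : N) : Fin N.dim → ∀ x : N, N.T x := (exists_coords y).choose_spec.choose

theorem smooth_crd (y : N) (i : Fin N.dim) : SmoothFn (crd y i) :=
  (exists_coords y).choose_spec.choose_spec.1 i

theorem smooth_frm (y : N) (i : Fin N.dim) : IsVectorField (frm y i) :=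
  (exists_coords y).choose_spec.choose_spec.2.1 i

theorem eventually_eq_sum_frm (y : N) :
    ∀ᶠ x in nhds y, ∀ v : N.T x, v = ∑ i, D (crd y i) ⟨x, v⟩ • frm y i x :=
  (exists_coords y).choose_spec.choose_spec.2.2

/-- The coefficients of a 1-form. -/
def coef (η : N.TB → ℝ) (y : N) (i : Fin N.dim) (x : N) : ℝ := η ⟨x, frm y i x⟩

theorem IsOneForm.smooth_coef {η : N.TB → ℝ} (hη : IsOneForm η) (y : N) (i : Fin N.dim) :
    SmoothFn (coef η y i) :=
  ContMDiff.comp hη.smooth (smooth_frm y i)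

theorem IsOneForm.local_form {η : N.TB → ℝ} (hη : IsOneForm η) (y : N) :
    ∀ᶠ x in nhds y, ∀ u : N.TB, u.1 = x → η u = ∑ i, coef η y i x * D (crd y i) u := by
  filter_upwards [eventually_eq_sum_frm y] with x hx u hu
  obtain ⟨x', v⟩ := u
  obtain rfl : x' = x := hu
  conv_lhs => rw [hx v]
  rw [hη.sum]
  refine Finset.sum_congr rfl fun i _ => ?_
  rw [hη.smul, mul_comm]
  rfl

/-- The exterior derivative of a 1-form at a point. -/
def extd (η : N.TB → ℝ) (y : N) (v w : N.T y) : ℝ :=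
  ∑ i, (D (coef η y i) ⟨y, v⟩ * D (crd y i) ⟨y, w⟩ - D (coef η y i) ⟨y, w⟩ * D (crd y i) ⟨y, v⟩)

theorem extd_add_left (η : N.TB → ℝ) (y : N) (v v' w : N.T y) :
    extd η y (v + v') w = extd η y v w + extd η y v' w := by
  simp only [extd, D_add_vec, ← Finset.sum_add_distrib]
  exact Finset.sum_congr rfl fun i _ => by ring

theorem extd_antisymm (η : N.TB → ℝ) (y : N) (v w : N.T y) : extd η y v w = -extd η y w v := by
  simp only [extd, ← Finset.sum_neg_distrib]
  exact Finset.sum_congr rfl fun i _ => by ring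

theorem extd_add_right (η : N.TB → ℝ) (y : N) (v w w' : N.T y) :
    extd η y v (w + w') = extd η y v w + extd η y v w' := by
  rw [extd_antisymm, extd_add_left, extd_antisymm η y w, extd_antisymm η y w']
  ring

theorem two_le_infty : (2 : WithTop ℕ∞) ≤ ∞ := 
  WithTop.coe_le_coe.mpr (le_top : (2 : ℕ∞) ≤ ⊤)

/-- Along `σ` the form is ∑ cᵢ d(φᵢ ∘ σ), and the terms with second derivatives of φᵢ ∘ σ cancel by
symmetry. The frame may be centred at a point `y₀` different from `y`, while the left side involves
no frame at all. -/
theorem fderiv_family_eq_frame {η : N.TB → ℝ} (hη : IsOneForm η) {σ : ℝ × ℝ → N} (hσ : Fam σ)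
    (y₀ y : N) (hy₀ : ∀ᶠ x in nhds y, ∀ u : N.TB, u.1 = x →
      η u = ∑ i, coef η y₀ i x * D (crd y₀ i) u) (v w : N.T y) (hv : dir σ 0 (1, 0) = ⟨y, v⟩) (hw : dir σ 0 (0, 1) = ⟨y, w⟩) :
    fderiv ℝ (fun z => η (dir σ z (0, 1))) 0 (1, 0) - fderiv ℝ (fun z => η (dir σ z (1, 0))) 0 (0, 1)
      = ∑ i, (D (coef η y₀ i) ⟨y, v⟩ * D (crd y₀ i) ⟨y, w⟩
        - D (coef η y₀ i) ⟨y, w⟩ * D (crd y₀ i) ⟨y, v⟩) := by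
  have hy : σ 0 = y := congrArg (fun u : N.TB => u.1) hv
  have hev : ∀ᶠ z in nhds (0 : ℝ × ℝ), ∀ a : ℝ × ℝ,
      η (dir σ z a) = ∑ i, coef η y₀ i (σ z) * fderiv ℝ (crd y₀ i ∘ σ) z a := by
    have h1 : Filter.Tendsto σ (nhds 0) (nhds y) := hy ▸ hσ.continuous.tendsto 0
    filter_upwards [h1.eventually hy₀] with z hz a
    rw [hz _ rfl]
    exact Finset.sum_congr rfl fun i _ => by rw [D_dir (smooth_crd y₀ i) hσ]
  have hc : ∀ i, ContDiff ℝ ∞ (coef η y₀ i ∘ σ) := fun i => hσ.contDiff (hη.smooth_coef y₀ i)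
  have hφ : ∀ i, ContDiff ℝ ∞ (crd y₀ i ∘ σ) := fun i => hσ.contDiff (smooth_crd y₀ i)
  have hd : ∀ i, ContDiff ℝ ∞ (fderiv ℝ (crd y₀ i ∘ σ)) := fun i => (hφ i).fderiv_right (by simp)
  have key : ∀ a b : ℝ × ℝ, fderiv ℝ (fun z => η (dir σ z a)) 0 b
      = ∑ i, (coef η y₀ i y * fderiv ℝ (fderiv ℝ (crd y₀ i ∘ σ)) 0 b a
        + fderiv ℝ (crd y₀ i ∘ σ) 0 a * fderiv ℝ (coef η y₀ i ∘ σ) 0 b) := by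
    intro a b
    have h1 : (fun z => η (dir σ z a)) =ᶠ[nhds 0]
        fun z => ∑ i, (coef η y₀ i ∘ σ) z * fderiv ℝ (crd y₀ i ∘ σ) z a := by
      filter_upwards [hev] with z hz
      exact hz a
    rw [h1.fderiv_eq]
    have h2 : ∀ i, HasFDerivAt (fun z => fderiv ℝ (crd y₀ i ∘ σ) z a)
        ((ContinuousLinearMap.apply ℝ ℝ a).comp (fderiv ℝ (fderiv ℝ (crd y₀ i ∘ σ)) 0)) 0 := fun i =>
      (ContinuousLinearMap.apply ℝ ℝ a).hasFDerivAt.comp (0 : ℝ × ℝ)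
        ((hd i).differentiable (by simp) 0).hasFDerivAt
    have h3 : ∀ i, HasFDerivAt (coef η y₀ i ∘ σ) (fderiv ℝ (coef η y₀ i ∘ σ) 0) 0 := fun i =>
      ((hc i).differentiable (by simp) 0).hasFDerivAt
    have h4 := HasFDerivAt.fun_sum (u := Finset.univ) fun i _ => (h3 i).mul (h2 i)
    refine (congrArg (fun l : ℝ × ℝ →L[ℝ] ℝ => l b) h4.fderiv).trans ?_
    simp [hy]
  rw [key, key, ← Finset.sum_sub_distrib]
  refine Finset.sum_congr rfl fun i _ => ?_
  have hsym : fderiv ℝ (fderiv ℝ (crd y₀ i ∘ σ)) 0 (1, 0) (0, 1)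
      = fderiv ℝ (fderiv ℝ (crd y₀ i ∘ σ)) 0 (0, 1) (1, 0) :=
    ((hφ i).contDiffAt.isSymmSndFDerivAt (by simpa using two_le_infty)) (1, 0) (0, 1)
  rw [hsym, ← D_dir (smooth_crd y₀ i) hσ, ← D_dir (smooth_crd y₀ i) hσ,
    ← D_dir (hη.smooth_coef y₀ i) hσ, ← D_dir (hη.smooth_coef y₀ i) hσ, hv, hw]
  ring

/-- The exterior derivative along a two-parameter family. -/
theorem fderiv_family_eq_extd {η : N.TB → ℝ} (hη : IsOneForm η) {σ : ℝ × ℝ → N} (hσ : Fam σ)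
    (y : N) (v w : N.T y) (hv : dir σ 0 (1, 0) = ⟨y, v⟩) (hw : dir σ 0 (0, 1) = ⟨y, w⟩) :
    fderiv ℝ (fun z => η (dir σ z (0, 1))) 0 (1, 0) - fderiv ℝ (fun z => η (dir σ z (1, 0))) 0 (0, 1)
      = extd η y v w :=
  fderiv_family_eq_frame hη hσ y y (hη.local_form y) v w hv hw

/-- `extd` uses at each point the frame chosen for that point, with no relation between neighbours.
Both expressions equal the same mixed derivative along a surface, so the frame of `y₀` serves nearby
points as well; smoothness of `extd` rests on this. -/
theorem extd_eventually {η : N.TB → ℝ} (hη : IsOneForm η) (y₀ : N) :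
    ∀ᶠ y in nhds y₀, ∀ v w : N.T y, extd η y v w
      = ∑ i, (D (coef η y₀ i) ⟨y, v⟩ * D (crd y₀ i) ⟨y, w⟩
        - D (coef η y₀ i) ⟨y, w⟩ * D (crd y₀ i) ⟨y, v⟩) := by
  filter_upwards [(hη.local_form y₀).eventually_nhds] with y hy v w
  obtain ⟨σ, hσ, hv, hw⟩ := exists_surface y v w
  rw [← fderiv_family_eq_extd hη hσ y v w hv hw, fderiv_family_eq_frame hη hσ y₀ y hy v w hv hw]

theorem contMDiff_extd {η : N.TB → ℝ} (hη : IsOneForm η) {EK : Type*} [NormedAddCommGroup EK]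
    [NormedSpace ℝ EK] {HK : Type*} [TopologicalSpace HK] {I : ModelWithCorners ℝ EK HK} {K : Type*}
    [TopologicalSpace K] [ChartedSpace HK K] {a b : K → N.TB}
    (ha : ContMDiff I (𝓡 N.dim).tangent ∞ a) (hb : ContMDiff I (𝓡 N.dim).tangent ∞ b)
    (hab : ∀ k, (a k).1 = (b k).1) :
    ContMDiff I 𝓘(ℝ, ℝ) ∞ fun k => extd η (a k).1 (a k).2 (b k).2 := by
  intro k₀
  have h2 := (contMDiff_proj ha).continuous.continuousAt.eventually (extd_eventually hη (a k₀).1)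
  have h3 : ∀ k, (⟨(a k).1, (b k).2⟩ : N.TB) = b k := fun k => TB_ext (hab k) rfl
  have hD : ∀ {f : N → ℝ}, SmoothFn f → ∀ {c : K → N.TB}, ContMDiff I (𝓡 N.dim).tangent ∞ c →
      ContMDiff I 𝓘(ℝ, ℝ) ∞ fun k => D f (c k) := fun hf _ hc => (SmoothFn.D hf).comp hc
  refine ContMDiffAt.congr_of_eventuallyEq ?_ (h2.mono fun k hk => hk (a k).2 (b k).2)
  refine (ContMDiff.sum fun i _ => ?_ : ContMDiff I 𝓘(ℝ, ℝ) ∞ _) k₀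
  simp only [h3]
  exact ((hD (hη.smooth_coef _ i) ha).mul (hD (smooth_crd _ i) hb)).sub
    ((hD (hη.smooth_coef _ i) hb).mul (hD (smooth_crd _ i) ha))

theorem extd_D {F : N → ℝ} (hF : SmoothFn F) (y : N) (v w : N.T y) : extd (D F) y v w = 0 := by
  obtain ⟨σ, hσ, hv, hw⟩ := exists_surface y v w
  rw [← fderiv_family_eq_extd hF.isOneForm hσ y v w hv hw]
  have h1 : ∀ a b : ℝ × ℝ, fderiv ℝ (fun z => D F (dir σ z a)) 0 b
      = fderiv ℝ (fderiv ℝ (F ∘ σ)) 0 b a := by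
    intro a b
    have h2 : (fun z => D F (dir σ z a)) = fun z => fderiv ℝ (F ∘ σ) z a :=
      funext fun z => D_dir hF hσ z a
    have h3 : ContDiff ℝ ∞ (fderiv ℝ (F ∘ σ)) := (hσ.contDiff hF).fderiv_right (by simp)
    have h4 := (ContinuousLinearMap.apply ℝ ℝ a).hasFDerivAt.comp (0 : ℝ × ℝ)
        (h3.differentiable (by simp) 0).hasFDerivAt
    rw [h2]
    exact congrArg (fun l : ℝ × ℝ →L[ℝ] ℝ => l b) h4.fderiv
  rw [h1, h1, ((hσ.contDiff hF).contDiffAt.isSymmSndFDerivAt (by simpa using two_le_infty)) (1, 0) (0, 1), sub_self]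

end Mfd

end

/-! ### Points, vector fields and Lie brackets on towers. -/

section

namespace Tower

open Mfd

variable {T : Tower.{u}}

/-- The `k`-th component of a tangent vector, as a point of the tangent bundle. -/
def tb {p : T.Pt} (v : Vec p) (k : ℕ) : (T.M k).TB := ⟨p.at k, v k⟩

theorem mem_Tan_iff {p : T.Pt} {v : Vec p} :
    v ∈ Tan p ↔ ∀ k, TM (T.proj k) (tb v (k + 1)) = tb v k :=
  ⟨fun h k => TB_ext (p.2 k) (h k), fun h k => snd_eq_of_TB_eq (h k)⟩

theorem vec_ext {p : T.Pt} {v w : Vec p} (h : ∀ k, tb v k = tb w k) : v = w :=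
  funext fun k => snd_eq_of_TB_eq (h k)

/-- The tower without its first level. -/
def shift (T : Tower.{u}) : Tower.{u} := ⟨fun k => T.M (k + 1), fun k => T.proj (k + 1),
  fun k => T.proj_subm (k + 1)⟩

/-- Preimages are chosen upwards one level at a time, and a start at a higher level is reduced to
this by removing the bottom of the tower. In consequence a function on a level is determined by its
values at points of the limit. -/
theorem exists_pt (T : Tower.{u}) (m : ℕ) (y : T.M m) : ∃ p : T.Pt, p.at m = y := by
  induction m generalizing T with
  | zero =>
    let q : ∀ k, T.M k := fun k => Nat.rec y (fun k x => Function.surjInv (T.proj_subm k).surj x) k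
    exact ⟨⟨q, fun k => Function.surjInv_eq (T.proj_subm k).surj (q k)⟩, rfl⟩
  | succ m ih =>
    obtain ⟨p, hp⟩ := ih T.shift y
    refine ⟨⟨fun k => Nat.casesOn k (T.proj 0 (p.1 0)) fun k => p.1 k, fun k => ?_⟩, hp⟩
    cases k with
    | zero => rfl
    | succ k => exact p.2 k

theorem exists_tan {T : Tower.{u}} (p : T.Pt) (m : ℕ) (y : (T.M m).T (p.at m)) :
    ∃ v ∈ Tan p, v m = y := by
  induction m generalizing T with
  | zero =>
    have hs : ∀ (k : ℕ) (y : (T.M k).E), ∃ z : (T.M (k + 1)).T (p.at (k + 1)),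
        (d (T.proj k) (p.at (k + 1)) z : (T.M k).E) = y :=
      fun k y => (T.proj_subm k).submersion (p.at (k + 1)) y
    choose g hg using hs
    let q : Vec p := fun k => Nat.rec y (fun k x => g k x) k
    exact ⟨q, fun k => hg k (q k), rfl⟩
  | succ m ih =>
    let p' : T.shift.Pt := ⟨fun k => p.1 (k + 1), fun k => p.2 (k + 1)⟩
    obtain ⟨v, hv, hvm⟩ := ih p' y
    refine ⟨fun k => Nat.casesOn k (d (T.proj 0) (p.at 1) (v 0) : (T.M 0).E) fun k => v k,
      fun k => ?_, hvm⟩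
    cases k with
    | zero => rfl
    | succ k => exact hv k

theorem exists_pt_tan (T : Tower.{u}) (m : ℕ) (u : (T.M m).TB) :
    ∃ (p : T.Pt) (v : Vec p), v ∈ Tan p ∧ tb v m = u := by
  obtain ⟨y, a⟩ := u
  obtain ⟨p, rfl⟩ := T.exists_pt m y
  obtain ⟨v, hv, hvm⟩ := exists_tan p m a
  exact ⟨p, v, hv, TB_ext rfl hvm⟩

theorem exists_pr (T : Tower.{u}) {m n : ℕ} (h : m ≤ n) : ∃ f : T.M n → T.M m, Smooth f ∧
    (∀ p : T.Pt, f (p.at n) = p.at m) ∧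
    ∀ (p : T.Pt) (v : Vec p), v ∈ Tan p → TM f (tb v n) = tb v m := by
  induction n, h using Nat.le_induction with
  | base =>
    refine ⟨id, contMDiff_id, fun _ => rfl, fun p v _ => TB_ext rfl ?_⟩
    exact congrArg (fun l : (T.M m).E →L[ℝ] (T.M m).E => l (v m)) mfderiv_id
  | succ n _ ih =>
    obtain ⟨f, hf, h1, h2⟩ := ih
    refine ⟨f ∘ T.proj n, ContMDiff.comp hf (T.proj_subm n).smooth, fun p => ?_, fun p v hv => ?_⟩
    · rw [Function.comp_apply, p.2 n]; exact h1 p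
    · rw [TM_comp hf (T.proj_subm n).smooth, mem_Tan_iff.mp hv n, h2 p v hv]

/-- The projection between two levels of a tower. -/
def pr (T : Tower.{u}) {m n : ℕ} (h : m ≤ n) : T.M n → T.M m := (T.exists_pr h).choose

theorem smooth_pr (T : Tower.{u}) {m n : ℕ} (h : m ≤ n) : Smooth (T.pr h) :=
  (T.exists_pr h).choose_spec.1

theorem pr_at (T : Tower.{u}) {m n : ℕ} (h : m ≤ n) (p : T.Pt) : T.pr h (p.at n) = p.at m :=
  (T.exists_pr h).choose_spec.2.1 p

theorem TM_pr (T : Tower.{u}) {m n : ℕ} (h : m ≤ n) {p : T.Pt} {v : Vec p} (hv : v ∈ Tan p) :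
    TM (T.pr h) (tb v n) = tb v m :=
  (T.exists_pr h).choose_spec.2.2 p v hv

theorem tan_ext {p : T.Pt} {v w : Vec p}
    (h : ∀ (k : ℕ) (F : T.M k → ℝ), SmoothFn F → D F (tb v k) = D F (tb w k)) : v = w :=
  vec_ext fun k => TB_ext_D rfl (h k)

theorem isSmoothFun_at {k : ℕ} {F : T.M k → ℝ} (hF : SmoothFn F) :
    IsSmoothFun fun p : T.Pt => F (p.at k) := ⟨k, F, hF, fun _ => rfl⟩

theorem IsSmoothFun.raise {f : T.Pt → ℝ} (hf : IsSmoothFun f) (n : ℕ) :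
    ∃ m ≥ n, ∃ F : T.M m → ℝ, SmoothFn F ∧ ∀ p : T.Pt, f p = F (p.at m) := by
  obtain ⟨m, F, hF, h⟩ := hf
  refine ⟨max m n, le_max_right _ _, F ∘ T.pr (le_max_left m n), SmoothFn.comp hF (T.smooth_pr _),
    fun p => ?_⟩
  rw [Function.comp_apply, T.pr_at, h]

/-- The derivative does not depend on the level or the representative: of two representatives, the
one at the higher level is the pull-back of the other, because points of the limit fill every level.
-/
theorem deriv_eq {f : T.Pt → ℝ} {m : ℕ} {F : T.M m → ℝ} (hF : SmoothFn F)
    (h : ∀ p : T.Pt, f p = F (p.at m)) {p : T.Pt} {v : Vec p} (hv : v ∈ Tan p) :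
    deriv f v = D F (tb v m) := by
  have hf : IsSmoothFun f := ⟨m, F, hF, h⟩
  have key : ∀ {m n : ℕ} {F : T.M m → ℝ} {G : T.M n → ℝ}, m ≤ n → SmoothFn F → SmoothFn G →
      (∀ p : T.Pt, F (p.at m) = G (p.at n)) → D F (tb v m) = D G (tb v n) := by
    intro m n F G hmn hF hG hFG
    have h1 : G = F ∘ T.pr hmn := by
      funext y
      obtain ⟨q, rfl⟩ := T.exists_pt n y
      rw [Function.comp_apply, T.pr_at, hFG]
    rw [h1, D_comp hF (T.smooth_pr _), T.TM_pr _ hv]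
  have h1 := hf.choose_spec.choose_spec
  have h0 : deriv f v = D hf.choose_spec.choose (tb v hf.choose) := dif_pos hf
  rw [h0]
  rcases le_total hf.choose m with hle | hle
  · exact key hle h1.1 hF fun p => (h1.2 p).symm.trans (h p)
  · exact (key hle hF h1.1 fun p => (h p).symm.trans (h1.2 p)).symm

theorem deriv_at {k : ℕ} {F : T.M k → ℝ} (hF : SmoothFn F) {p : T.Pt} {v : Vec p} (hv : v ∈ Tan p) :
    deriv (fun p : T.Pt => F (p.at k)) v = D F (tb v k) := deriv_eq hF (fun _ => rfl) hv

theorem IsSmoothFun.exists_common {f g : T.Pt → ℝ} (hf : IsSmoothFun f) (hg : IsSmoothFun g) :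
    ∃ (m : ℕ) (F G : T.M m → ℝ), SmoothFn F ∧ SmoothFn G ∧ (∀ p : T.Pt, f p = F (p.at m)) ∧
      ∀ p : T.Pt, g p = G (p.at m) := by
  obtain ⟨m, F, hF, h⟩ := hf
  obtain ⟨n, hn, G, hG, h'⟩ := hg.raise m
  refine ⟨n, F ∘ T.pr hn, G, SmoothFn.comp hF (T.smooth_pr _), hG, fun p => ?_, h'⟩
  rw [Function.comp_apply, T.pr_at, h]

theorem deriv_add {f g : T.Pt → ℝ} (hf : IsSmoothFun f) (hg : IsSmoothFun g) {p : T.Pt} {v : Vec p}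
    (hv : v ∈ Tan p) : deriv (fun p => f p + g p) v = deriv f v + deriv g v := by
  obtain ⟨m, F, G, hF, hG, h, h'⟩ := hf.exists_common hg
  rw [deriv_eq (hF.add hG) (fun p => by rw [h, h']) hv, deriv_eq hF h hv, deriv_eq hG h' hv, D_add hF hG]

theorem deriv_mul {f g : T.Pt → ℝ} (hf : IsSmoothFun f) (hg : IsSmoothFun g) {p : T.Pt} {v : Vec p}
    (hv : v ∈ Tan p) : deriv (fun p => f p * g p) v = f p * deriv g v + g p * deriv f v := by
  obtain ⟨m, F, G, hF, hG, h, h'⟩ := hf.exists_common hg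
  rw [deriv_eq (hF.mul hG) (fun p => by rw [h, h']) hv, deriv_eq hF h hv, deriv_eq hG h' hv, D_mul hF hG,
    h, h']
  rfl

theorem deriv_const (c : ℝ) {p : T.Pt} {v : Vec p} (hv : v ∈ Tan p) :
    deriv (fun _ : T.Pt => c) v = 0 := by
  rw [deriv_eq (m := 0) (smoothFn_const c) (fun _ => rfl) hv, D_const]

theorem deriv_vec_add {f : T.Pt → ℝ} (hf : IsSmoothFun f) {p : T.Pt} {v w : Vec p} (hv : v ∈ Tan p)
    (hw : w ∈ Tan p) : deriv f (v + w) = deriv f v + deriv f w := by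
  obtain ⟨m, F, hF, h⟩ := hf
  rw [deriv_eq hF h hv, deriv_eq hF h hw, deriv_eq hF h (add_mem hv hw)]
  exact D_add_vec F _ _ _

theorem deriv_vec_smul {f : T.Pt → ℝ} (hf : IsSmoothFun f) {p : T.Pt} {v : Vec p} (hv : v ∈ Tan p)
    (c : ℝ) : deriv f (c • v) = c * deriv f v := by
  obtain ⟨m, F, hF, h⟩ := hf
  rw [deriv_eq hF h hv, deriv_eq hF h (Submodule.smul_mem _ c hv)]
  exact D_smul_vec F _ _ _

/-- Cartan's formula for the exterior derivative, before the bracket is known to exist. -/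
theorem deriv_form_sub {V W : ∀ p : T.Pt, Vec p} (hV : IsVectorField V) (hW : IsVectorField W)
    {k : ℕ} {η : (T.M k).TB → ℝ} (hη : IsOneForm η) (p : T.Pt) :
    deriv (fun q => η (tb (W q) k)) (V p) - deriv (fun q => η (tb (V q) k)) (W p)
      = (∑ i, coef η (p.at k) i (p.at k) *
        (deriv (fun q => D (crd (p.at k) i) (tb (W q) k)) (V p)
          - deriv (fun q => D (crd (p.at k) i) (tb (V q) k)) (W p)))
        + extd η (p.at k) (V p k) (W p k) := by
  set y := p.at k with hy
  -- The Leibniz rule for ∑ cᵢ dφᵢ. The derivatives of the cᵢ assemble to `extd`, those of the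
  -- dφᵢ(W) to the coordinates of the bracket.
  have key : ∀ {V W : ∀ p : T.Pt, Vec p}, IsVectorField V → IsVectorField W →
      deriv (fun q => η (tb (W q) k)) (V p)
        = ∑ i, (coef η y i y * deriv (fun q => D (crd y i) (tb (W q) k)) (V p)
          + D (crd y i) (tb (W p) k) * D (coef η y i) (tb (V p) k)) := by
    intro V W hV hW
    obtain ⟨n, G, hG, h⟩ := hW.2 k
    have hb : Smooth (fun x => (G x).1) := contMDiff_proj hG
    have hc : ∀ i, SmoothFn (fun x => coef η y i (G x).1) := fun i => (hη.smooth_coef y i).comp hb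
    have hd : ∀ i, SmoothFn (fun x => D (crd y i) (G x)) := fun i => (SmoothFn.D (smooth_crd y i)).comp hG
    have hηG : SmoothFn (fun x => η (G x)) := hη.smooth.comp hG
    have hpy : (G (p.at n)).1 = y := by rw [h p]
    have hloc : (fun x => η (G x)) =ᶠ[nhds (p.at n)]
        fun x => ∑ i, coef η y i (G x).1 * D (crd y i) (G x) := by
      have h1 : Filter.Tendsto (fun x => (G x).1) (nhds (p.at n)) (nhds y) :=
        hpy ▸ hb.continuous.tendsto (p.at n)
      filter_upwards [h1.eventually (hη.local_form y)] with x hx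
      exact hx _ rfl
    rw [deriv_eq (f := fun q => η (tb (W q) k)) hηG (fun q => (congrArg η (h q)).symm) (hV.1 p), D_congr hloc,
      D_sum _ fun i => (hc i).mul (hd i)]
    refine Finset.sum_congr rfl fun i _ => ?_
    rw [D_mul (hc i) (hd i),
      deriv_eq (f := fun q => D (crd y i) (tb (W q) k)) (hd i)
        (fun q => (congrArg (D (crd y i)) (h q)).symm) (hV.1 p),
      ← deriv_eq (f := fun q => coef η y i (q.at k)) (hc i)
        (fun q => by rw [h q]) (hV.1 p), deriv_at (hη.smooth_coef y i) (hV.1 p)]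
    congr 2
    · exact congrArg (coef η y i) hpy
    · exact congrArg (D (crd y i)) (h p)
  rw [key hV hW, key hW hV, extd, ← Finset.sum_sub_distrib, ← Finset.sum_add_distrib]
  refine Finset.sum_congr rfl fun i _ => ?_
  simp only [tb]
  ring

/-- The Lie bracket of vector fields on a pf-manifold exists. -/
theorem deriv_lieBracket {V W : ∀ p : T.Pt, Vec p} (hV : IsVectorField V) (hW : IsVectorField W)
    (p : T.Pt) {f : T.Pt → ℝ} (hf : IsSmoothFun f) :
    deriv f (lieBracket V W p : Vec p)
      = deriv (fun q => deriv f (W q)) (V p) - deriv (fun q => deriv f (V q)) (W p) := by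
  have hex : ∃ u : Tan p, ∀ f : T.Pt → ℝ, IsSmoothFun f →
      deriv f u.1 = deriv (fun q => deriv f (W q)) (V p) - deriv (fun q => deriv f (V q)) (W p) := by
    -- These are the coordinates of the bracket at each level. For η = dF the term `extd` vanishes,
    -- so `u` acts on functions as the commutator, and this action forces the levels to be
    -- compatible.
    let u : Vec p := fun k => ∑ i, (deriv (fun q => D (crd (p.at k) i) (tb (W q) k)) (V p)
          - deriv (fun q => D (crd (p.at k) i) (tb (V q) k)) (W p)) • frm (p.at k) i (p.at k)
    have hu : ∀ (k : ℕ) (F : T.M k → ℝ), SmoothFn F → D F (tb u k)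
        = deriv (fun q => D F (tb (W q) k)) (V p) - deriv (fun q => D F (tb (V q) k)) (W p) := by
      intro k F hF
      have h1 := deriv_form_sub hV hW hF.isOneForm p
      rw [extd_D hF, add_zero] at h1
      rw [h1, tb, hF.isOneForm.sum]
      refine Finset.sum_congr rfl fun i _ => ?_
      rw [hF.isOneForm.smul, mul_comm]
      rfl
    have hT : u ∈ Tan p := by
      refine mem_Tan_iff.mpr fun k => TB_ext_D (p.2 k) fun F hF => ?_
      have hF' : SmoothFn (F ∘ T.proj k) := hF.comp (T.proj_subm k).smooth
      have h1 : ∀ {V : ∀ p : T.Pt, Vec p}, IsVectorField V →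
          (fun q => D (F ∘ T.proj k) (tb (V q) (k + 1))) = fun q => D F (tb (V q) k) :=
        fun hV => funext fun q => by
          rw [D_comp hF (T.proj_subm k).smooth, mem_Tan_iff.mp (hV.1 q) k]
      rw [← D_comp hF (T.proj_subm k).smooth, hu _ _ hF', hu _ _ hF, h1 hV, h1 hW]
    refine ⟨⟨u, hT⟩, fun f hf => ?_⟩
    obtain ⟨k, F, hF, h⟩ := hf
    have h1 : ∀ {V : ∀ p : T.Pt, Vec p}, IsVectorField V →
        (fun q => deriv f (V q)) = fun q => D F (tb (V q) k) :=
      fun hV => funext fun q => deriv_eq hF h (hV.1 q)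
    rw [deriv_eq hF h hT, h1 hV, h1 hW, hu k F hF]
  have h2 : lieBracket V W p = hex.choose := dif_pos hex
  rw [h2]
  exact hex.choose_spec f hf

theorem D_lieBracket {V W : ∀ p : T.Pt, Vec p} (hV : IsVectorField V) (hW : IsVectorField W)
    (p : T.Pt) {k : ℕ} {F : T.M k → ℝ} (hF : SmoothFn F) :
    D F (tb (lieBracket V W p : Vec p) k)
      = deriv (fun q => D F (tb (W q) k)) (V p) - deriv (fun q => D F (tb (V q) k)) (W p) := by
  have h1 : ∀ {V : ∀ p : T.Pt, Vec p}, IsVectorField V →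
      (fun q => deriv (fun p : T.Pt => F (p.at k)) (V q)) = fun q => D F (tb (V q) k) :=
    fun hV => funext fun q => deriv_at hF (hV.1 q)
  rw [← deriv_at hF (lieBracket V W p).2, deriv_lieBracket hV hW p (isSmoothFun_at hF), h1 hV, h1 hW]

/-- Cartan's formula for the exterior derivative. -/
theorem extd_eq {V W : ∀ p : T.Pt, Vec p} (hV : IsVectorField V) (hW : IsVectorField W)
    {k : ℕ} {η : (T.M k).TB → ℝ} (hη : IsOneForm η) (p : T.Pt) :
    extd η (p.at k) (V p k) (W p k)
      = deriv (fun q => η (tb (W q) k)) (V p) - deriv (fun q => η (tb (V q) k)) (W p)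
        - η (tb (lieBracket V W p : Vec p) k) := by
  have h1 := deriv_form_sub hV hW hη p
  have h2 : η (tb (lieBracket V W p : Vec p) k) = ∑ i, coef η (p.at k) i (p.at k) *
        (deriv (fun q => D (crd (p.at k) i) (tb (W q) k)) (V p)
          - deriv (fun q => D (crd (p.at k) i) (tb (V q) k)) (W p)) := by
    rw [(hη.local_form (p.at k)).self_of_nhds _ rfl]
    exact Finset.sum_congr rfl fun i _ => by rw [D_lieBracket hV hW p (smooth_crd _ i)]
  rw [h1, h2]
  ring

/-- Tangent vectors extend to vector fields. -/
theorem exists_vectorField {p : T.Pt} {v : Vec p} (hv : v ∈ Tan p) :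
    ∃ V : ∀ p : T.Pt, Vec p, IsVectorField V ∧ V p = v := by
  let S : ℕ → Type u := fun k => {V : ∀ x : T.M k, (T.M k).T x // Mfd.IsVectorField V ∧ V (p.at k) = v k}
  have hstep : ∀ (k : ℕ) (V : S k), ∃ W : S (k + 1), ∀ x, TM (T.proj k) ⟨x, W.1 x⟩ = ⟨T.proj k x, V.1 (T.proj k x)⟩ := by
    intro k V
    have h0 : TM (T.proj k) ⟨p.at (k + 1), v (k + 1)⟩ = ⟨T.proj k (p.at (k + 1)), V.1 (T.proj k (p.at (k + 1)))⟩ := by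
      refine (mem_Tan_iff.mp hv k).trans (TB_ext (p.2 k).symm ?_)
      change v k = (V.1 (T.proj k (p.at (k + 1))) : (T.M k).E)
      rw [p.2 k]
      exact V.2.2.symm
    obtain ⟨W, hW, h1, h2⟩ := Mfd.exists_lift (h := id) contMDiff_id (T.proj_subm k)
      (w := fun x => ⟨T.proj k x, V.1 (T.proj k x)⟩) (ContMDiff.comp V.2.1 (T.proj_subm k).smooth)
      (fun _ => rfl) (p.at (k + 1)) (v (k + 1)) h0
    exact ⟨⟨W, hW, h2⟩, h1⟩
  choose next hnext using hstep
  obtain ⟨V₀, hV₀⟩ := Mfd.exists_vectorField (p.at 0) (v 0)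
  let s : ∀ k, S k := fun k => Nat.rec ⟨V₀, hV₀⟩ next k
  refine ⟨fun q k => (s k).1 (q.at k), ⟨fun q => ?_, fun k => ⟨k, _, (s k).2.1, fun q => rfl⟩⟩,
    funext fun k => (s k).2.2⟩
  refine mem_Tan_iff.mpr fun k => ?_
  refine (hnext k (s k) (q.at (k + 1))).trans ?_
  exact congrArg (fun x => (⟨x, (s k).1 x⟩ : (T.M k).TB)) (q.2 k)

end Tower

end

/-! ### The tangent groupoid and its action on tangent vectors. -/

section

namespace Mfd

variable {M : Mfd.{u}} {N : Mfd.{v}} {L : Mfd.{w}} {B : Mfd.{z}}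
variable {EK : Type*} [NormedAddCommGroup EK] [NormedSpace ℝ EK] {HK : Type*} [TopologicalSpace HK]
  {I : ModelWithCorners ℝ EK HK} {K : Type*} [TopologicalSpace K] [ChartedSpace HK K]

/-- The zero tangent vector at a point. -/
def zt (x : N) : N.TB := ⟨x, (0 : N.T x)⟩

theorem D_zt (f : N → ℝ) (x : N) : D f (zt x) = 0 := D_zero_vec f x

theorem TM_zt (f : M → N) (x : M) : TM f (zt x) = zt (f x) :=
  TB_ext rfl (map_zero (d f x))

theorem T₂_zt (f : M → N → L) (S : Set (M × N)) (x : M) (y : N) :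
    T₂ f S (zt x) (zt y) = zt (f x y) :=
  TB_ext rfl (map_zero (mfderivWithin ((𝓡 M.dim).prod (𝓡 N.dim)) (𝓡 L.dim)
    (fun q : M × N => f q.1 q.2) S (x, y)))

theorem contMDiff_zt {f : K → N} (hf : ContMDiff I (𝓡 N.dim) ∞ f) :
    ContMDiff I (𝓡 N.dim).tangent ∞ fun k => zt (f k) :=
  contMDiff_TB hf fun F _ => (contMDiff_const (c := (0 : ℝ))).congr fun k => D_zt F (f k)

/-- The difference of two tangent vectors at the same point. -/
def tsub (u v : N.TB) : N.TB := ⟨u.1, @HSub.hSub N.E N.E N.E _ u.2 v.2⟩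

theorem D_tsub (f : N → ℝ) {u v : N.TB} (h : u.1 = v.1) : D f (tsub u v) = D f u - D f v := by
  obtain ⟨x, a⟩ := u
  obtain ⟨y, b⟩ := v
  obtain rfl : x = y := h
  exact D_sub_vec f x a b

theorem TM_tsub (f : M → N) {u v : M.TB} (h : u.1 = v.1) :
    TM f (tsub u v) = tsub (TM f u) (TM f v) := by
  obtain ⟨x, a⟩ := u
  obtain ⟨y, b⟩ := v
  obtain rfl : x = y := h
  exact TB_ext rfl (map_sub (d f x) a b)

theorem tsub_self (u : N.TB) : tsub u u = zt u.1 := TB_ext rfl (sub_self (u.2 : N.E))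

theorem contMDiff_tsub {u v : K → N.TB} (hu : ContMDiff I (𝓡 N.dim).tangent ∞ u)
    (hv : ContMDiff I (𝓡 N.dim).tangent ∞ v) (h : ∀ k, (u k).1 = (v k).1) :
    ContMDiff I (𝓡 N.dim).tangent ∞ fun k => tsub (u k) (v k) :=
  contMDiff_TB (show ContMDiff I (𝓡 N.dim) ∞ fun k => (u k).1 from contMDiff_proj hu) fun F hF =>
    (((SmoothFn.D hF).comp hu).sub ((SmoothFn.D hF).comp hv)).congr fun k => D_tsub F (h k)

theorem TM_id (u : M.TB) : TM id u = u :=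
  TB_ext rfl (congrArg (fun l : M.E →L[ℝ] M.E => l u.2) mfderiv_id)

theorem IsOneForm.zero {η : N.TB → ℝ} (hη : IsOneForm η) (x : N) : η (zt x) = 0 := by
  have h := hη.smul x 0 0
  rw [zero_smul, zero_mul] at h
  exact h

theorem dir_reparam {r : ℝ → ℝ} (hr : ∀ᶠ t in nhds 0, r t = t) {γ : ℝ → N} (hγ : Fam γ) :
    dir (γ ∘ r) 0 1 = dir γ 0 1 := by
  have h := fderiv_of_eventually_id hr
  have h0 : r 0 = 0 := hr.self_of_nhds
  rw [dir_comp hγ h.differentiableAt, h.fderiv, h0]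
  rfl

/-- Compatible tangent vectors are the velocities of compatible curves. -/
theorem exists_pair {s : M → B} {t : N → B} (hs : Smooth s)
    (hsub : ∀ x, Function.Surjective (d s x)) (ht : Smooth t) {a : M.TB} {ψ : ℝ → N} (hψ : Fam ψ)
    (h : TM s a = TM t (dir ψ 0 1)) :
    ∃ (r : ℝ → ℝ) (φ : ℝ → M), ContDiff ℝ ∞ r ∧ (∀ᶠ t in nhds 0, r t = t) ∧ Fam φ ∧
      (∀ z, s (φ z) = t (ψ (r z))) ∧ dir φ 0 1 = a := by
  obtain ⟨r, φ, hr, hr1, -, hφ, h1, h2⟩ := exists_curve_lift hs (hψ.comp ht) a (hsub _)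
    (h.trans (TM_dir ht hψ 0 1))
  exact ⟨r, φ, hr, hr1, hφ, h1, h2⟩

theorem exists_pair' {s : M → B} {t : N → B} (hs : Smooth s)
    (hsub : ∀ x, Function.Surjective (d s x)) (ht : Smooth t) {a : M.TB} {b : N.TB}
    (h : TM s a = TM t b) :
    ∃ (φ : ℝ → M) (ψ : ℝ → N), Fam φ ∧ Fam ψ ∧ (∀ z, s (φ z) = t (ψ z)) ∧ dir φ 0 1 = a ∧
      dir ψ 0 1 = b := by
  obtain ⟨ψ, hψ, rfl⟩ := exists_curve b
  obtain ⟨r, φ, hr, hr1, hφ, h1, h2⟩ := exists_pair hs hsub ht hψ h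
  exact ⟨φ, ψ ∘ r, hφ, hψ.comp_left hr, h1, h2, dir_reparam hr1 hψ⟩

theorem exists_triple {B' : Mfd.{z}} {s : M → B} {t : N → B} {s' : N → B'} {t' : L → B'}
    (hs : Smooth s) (hsub : ∀ x, Function.Surjective (d s x)) (ht : Smooth t)
    (hs' : Smooth s') (hsub' : ∀ x, Function.Surjective (d s' x)) (ht' : Smooth t')
    {a : M.TB} {b : N.TB} {c : L.TB} (h : TM s a = TM t b) (h' : TM s' b = TM t' c) :
    ∃ (φ : ℝ → M) (ψ : ℝ → N) (χ : ℝ → L), Fam φ ∧ Fam ψ ∧ Fam χ ∧ (∀ z, s (φ z) = t (ψ z)) ∧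
      (∀ z, s' (ψ z) = t' (χ z)) ∧ dir φ 0 1 = a ∧ dir ψ 0 1 = b ∧ dir χ 0 1 = c := by
  obtain ⟨ψ, χ, hψ, hχ, h1, rfl, rfl⟩ := exists_pair' hs' hsub' ht' h'
  obtain ⟨r, φ, hr, hr1, hφ, h2, h3⟩ := exists_pair hs hsub ht hψ h
  exact ⟨φ, ψ ∘ r, χ ∘ r, hφ, hψ.comp_left hr, hχ.comp_left hr, h2, fun z => h1 (r z), h3,
    dir_reparam hr1 hψ, dir_reparam hr1 hχ⟩

end Mfd

open Mfd

namespace LieGroupoid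

variable {X : Mfd.{u}} (G : LieGroupoid.{u, v} X)
variable {EK : Type*} [NormedAddCommGroup EK] [NormedSpace ℝ EK] {HK : Type*} [TopologicalSpace HK]
  {I : ModelWithCorners ℝ EK HK} {K : Type*} [TopologicalSpace K] [ChartedSpace HK K]

/-- The multiplication of the tangent groupoid. -/
def Tm (a b : G.arr.TB) : G.arr.TB := T₂ G.mul {q | G.src q.1 = G.tgt q.2} a b

variable {G}

theorem fam_mul {E : Type*} [NormedAddCommGroup E] [NormedSpace ℝ E] {φ ψ : E → G.arr} (hφ : Fam φ)
    (hψ : Fam ψ) (h : ∀ z, G.src (φ z) = G.tgt (ψ z)) : Fam fun z => G.mul (φ z) (ψ z) :=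
  SmoothOn₂.fam G.mul_smooth hφ hψ h

theorem dir_mul {E : Type*} [NormedAddCommGroup E] [NormedSpace ℝ E] {φ ψ : E → G.arr} (hφ : Fam φ)
    (hψ : Fam ψ) (h : ∀ z, G.src (φ z) = G.tgt (ψ z)) (z w : E) :
    dir (fun z => G.mul (φ z) (ψ z)) z w = G.Tm (dir φ z w) (dir ψ z w) :=
  dir_T₂ G.mul_smooth hφ hψ h z w

theorem contMDiff_Tm {a b : K → G.arr.TB} (ha : ContMDiff I (𝓡 G.arr.dim).tangent ∞ a)
    (hb : ContMDiff I (𝓡 G.arr.dim).tangent ∞ b) (h : ∀ k, TM G.src (a k) = TM G.tgt (b k)) :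
    ContMDiff I (𝓡 G.arr.dim).tangent ∞ fun k => G.Tm (a k) (b k) :=
  contMDiff_T₂ G.src_subm.smooth G.src_subm.submersion G.tgt_subm.smooth G.mul_smooth ha hb h

theorem Tm_zt (g h : G.arr) : G.Tm (zt g) (zt h) = zt (G.mul g h) := T₂_zt _ _ g h

/-- Composable vectors are velocities of composable curves, so a law of the tangent groupoid is the
derivative of a law of the groupoid along such curves. The laws for the action, the division map and
the tower projections are obtained in the same way. -/
theorem Tm_src {a b : G.arr.TB} (h : TM G.src a = TM G.tgt b) :
    TM G.src (G.Tm a b) = TM G.src b := by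
  obtain ⟨φ, ψ, hφ, hψ, hc, rfl, rfl⟩ :=
    exists_pair' G.src_subm.smooth G.src_subm.submersion G.tgt_subm.smooth h
  rw [← LieGroupoid.dir_mul hφ hψ hc, TM_dir G.src_subm.smooth (SmoothOn₂.fam G.mul_smooth hφ hψ hc),
    TM_dir G.src_subm.smooth hψ]
  exact congrArg (fun e : ℝ → X => dir e 0 1) (funext fun z => G.src_mul _ _ (hc z))

theorem Tm_assoc {a b c : G.arr.TB} (h : TM G.src a = TM G.tgt b) (h' : TM G.src b = TM G.tgt c) :
    G.Tm (G.Tm a b) c = G.Tm a (G.Tm b c) := by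
  obtain ⟨φ, ψ, χ, hφ, hψ, hχ, hc, hc', rfl, rfl, rfl⟩ :=
    exists_triple G.src_subm.smooth G.src_subm.submersion G.tgt_subm.smooth
      G.src_subm.smooth G.src_subm.submersion G.tgt_subm.smooth h h'
  rw [← LieGroupoid.dir_mul hφ hψ hc, ← LieGroupoid.dir_mul hψ hχ hc',
    ← LieGroupoid.dir_mul (SmoothOn₂.fam G.mul_smooth hφ hψ hc) hχ
      (fun z => (G.src_mul _ _ (hc z)).trans (hc' z)),
    ← LieGroupoid.dir_mul hφ (SmoothOn₂.fam G.mul_smooth hψ hχ hc')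
      (fun z => (hc z).trans (G.tgt_mul _ _ (hc' z)).symm)]
  exact congrArg (fun e : ℝ → G.arr => dir e 0 1)
    (funext fun z => G.mul_assoc _ _ _ (hc z) (hc' z))

theorem Tm_one_right (a : G.arr.TB) : G.Tm a (TM G.one (TM G.src a)) = a := by
  obtain ⟨φ, hφ, rfl⟩ := exists_curve a
  rw [TM_dir G.src_subm.smooth hφ, TM_dir G.one_smooth (hφ.comp G.src_subm.smooth),
    ← LieGroupoid.dir_mul hφ ((hφ.comp G.src_subm.smooth).comp G.one_smooth)
      (fun z => (G.tgt_one _).symm)]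
  exact congrArg (fun e : ℝ → G.arr => dir e 0 1) (funext fun z => G.mul_one _)

theorem TM_src_one (x : X.TB) : TM G.src (TM G.one x) = x := by
  rw [← TM_comp G.src_subm.smooth G.one_smooth, show G.src ∘ G.one = id from funext G.src_one, TM_id]

theorem TM_tgt_one (x : X.TB) : TM G.tgt (TM G.one x) = x := by
  rw [← TM_comp G.tgt_subm.smooth G.one_smooth, show G.tgt ∘ G.one = id from funext G.tgt_one, TM_id]

theorem TM_src_inv (a : G.arr.TB) : TM G.src (TM G.inv a) = TM G.tgt a := by
  rw [← TM_comp G.src_subm.smooth G.inv_smooth, show G.src ∘ G.inv = G.tgt from funext G.src_inv]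

theorem TM_tgt_inv (a : G.arr.TB) : TM G.tgt (TM G.inv a) = TM G.src a := by
  rw [← TM_comp G.tgt_subm.smooth G.inv_smooth, show G.tgt ∘ G.inv = G.src from funext G.tgt_inv]

theorem inv_inv (g : G.arr) : G.inv (G.inv g) = g := by
  have h1 := G.mul_assoc (G.inv (G.inv g)) (G.inv g) g (by rw [G.src_inv]) (by rw [G.src_inv])
  rw [G.inv_mul (G.inv g), G.src_inv, G.one_mul g, G.inv_mul] at h1
  have h3 := G.mul_one (G.inv (G.inv g))
  rw [G.src_inv (G.inv g), G.tgt_inv] at h3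
  exact h3.symm.trans h1.symm

theorem TM_inv_inv (a : G.arr.TB) : TM G.inv (TM G.inv a) = a := by
  rw [← TM_comp G.inv_smooth G.inv_smooth, show G.inv ∘ G.inv = id from funext G.inv_inv, TM_id]

end LieGroupoid

namespace PrincipalBundle

variable {X : Mfd.{u}} {G : LieGroupoid.{u, v} X} {M : Mfd.{w}} (P : PrincipalBundle.{u, v, w, z} G M)
variable {EK : Type*} [NormedAddCommGroup EK] [NormedSpace ℝ EK] {HK : Type*} [TopologicalSpace HK]
  {I : ModelWithCorners ℝ EK HK} {K : Type*} [TopologicalSpace K] [ChartedSpace HK K]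

/-- The action of the tangent groupoid. -/
def Ta (a : G.arr.TB) (b : P.tot.TB) : P.tot.TB := T₂ P.act {q | G.src q.1 = P.mom q.2} a b

/-- The differential of the division map. -/
def Tdiv (b c : P.tot.TB) : G.arr.TB := T₂ P.div {q | P.pr q.1 = P.pr q.2} b c

variable {P}

theorem fam_act {E : Type*} [NormedAddCommGroup E] [NormedSpace ℝ E] {φ : E → G.arr} {ψ : E → P.tot}
    (hφ : Fam φ) (hψ : Fam ψ) (h : ∀ z, G.src (φ z) = P.mom (ψ z)) :
    Fam fun z => P.act (φ z) (ψ z) :=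
  SmoothOn₂.fam P.act_smooth hφ hψ h

theorem dir_act {E : Type*} [NormedAddCommGroup E] [NormedSpace ℝ E] {φ : E → G.arr} {ψ : E → P.tot}
    (hφ : Fam φ) (hψ : Fam ψ) (h : ∀ z, G.src (φ z) = P.mom (ψ z)) (z w : E) :
    dir (fun z => P.act (φ z) (ψ z)) z w = P.Ta (dir φ z w) (dir ψ z w) :=
  dir_T₂ P.act_smooth hφ hψ h z w

theorem contMDiff_Ta {a : K → G.arr.TB} {b : K → P.tot.TB}
    (ha : ContMDiff I (𝓡 G.arr.dim).tangent ∞ a) (hb : ContMDiff I (𝓡 P.tot.dim).tangent ∞ b)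
    (h : ∀ k, TM G.src (a k) = TM P.mom (b k)) :
    ContMDiff I (𝓡 P.tot.dim).tangent ∞ fun k => P.Ta (a k) (b k) :=
  contMDiff_T₂ G.src_subm.smooth G.src_subm.submersion P.mom_smooth P.act_smooth ha hb h

theorem Ta_zt (g : G.arr) (p : P.tot) : P.Ta (zt g) (zt p) = zt (P.act g p) := T₂_zt _ _ g p

theorem dir_div {E : Type*} [NormedAddCommGroup E] [NormedSpace ℝ E] {φ ψ : E → P.tot}
    (hφ : Fam φ) (hψ : Fam ψ) (h : ∀ z, P.pr (φ z) = P.pr (ψ z)) (z w : E) :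
    dir (fun z => P.div (φ z) (ψ z)) z w = P.Tdiv (dir φ z w) (dir ψ z w) :=
  dir_T₂ P.div_smooth hφ hψ h z w

theorem contMDiff_Tdiv {a b : K → P.tot.TB} (ha : ContMDiff I (𝓡 P.tot.dim).tangent ∞ a)
    (hb : ContMDiff I (𝓡 P.tot.dim).tangent ∞ b) (h : ∀ k, TM P.pr (a k) = TM P.pr (b k)) :
    ContMDiff I (𝓡 G.arr.dim).tangent ∞ fun k => P.Tdiv (a k) (b k) :=
  contMDiff_T₂ P.pr_subm.smooth P.pr_subm.submersion P.pr_subm.smooth P.div_smooth ha hb h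

theorem Ta_mom {a : G.arr.TB} {b : P.tot.TB} (h : TM G.src a = TM P.mom b) :
    TM P.mom (P.Ta a b) = TM G.tgt a := by
  obtain ⟨φ, ψ, hφ, hψ, hc, rfl, rfl⟩ :=
    exists_pair' G.src_subm.smooth G.src_subm.submersion P.mom_smooth h
  rw [← PrincipalBundle.dir_act hφ hψ hc, TM_dir P.mom_smooth (SmoothOn₂.fam P.act_smooth hφ hψ hc),
    TM_dir G.tgt_subm.smooth hφ]
  exact congrArg (fun e : ℝ → X => dir e 0 1) (funext fun z => P.mom_act _ _ (hc z))

theorem Ta_pr {a : G.arr.TB} {b : P.tot.TB} (h : TM G.src a = TM P.mom b) :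
    TM P.pr (P.Ta a b) = TM P.pr b := by
  obtain ⟨φ, ψ, hφ, hψ, hc, rfl, rfl⟩ :=
    exists_pair' G.src_subm.smooth G.src_subm.submersion P.mom_smooth h
  rw [← PrincipalBundle.dir_act hφ hψ hc, TM_dir P.pr_subm.smooth (SmoothOn₂.fam P.act_smooth hφ hψ hc),
    TM_dir P.pr_subm.smooth hψ]
  exact congrArg (fun e : ℝ → M => dir e 0 1) (funext fun z => P.pr_act _ _ (hc z))

theorem Ta_mul {a b : G.arr.TB} {c : P.tot.TB} (h : TM G.src a = TM G.tgt b)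
    (h' : TM G.src b = TM P.mom c) : P.Ta (G.Tm a b) c = P.Ta a (P.Ta b c) := by
  obtain ⟨φ, ψ, χ, hφ, hψ, hχ, hc, hc', rfl, rfl, rfl⟩ :=
    exists_triple G.src_subm.smooth G.src_subm.submersion G.tgt_subm.smooth
      G.src_subm.smooth G.src_subm.submersion P.mom_smooth h h'
  rw [← LieGroupoid.dir_mul hφ hψ hc, ← PrincipalBundle.dir_act hψ hχ hc',
    ← PrincipalBundle.dir_act (SmoothOn₂.fam G.mul_smooth hφ hψ hc) hχ
      (fun z => (G.src_mul _ _ (hc z)).trans (hc' z)),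
    ← PrincipalBundle.dir_act hφ (SmoothOn₂.fam P.act_smooth hψ hχ hc')
      (fun z => (hc z).trans (P.mom_act _ _ (hc' z)).symm)]
  exact congrArg (fun e : ℝ → P.tot => dir e 0 1)
    (funext fun z => P.mul_act _ _ _ (hc z) (hc' z))

theorem Ta_one (b : P.tot.TB) : P.Ta (TM G.one (TM P.mom b)) b = b := by
  obtain ⟨φ, hφ, rfl⟩ := exists_curve b
  rw [TM_dir P.mom_smooth hφ, TM_dir G.one_smooth (hφ.comp P.mom_smooth),
    ← PrincipalBundle.dir_act ((hφ.comp P.mom_smooth).comp G.one_smooth) hφ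
      (fun z => G.src_one _)]
  exact congrArg (fun e : ℝ → P.tot => dir e 0 1) (funext fun z => P.one_act _)

theorem Tdiv_Ta {a : G.arr.TB} {b : P.tot.TB} (h : TM G.src a = TM P.mom b) :
    P.Tdiv (P.Ta a b) b = a := by
  obtain ⟨φ, ψ, hφ, hψ, hc, rfl, rfl⟩ :=
    exists_pair' G.src_subm.smooth G.src_subm.submersion P.mom_smooth h
  rw [← PrincipalBundle.dir_act hφ hψ hc,
    ← PrincipalBundle.dir_div (SmoothOn₂.fam P.act_smooth hφ hψ hc) hψ (fun z => P.pr_act _ _ (hc z))]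
  exact congrArg (fun e : ℝ → G.arr => dir e 0 1) (funext fun z => P.act_div _ _ (hc z))

theorem Tdiv_src {b c : P.tot.TB} (h : TM P.pr b = TM P.pr c) :
    TM G.src (P.Tdiv b c) = TM P.mom c := by
  obtain ⟨φ, ψ, hφ, hψ, hc, rfl, rfl⟩ :=
    exists_pair' P.pr_subm.smooth P.pr_subm.submersion P.pr_subm.smooth h
  rw [← PrincipalBundle.dir_div hφ hψ hc, TM_dir G.src_subm.smooth (SmoothOn₂.fam P.div_smooth hφ hψ hc),
    TM_dir P.mom_smooth hψ]
  exact congrArg (fun e : ℝ → X => dir e 0 1) (funext fun z => P.src_div _ _ (hc z))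

theorem Ta_Tdiv {b c : P.tot.TB} (h : TM P.pr b = TM P.pr c) : P.Ta (P.Tdiv b c) c = b := by
  obtain ⟨φ, ψ, hφ, hψ, hc, rfl, rfl⟩ :=
    exists_pair' P.pr_subm.smooth P.pr_subm.submersion P.pr_subm.smooth h
  rw [← PrincipalBundle.dir_div hφ hψ hc,
    ← PrincipalBundle.dir_act (SmoothOn₂.fam P.div_smooth hφ hψ hc) hψ (fun z => P.src_div _ _ (hc z))]
  exact congrArg (fun e : ℝ → P.tot => dir e 0 1) (funext fun z => P.div_act _ _ (hc z))

end PrincipalBundle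

namespace PfGroupoid

variable {X : Mfd.{u}} {G : PfGroupoid.{u, v} X}

theorem TM_proj_Tm (k : ℕ) {a b : (G.lev (k + 1)).arr.TB}
    (h : TM (G.lev (k + 1)).src a = TM (G.lev (k + 1)).tgt b) :
    TM (G.proj k) ((G.lev (k + 1)).Tm a b) = (G.lev k).Tm (TM (G.proj k) a) (TM (G.proj k) b) := by
  obtain ⟨φ, ψ, hφ, hψ, hc, rfl, rfl⟩ := exists_pair' (G.lev (k + 1)).src_subm.smooth
    (G.lev (k + 1)).src_subm.submersion (G.lev (k + 1)).tgt_subm.smooth h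
  have hp := (G.proj_subm k).smooth
  rw [← LieGroupoid.dir_mul hφ hψ hc,
    TM_dir hp (SmoothOn₂.fam (G.lev (k + 1)).mul_smooth hφ hψ hc), TM_dir hp hφ, TM_dir hp hψ,
    ← LieGroupoid.dir_mul (hφ.comp hp) (hψ.comp hp)
      (fun z => (G.src_proj k _).trans ((hc z).trans (G.tgt_proj k _).symm))]
  exact congrArg (fun e : ℝ → (G.lev k).arr => dir e 0 1) (funext fun z => G.proj_mul k _ _ (hc z))

end PfGroupoid

namespace PfPrincipalBundle

variable {X : Mfd.{u}} {G : PfGroupoid.{u, v} X} {M : Mfd.{w}}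
variable {P : PfPrincipalBundle.{u, v, w, z} G M}

theorem TM_proj_Ta (k : ℕ) {a : (G.lev (k + 1)).arr.TB} {b : (P.lev (k + 1)).tot.TB}
    (h : TM (G.lev (k + 1)).src a = TM (P.lev (k + 1)).mom b) :
    TM (P.proj k) ((P.lev (k + 1)).Ta a b) = (P.lev k).Ta (TM (G.proj k) a) (TM (P.proj k) b) := by
  obtain ⟨φ, ψ, hφ, hψ, hc, rfl, rfl⟩ := exists_pair' (G.lev (k + 1)).src_subm.smooth
    (G.lev (k + 1)).src_subm.submersion (P.lev (k + 1)).mom_smooth h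
  have hp := (P.proj_subm k).smooth
  have hg := (G.proj_subm k).smooth
  rw [← PrincipalBundle.dir_act hφ hψ hc,
    TM_dir hp (SmoothOn₂.fam (P.lev (k + 1)).act_smooth hφ hψ hc), TM_dir hg hφ, TM_dir hp hψ,
    ← PrincipalBundle.dir_act (hφ.comp hg) (hψ.comp hp)
      (fun z => (G.src_proj k _).trans ((hc z).trans (P.mom_proj k _).symm))]
  exact congrArg (fun e : ℝ → (P.lev k).tot => dir e 0 1) (funext fun z => P.proj_act k _ _ (hc z))

end PfPrincipalBundle

end

/-! ### Tangent vectors of the limit groupoid, and horizontal lifts for a Cartan groupoid. -/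

section

open Mfd

namespace Tower

variable {T : Tower.{u}}

theorem pt_ext {p q : T.Pt} (h : ∀ k, p.at k = q.at k) : p = q := Subtype.ext (funext h)

/-- Tangent spaces at points that are only provably equal are different types; comparison in the
total spaces of the levels avoids casts. -/
theorem mem_of_tb_eq {D : ∀ p : T.Pt, Submodule ℝ (Vec p)} {p q : T.Pt} {v : Vec p} {w : Vec q}
    (h : ∀ k, tb v k = tb w k) (hv : v ∈ D p) : w ∈ D q := by
  obtain rfl : p = q := pt_ext fun k => congrArg (fun u : (T.M k).TB => u.1) (h k)
  exact vec_ext h ▸ hv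

theorem tb_sub {p : T.Pt} (v w : Vec p) (k : ℕ) : tb (v - w) k = tsub (tb v k) (tb w k) := rfl

theorem tb_zero (p : T.Pt) (k : ℕ) : tb (0 : Vec p) k = zt (p.at k) := rfl

/-- Recognizing 1-forms at a finite level. -/
theorem isOneForm_of {m : ℕ} {η : (T.M m).TB → ℝ}
    (hs : ContMDiff (𝓡 (T.M m).dim).tangent 𝓘(ℝ, ℝ) ∞ η)
    (ha : ∀ (p : T.Pt) (v w : Vec p), v ∈ Tan p → w ∈ Tan p →
      η (tb (v + w) m) = η (tb v m) + η (tb w m))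
    (hm : ∀ (p : T.Pt) (c : ℝ) (v : Vec p), v ∈ Tan p → η (tb (c • v) m) = c * η (tb v m)) :
    IsOneForm η := by
  refine ⟨hs, fun x v w => ?_, fun x c v => ?_⟩
  · obtain ⟨p, rfl⟩ := T.exists_pt m x
    obtain ⟨v', hv, rfl⟩ := exists_tan p m v
    obtain ⟨w', hw, rfl⟩ := exists_tan p m w
    exact ha p v' w' hv hw
  · obtain ⟨p, rfl⟩ := T.exists_pt m x
    obtain ⟨v', hv, rfl⟩ := exists_tan p m v
    exact hm p c v' hv

end Tower

open Tower

namespace PfGroupoid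

variable {X : Mfd.{u}} {G : PfGroupoid.{u, v} X}

theorem TM_src {g : G.Arr} {v : Vec g} (hv : v ∈ Tan g) (k : ℕ) :
    TM (G.lev k).src (tb v k) = ⟨src g, dsrc g v⟩ := by
  induction k with
  | zero => rfl
  | succ k ih =>
    rw [← ih, ← mem_Tan_iff.mp hv k]
    refine Eq.trans ?_ (TM_comp (G.lev k).src_subm.smooth (G.proj_subm k).smooth _)
    rw [show (G.lev k).src ∘ G.toTower.proj k = (G.lev (k + 1)).src from funext (G.src_proj k)]

theorem TM_tgt {g : G.Arr} {v : Vec g} (hv : v ∈ Tan g) (k : ℕ) :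
    TM (G.lev k).tgt (tb v k) = ⟨tgt g, dtgt g v⟩ := by
  induction k with
  | zero => rfl
  | succ k ih =>
    rw [← ih, ← mem_Tan_iff.mp hv k]
    refine Eq.trans ?_ (TM_comp (G.lev k).tgt_subm.smooth (G.proj_subm k).smooth _)
    rw [show (G.lev k).tgt ∘ G.toTower.proj k = (G.lev (k + 1)).tgt from funext (G.tgt_proj k)]

theorem comp_at {g h : G.Arr} (c : src g = tgt h) {v : Vec g} {w : Vec h} (hv : v ∈ Tan g)
    (hw : w ∈ Tan h) (e : (dsrc g v : X.E) = dtgt h w) (k : ℕ) :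
    TM (G.lev k).src (tb v k) = TM (G.lev k).tgt (tb w k) := by
  rw [TM_src hv, TM_tgt hw]
  exact TB_ext c e

theorem tb_dmul {g h : G.Arr} (c : src g = tgt h) (v : Vec g) (w : Vec h) (k : ℕ) :
    tb (dmul g h c v w) k = (G.lev k).Tm (tb v k) (tb w k) := rfl

theorem dmul_mem_Tan {g h : G.Arr} (c : src g = tgt h) {v : Vec g} {w : Vec h} (hv : v ∈ Tan g)
    (hw : w ∈ Tan h) (e : (dsrc g v : X.E) = dtgt h w) : dmul g h c v w ∈ Tan (mul g h c) := by
  refine mem_Tan_iff.mpr fun k => ?_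
  rw [tb_dmul, tb_dmul, ← mem_Tan_iff.mp hv k, ← mem_Tan_iff.mp hw k]
  exact TM_proj_Tm k (comp_at c hv hw e (k + 1))

theorem tb_dinv (g : G.Arr) (v : Vec g) (k : ℕ) : tb (dinv g v) k = TM (G.lev k).inv (tb v k) := rfl

theorem dinv_mem_Tan {g : G.Arr} {v : Vec g} (hv : v ∈ Tan g) : dinv g v ∈ Tan (inv g) := by
  refine mem_Tan_iff.mpr fun k => ?_
  rw [tb_dinv, tb_dinv, ← mem_Tan_iff.mp hv k]
  refine (TM_comp (G.proj_subm k).smooth (G.lev (k + 1)).inv_smooth _).symm.trans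
    (Eq.trans ?_ (TM_comp (G.lev k).inv_smooth (G.proj_subm k).smooth _))
  rw [show G.proj k ∘ (G.lev (k + 1)).inv = (G.lev k).inv ∘ G.toTower.proj k from
    funext (G.proj_inv k)]

theorem dsrc_eq_iff {g : G.Arr} {v : Vec g} (k : ℕ) (hv : v ∈ Tan g) (x : X.T (src g)) :
    dsrc g v = x ↔ TM (G.lev k).src (tb v k) = ⟨src g, x⟩ := by
  rw [TM_src hv k]
  exact ⟨fun h => by rw [h], fun h => snd_eq_of_TB_eq h⟩

theorem dsrc_dinv {g : G.Arr} {v : Vec g} (hv : v ∈ Tan g) :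
    (dsrc (inv g) (dinv g v) : X.E) = dtgt g v := by
  have h := TM_src (dinv_mem_Tan hv) 0
  rw [tb_dinv, LieGroupoid.TM_src_inv, TM_tgt hv] at h
  exact (snd_eq_of_TB_eq h).symm

theorem dtgt_dinv {g : G.Arr} {v : Vec g} (hv : v ∈ Tan g) :
    (dtgt (inv g) (dinv g v) : X.E) = dsrc g v := by
  have h := TM_tgt (dinv_mem_Tan hv) 0
  rw [tb_dinv, LieGroupoid.TM_tgt_inv, TM_src hv] at h
  exact (snd_eq_of_TB_eq h).symm

theorem tb_dinv_dinv (g : G.Arr) (v : Vec g) (k : ℕ) : tb (dinv (inv g) (dinv g v)) k = tb v k :=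
  LieGroupoid.TM_inv_inv (G := G.lev k) (tb v k)

theorem tb_done (x : X) (y : X.T x) (k : ℕ) : tb (done G x y) k = TM (G.lev k).one ⟨x, y⟩ := rfl

theorem done_mem_Tan (x : X) (y : X.T x) : done G x y ∈ Tan (one G x) := by
  refine mem_Tan_iff.mpr fun k => ?_
  rw [tb_done, tb_done]
  refine (TM_comp (G.proj_subm k).smooth (G.lev (k + 1)).one_smooth _).symm.trans ?_
  rw [show G.proj k ∘ (G.lev (k + 1)).one = (G.lev k).one from funext (G.proj_one k)]

theorem src_one (x : X) : src (one G x) = x := (G.lev 0).src_one x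

theorem tgt_one (x : X) : tgt (one G x) = x := (G.lev 0).tgt_one x

theorem dsrc_done (x : X) (y : X.T x) : (dsrc (one G x) (done G x y) : X.E) = y := by
  have h := TM_src (done_mem_Tan (G := G) x y) 0
  rw [tb_done, LieGroupoid.TM_src_one] at h
  exact (snd_eq_of_TB_eq h).symm

theorem dtgt_done (x : X) (y : X.T x) : (dtgt (one G x) (done G x y) : X.E) = y := by
  have h := TM_tgt (done_mem_Tan (G := G) x y) 0
  rw [tb_done, LieGroupoid.TM_tgt_one] at h
  exact (snd_eq_of_TB_eq h).symm

theorem mem_A_iff {x : X} {a : Vec (one G x)} (k : ℕ) :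
    a ∈ G.A x ↔ a ∈ Tan (one G x) ∧ TM (G.lev k).src (tb a k) = zt x := by
  refine and_congr_right fun ha => ?_
  refine (dsrc_eq_iff k ha 0).trans ?_
  exact ⟨fun h => h.trans (TB_ext (src_one x) rfl), fun h => h.trans (TB_ext (src_one x).symm rfl)⟩

variable {C : ∀ g : G.Arr, Submodule ℝ (Vec g)}

theorem IsCartan.le_Tan (hC : IsCartan C) (g : G.Arr) : C g ≤ Tan g :=
  (hC.ehresmann.1 g).2 ▸ le_sup_left

/-- Inversion preserves `C` and exchanges source and target, so transversality of `C` to ker(dt)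
carries over to ker(ds). -/
theorem IsCartan.eq_zero (hC : IsCartan C) {g : G.Arr} {v : Vec g} (hv : v ∈ C g)
    (h : dsrc g v = 0) : v = 0 := by
  have h1 := hC.dinv_mem g v hv
  have hvT := hC.le_Tan g hv
  have h2 : dinv g v ∈ tgtVert (inv g) :=
    ⟨dinv_mem_Tan hvT, (dtgt_dinv hvT).trans h⟩
  have h3 : dinv g v ∈ C (inv g) ⊓ tgtVert (inv g) := ⟨h1, h2⟩
  rw [(hC.ehresmann.1 _).1, Submodule.mem_bot] at h3
  refine vec_ext fun k => ?_
  rw [← tb_dinv_dinv, tb_dinv, h3, tb_zero, TM_zt, tb_zero]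
  exact congrArg zt ((G.lev k).inv_inv _)

theorem IsCartan.eq_of_dsrc_eq (hC : IsCartan C) {g : G.Arr} {v w : Vec g} (hv : v ∈ C g)
    (hw : w ∈ C g) (h : dsrc g v = dsrc g w) : v = w :=
  sub_eq_zero.mp (hC.eq_zero (sub_mem hv hw) (by rw [map_sub, h, sub_self]))

/-- The horizontal lift of a tangent vector. -/
def horAt (C : ∀ g : G.Arr, Submodule ℝ (Vec g)) (g : G.Arr) (x : X.T (src g)) : Vec g :=
  Classical.epsilon fun v => v ∈ C g ∧ dsrc g v = x

theorem hor_eq (V : ∀ x, X.T x) (g : G.Arr) : hor C V g = horAt C g (V (src g)) := rfl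

theorem IsCartan.horAt_mem (hC : IsCartan C) (g : G.Arr) (x : X.T (src g)) : horAt C g x ∈ C g :=
  (Classical.epsilon_spec (p := fun v => v ∈ C g ∧ dsrc g v = x) (hC.dsrc_surj g x)).1

theorem IsCartan.dsrc_horAt (hC : IsCartan C) (g : G.Arr) (x : X.T (src g)) :
    dsrc g (horAt C g x) = x :=
  (Classical.epsilon_spec (p := fun v => v ∈ C g ∧ dsrc g v = x) (hC.dsrc_surj g x)).2

theorem IsCartan.horAt_mem_Tan (hC : IsCartan C) (g : G.Arr) (x : X.T (src g)) :
    horAt C g x ∈ Tan g := hC.le_Tan g (hC.horAt_mem g x)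

theorem IsCartan.horAt_eq (hC : IsCartan C) {g : G.Arr} {v : Vec g} (hv : v ∈ C g) :
    horAt C g (dsrc g v) = v :=
  hC.eq_of_dsrc_eq (hC.horAt_mem g _) hv (hC.dsrc_horAt g _)

theorem IsCartan.horAt_add (hC : IsCartan C) (g : G.Arr) (x y : X.T (src g)) :
    horAt C g (x + y) = horAt C g x + horAt C g y :=
  hC.eq_of_dsrc_eq (hC.horAt_mem g _) (add_mem (hC.horAt_mem g x) (hC.horAt_mem g y))
    (by rw [map_add, hC.dsrc_horAt, hC.dsrc_horAt, hC.dsrc_horAt])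

theorem IsCartan.horAt_smul (hC : IsCartan C) (g : G.Arr) (c : ℝ) (x : X.T (src g)) :
    horAt C g (c • x) = c • horAt C g x :=
  hC.eq_of_dsrc_eq (hC.horAt_mem g _) (Submodule.smul_mem _ c (hC.horAt_mem g x))
    (by rw [map_smul, hC.dsrc_horAt, hC.dsrc_horAt])

theorem IsCartan.horAt_zero (hC : IsCartan C) (g : G.Arr) : horAt C g 0 = 0 :=
  hC.eq_zero (hC.horAt_mem g 0) (hC.dsrc_horAt g 0)

/-- The `C`-component along `Ker(ds)` is smooth. -/
theorem IsCartan.exists_horAt_smooth (hC : IsCartan C) (k : ℕ) :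
    ∃ m, ∀ n ≥ m, ∃ Q : (G.lev n).arr.TB → (G.lev k).arr.TB,
      ContMDiff (𝓡 (G.lev n).arr.dim).tangent (𝓡 (G.lev k).arr.dim).tangent ∞ Q ∧
      ∀ (g : G.Arr) (v : Vec g), v ∈ Tan g → Q (tb v n) = tb (horAt C g (dsrc g v)) k := by
  obtain ⟨m, F, hF, h⟩ := hC.ehresmann.2 k
  -- The projection onto `C` along ker(dt), conjugated by the inversion, is the projection onto `C`
  -- along ker(ds).
  refine ⟨m, fun n hn => ⟨TM (G.lev k).inv ∘ F ∘ TM (G.lev m).inv ∘ TM (G.toTower.pr hn),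
    ((G.lev k).inv_smooth.TM).comp (hF.comp (((G.lev m).inv_smooth.TM).comp
      (G.toTower.smooth_pr hn).TM)), fun g v hv => ?_⟩⟩
  have hd := dinv_mem_Tan hv
  rw [← (hC.ehresmann.1 (inv g)).2] at hd
  obtain ⟨c, hc, e, he, hce⟩ := Submodule.mem_sup.mp hd
  have hcT := hC.le_Tan _ hc
  simp only [Function.comp_apply]
  rw [G.toTower.TM_pr hn hv, ← tb_dinv, ← hce]
  have h1 : F (tb (c + e) m) = tb c k := h _ c hc e he
  rw [h1, ← tb_dinv]
  have h2 : ∀ k, tb (dinv (inv g) c) k = tb (horAt C g (dsrc g v)) k := by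
    have hg : inv (inv g) = g := pt_ext fun k => (G.lev k).inv_inv _
    have key : ∀ (g' : G.Arr) (c' : Vec g'), g' = g → c' ∈ C g' → (dsrc g' c' : X.E) = dsrc g v →
        ∀ k, tb c' k = tb (horAt C g (dsrc g v)) k := by
      rintro g' c' rfl hc' he k
      have h3 : horAt C g' (dsrc g' c') = c' := hC.horAt_eq hc'
      rw [← h3]
      exact congrArg (fun x => tb (horAt C g' x) k) he
    refine key _ _ hg (hC.dinv_mem _ c hc) ?_
    rw [dsrc_dinv hcT, ← dtgt_dinv hv, ← hce, map_add, show dtgt (inv g) e = 0 from he.2, add_zero]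
  exact h2 k

end PfGroupoid

end

/-! ### Sections of the Lie algebroid, horizontal and right-invariant vector fields. -/

section

open Mfd Tower

namespace Mfd

variable {M : Mfd.{u}} {N : Mfd.{v}} {L : Mfd.{w}}

/-- Smooth lifts of vector fields along maps. -/
theorem exists_lift' {h : L → M} (hh : Smooth h) {f : M → N} (hf : IsSurjSubmersion f)
    {w : L → N.TB} (hw : ContMDiff (𝓡 L.dim) (𝓡 N.dim).tangent ∞ w) (hwf : ∀ l, (w l).1 = f (h l)) :
    ∃ w' : ∀ l, M.T (h l),
      ContMDiff (𝓡 L.dim) (𝓡 M.dim).tangent ∞ (fun l => (⟨h l, w' l⟩ : M.TB)) ∧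
      ∀ l, TM f ⟨h l, w' l⟩ = w l := by
  rcases isEmpty_or_nonempty L with hL | ⟨⟨l₀⟩⟩
  · exact ⟨fun l => 0, fun l => hL.elim l, fun l => hL.elim l⟩
  · obtain ⟨v₀, hv₀⟩ := hf.submersion (h l₀) ((w l₀).2 : N.E)
    obtain ⟨w', h1, h2, -⟩ := exists_lift hh hf hw hwf l₀ v₀ (TB_ext (hwf l₀).symm hv₀)
    exact ⟨w', h1, h2⟩

end Mfd

namespace Tower

variable {T : Tower.{u}} {L : Mfd.{v}}

theorem pr_comp {k n : ℕ} (h : k + 1 ≤ n) : T.proj k ∘ T.pr h = T.pr (Nat.le_of_succ_le h) :=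
  funext fun y => by
    obtain ⟨p, rfl⟩ := T.exists_pt n y
    rw [Function.comp_apply, T.pr_at, T.pr_at, p.2 k]

theorem pr_self (n : ℕ) : T.pr (le_refl n) = id :=
  funext fun y => by
    obtain ⟨p, rfl⟩ := T.exists_pt n y
    exact T.pr_at _ p

/-- Extension of a vector field along a map `o` which is given at one level and at one point. -/
theorem exists_section_along {o : L → T.Pt} (ho : ∀ k, Smooth fun l => (o l).at k) (n : ℕ)
    (σ : ∀ l, (T.M n).T ((o l).at n))
    (hσ : ContMDiff (𝓡 L.dim) (𝓡 (T.M n).dim).tangent ∞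
      fun l => (⟨(o l).at n, σ l⟩ : (T.M n).TB))
    (l₀ : L) {v : Vec (o l₀)} (hv : v ∈ Tan (o l₀)) (hvn : v n = σ l₀) :
    ∃ W : ∀ l, Vec (o l), (∀ l, W l ∈ Tan (o l)) ∧
      (∀ k, ContMDiff (𝓡 L.dim) (𝓡 (T.M k).dim).tangent ∞
        fun l => (⟨(o l).at k, W l k⟩ : (T.M k).TB)) ∧
      (∀ l, W l n = σ l) ∧ W l₀ = v := by
  -- Up to level `n` the field is forced to be the projection of `σ`; above it, it is lifted freely,
  -- subject to the value `v` at `l₀`.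
  let S : ℕ → Type _ := fun k => {V : ∀ l, (T.M k).T ((o l).at k) //
    ContMDiff (𝓡 L.dim) (𝓡 (T.M k).dim).tangent ∞ (fun l => (⟨(o l).at k, V l⟩ : (T.M k).TB)) ∧
    V l₀ = v k ∧ ∀ (h : k ≤ n) l, (⟨(o l).at k, V l⟩ : (T.M k).TB) = TM (T.pr h) ⟨(o l).at n, σ l⟩}
  have hdown : ∀ (k : ℕ), k ≤ n → ∃ V : S k, True := by
    intro k h
    refine ⟨⟨fun l => (TM (T.pr h) ⟨(o l).at n, σ l⟩).2, ?_, ?_, fun h l => ?_⟩, trivial⟩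
    · exact ((T.smooth_pr h).TM.comp hσ).congr fun l => TB_ext (T.pr_at h (o l)).symm rfl
    · have h1 := T.TM_pr h hv
      rw [tb, hvn] at h1
      exact snd_eq_of_TB_eq h1
    · exact TB_ext (T.pr_at h (o l)).symm rfl
  have hstep : ∀ (k : ℕ) (V : S k), ∃ W : S (k + 1), ∀ l,
      TM (T.proj k) ⟨(o l).at (k + 1), W.1 l⟩ = ⟨(o l).at k, V.1 l⟩ := by
    intro k V
    by_cases hk : k + 1 ≤ n
    · obtain ⟨W, -⟩ := hdown (k + 1) hk
      refine ⟨W, fun l => ?_⟩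
      rw [W.2.2.2 hk, V.2.2.2 (Nat.le_of_succ_le hk), ← pr_comp hk,
        TM_comp (T.proj_subm k).smooth (T.smooth_pr hk)]
    · obtain ⟨W, hW, h1, h2⟩ := Mfd.exists_lift (ho (k + 1)) (T.proj_subm k)
        (w := fun l => ⟨(o l).at k, V.1 l⟩) V.2.1 (fun l => ((o l).2 k).symm) l₀ (v (k + 1))
        ((mem_Tan_iff.mp hv k).trans (TB_ext rfl V.2.2.1.symm))
      exact ⟨⟨W, hW, h2, fun h => absurd h hk⟩, h1⟩
  choose next hnext using hstep
  let s : ∀ k, S k := fun k => Nat.rec (hdown 0 (Nat.zero_le n)).choose next k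
  refine ⟨fun l k => (s k).1 l, fun l => mem_Tan_iff.mpr fun k => hnext k (s k) l,
    fun k => (s k).2.1, fun l => ?_, funext fun k => (s k).2.2.1⟩
  have h1 := (s n).2.2.2 (le_refl n) l
  rw [pr_self, TM_id] at h1
  exact snd_eq_of_TB_eq h1

end Tower

namespace PfGroupoid

variable {X : Mfd.{u}} {G : PfGroupoid.{u, v} X} {C : ∀ g : G.Arr, Submodule ℝ (Vec g)}

theorem smooth_one_at (k : ℕ) : Smooth fun x : X => (one G x).at k := (G.lev k).one_smooth

/-- Extension of a section of `A` which is given at one level and at one point. -/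
theorem exists_section_of (n : ℕ) (σ : ∀ x, (G.lev n).arr.T ((G.lev n).one x))
    (hσ : ContMDiff (𝓡 X.dim) (𝓡 (G.lev n).arr.dim).tangent ∞
      fun x => (⟨(G.lev n).one x, σ x⟩ : (G.lev n).arr.TB))
    (hs : ∀ x, TM (G.lev n).src ⟨(G.lev n).one x, σ x⟩ = zt x) (x₀ : X) (a : G.A x₀)
    (ha : a.1 n = σ x₀) :
    ∃ α : ∀ x, G.A x, IsSection α ∧ (∀ x, (α x).1 n = σ x) ∧ α x₀ = a := by
  obtain ⟨W, h1, h2, h3, h4⟩ := exists_section_along (T := G.toTower) (o := one G)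
    smooth_one_at n σ hσ x₀ a.2.1 ha
  refine ⟨fun x => ⟨W x, (mem_A_iff n).mpr ⟨h1 x, ?_⟩⟩, h2, h3, Subtype.ext h4⟩
  refine Eq.trans ?_ (hs x)
  exact congrArg (TM (G.lev n).src) (TB_ext rfl (h3 x))

/-- The projection of tangent vectors at units to `Ker(ds)`. -/
def srcVert (H : LieGroupoid.{u, v} X) (a : H.arr.TB) : H.arr.TB := tsub a (TM H.one (TM H.src a))

theorem TM_src_srcVert {H : LieGroupoid.{u, v} X} {a : H.arr.TB} {x : X} (h : a.1 = H.one x) :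
    TM H.src (srcVert H a) = zt x := by
  obtain ⟨y, a⟩ := a
  obtain rfl : y = H.one x := h
  have h1 : (TM H.one (TM H.src (⟨H.one x, a⟩ : H.arr.TB))).1 = H.one x := congrArg H.one (H.src_one x)
  rw [srcVert, TM_tsub _ h1.symm, LieGroupoid.TM_src_one, tsub_self]
  exact congrArg zt (H.src_one x)

theorem contMDiff_srcVert {EK : Type*} [NormedAddCommGroup EK] [NormedSpace ℝ EK] {HK : Type*}
    [TopologicalSpace HK] {I : ModelWithCorners ℝ EK HK} {K : Type*} [TopologicalSpace K]
    [ChartedSpace HK K] {H : LieGroupoid.{u, v} X} {a : K → H.arr.TB}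
    (ha : ContMDiff I (𝓡 H.arr.dim).tangent ∞ a) {x : K → X} (h : ∀ k, (a k).1 = H.one (x k)) :
    ContMDiff I (𝓡 H.arr.dim).tangent ∞ fun k => srcVert H (a k) :=
  contMDiff_tsub ha (H.one_smooth.TM.comp (H.src_subm.smooth.TM.comp ha)) fun k => by
    change _ = H.one (H.src (a k).1)
    rw [h, H.src_one]

theorem srcVert_eq {H : LieGroupoid.{u, v} X} {a : H.arr.TB} {x : X} (h : TM H.src a = zt x) :
    srcVert H a = a := by
  rw [srcVert, h, TM_zt]
  exact TB_ext rfl (sub_zero (a.2 : H.arr.E))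

/-- Elements of `A` extend to sections; the extension vanishes at level `n` if the element does. -/
theorem exists_section (n : ℕ) {x₀ : X} (a : G.A x₀) :
    ∃ α : ∀ x, G.A x, IsSection α ∧ α x₀ = a ∧ (a.1 n = 0 → ∀ x, (α x).1 n = 0) := by
  by_cases ha : a.1 n = 0
  · obtain ⟨α, h1, h2, h3⟩ := exists_section_of n (fun x => 0) (contMDiff_zt (G.lev n).one_smooth)
      (fun x => (TM_zt _ _).trans (congrArg zt ((G.lev n).src_one x))) x₀ a ha
    exact ⟨α, h1, h3, fun _ => h2⟩
  · obtain ⟨V, hV, hVa⟩ := Mfd.exists_vectorField ((G.lev n).one x₀) (a.1 n)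
    have hV1 : ContMDiff (𝓡 X.dim) (𝓡 (G.lev n).arr.dim).tangent ∞
        fun x => (⟨(G.lev n).one x, V ((G.lev n).one x)⟩ : (G.lev n).arr.TB) :=
      ContMDiff.comp hV (G.lev n).one_smooth
    obtain ⟨α, h1, h2, h3⟩ := exists_section_of n
      (fun x => (srcVert (G.lev n) ⟨(G.lev n).one x, V ((G.lev n).one x)⟩).2)
      (contMDiff_srcVert hV1 (x := id) fun _ => rfl)
      (fun x => TM_src_srcVert (H := G.lev n)
        (a := ⟨(G.lev n).one x, V ((G.lev n).one x)⟩) rfl) x₀ a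
      (snd_eq_of_TB_eq (u := tb a.1 n) (by
        rw [hVa]
        exact (srcVert_eq ((mem_A_iff n).mp a.2).2).symm))
    exact ⟨α, h1, h3, fun h => absurd h ha⟩

/-- An arbitrary smooth lift of `V` to TG is projected to `C` along ker(ds); the outcome depends
only on the image of the lift under ds. -/
theorem IsCartan.hor_isVectorField (hC : IsCartan C) {V : ∀ x, X.T x} (hV : Mfd.IsVectorField V) :
    Tower.IsVectorField (hor C V) := by
  refine ⟨fun g => hC.horAt_mem_Tan g _, fun k => ?_⟩
  obtain ⟨m, hm⟩ := hC.exists_horAt_smooth k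
  obtain ⟨Q, hQ, h⟩ := hm m le_rfl
  obtain ⟨w, hw, hw1⟩ := exists_lift' (h := id) contMDiff_id (G.lev m).src_subm
    (w := fun g => ⟨(G.lev m).src g, V ((G.lev m).src g)⟩)
    (ContMDiff.comp hV (G.lev m).src_subm.smooth) (fun _ => rfl)
  refine ⟨m, _, hQ.comp hw, fun g => ?_⟩
  obtain ⟨v, hv, hvm⟩ := exists_tan g m (w (g.at m))
  have h1 : dsrc g v = V (src g) := by
    rw [dsrc_eq_iff m hv, tb, hvm]
    exact (hw1 (g.at m)).trans (congrArg (fun x => (⟨x, V x⟩ : X.TB)) (src_at g m))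
  have h2 := h g v hv
  rw [tb, hvm, h1] at h2
  exact h2

theorem tb_rightInv (α : ∀ x, G.A x) (g : G.Arr) (k : ℕ) :
    tb (rightInv α g) k = (G.lev k).Tm (tb (α (tgt g)).1 k) (zt (g.at k)) := by
  refine TB_ext ?_ rfl
  have h := (G.lev k).one_mul (g.at k)
  rw [tgt_at] at h
  exact h.symm

theorem comp_A_zt {x : X} (a : G.A x) {k : ℕ} {y : (G.lev k).arr} (h : (G.lev k).tgt y = x) :
    TM (G.lev k).src (tb a.1 k) = TM (G.lev k).tgt (zt y) := by
  rw [((mem_A_iff k).mp a.2).2, TM_zt, h]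

theorem rightInv_mem_Tan (α : ∀ x, G.A x) (g : G.Arr) : rightInv α g ∈ Tan g := by
  refine mem_Tan_iff.mpr fun k => ?_
  rw [tb_rightInv, tb_rightInv]
  refine (TM_proj_Tm k (comp_A_zt _ (tgt_at g _))).trans ?_
  rw [TM_zt]
  exact congrArg₂ (G.lev k).Tm (mem_Tan_iff.mp (α (tgt g)).2.1 k) (congrArg zt (g.2 k))

theorem dsrc_rightInv (α : ∀ x, G.A x) (g : G.Arr) : dsrc g (rightInv α g) = 0 := by
  rw [dsrc_eq_iff 0 (rightInv_mem_Tan α g), tb_rightInv,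
    LieGroupoid.Tm_src (comp_A_zt _ (tgt_at g _)), TM_zt]
  rfl

theorem tb_rightInv_one (α : ∀ x, G.A x) (x : X) (k : ℕ) :
    tb (rightInv α (one G x)) k = tb (α x).1 k := by
  rw [tb_rightInv, tgt_one]
  have h := LieGroupoid.Tm_one_right (G := G.lev k) (tb (α x).1 k)
  rw [((mem_A_iff k).mp (α x).2).2, TM_zt] at h
  exact h

theorem rightInv_one (α : ∀ x, G.A x) (x : X) : rightInv α (one G x) = (α x).1 :=
  vec_ext fun k => tb_rightInv_one α x k

theorem rightInv_isVectorField {α : ∀ x, G.A x} (hα : IsSection α) :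
    Tower.IsVectorField (rightInv α) := by
  refine ⟨rightInv_mem_Tan α, fun k => ⟨k, fun y => (G.lev k).Tm (tb (α ((G.lev k).tgt y)).1 k) (zt y),
    LieGroupoid.contMDiff_Tm ((hα k).comp (G.lev k).tgt_subm.smooth) (contMDiff_zt contMDiff_id)
      fun y => comp_A_zt _ rfl, fun g => ?_⟩⟩
  refine Eq.trans ?_ (tb_rightInv α g k).symm
  exact congrArg (fun x => (G.lev k).Tm (tb (α x).1 k) (zt (g.at k))) (tgt_at g k)

theorem anchor_isVectorField {α : ∀ x, G.A x} (hα : IsSection α) : Mfd.IsVectorField (anchor α) :=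
  (((G.lev 0).tgt_subm.smooth.TM).comp (hα 0)).congr fun x => TB_ext ((G.lev 0).tgt_one x).symm rfl

end PfGroupoid

end

/-! ### Connection forms, and the connection and brackets at the units. -/

section

open Mfd Tower

namespace LieGroupoid

variable {X : Mfd.{u}} {G : LieGroupoid.{u, v} X}

theorem inv_one (x : X) : G.inv (G.one x) = G.one x := by
  have h1 := G.one_mul (G.inv (G.one x))
  rw [G.tgt_inv, G.src_one] at h1
  have h2 := G.mul_inv (G.one x)
  rw [G.tgt_one] at h2
  exact h1.symm.trans h2

theorem dmul_add_left (g h : G.arr) (a b : G.arr.T g) :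
    G.dmul g h (a + b) 0 = G.dmul g h a 0 + G.dmul g h b 0 := by
  have h1 := d₂_add G.mul {q | G.src q.1 = G.tgt q.2} a b (0 : G.arr.T h) 0
  rw [add_zero] at h1
  exact h1

theorem dmul_smul_left (g h : G.arr) (c : ℝ) (a : G.arr.T g) :
    G.dmul g h (c • a) 0 = c • G.dmul g h a 0 := by
  have h1 := d₂_smul G.mul {q | G.src q.1 = G.tgt q.2} c a (0 : G.arr.T h)
  rw [smul_zero] at h1
  exact h1

end LieGroupoid

namespace Mfd

variable {N : Mfd.{v}}

theorem extd_smul_right (η : N.TB → ℝ) (y : N) (c : ℝ) (v w : N.T y) :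
    extd η y v (c • w) = c * extd η y v w := by
  simp only [extd, D_smul_vec, Finset.mul_sum]
  exact Finset.sum_congr rfl fun i _ => by ring

theorem extd_smul_left (η : N.TB → ℝ) (y : N) (c : ℝ) (v w : N.T y) :
    extd η y (c • v) w = c * extd η y v w := by
  rw [extd_antisymm, extd_smul_right, extd_antisymm η y w v]
  ring

theorem extd_zero_left (η : N.TB → ℝ) (y : N) (w : N.T y) : extd η y 0 w = 0 := by
  have h := extd_add_left η y 0 0 w
  rw [add_zero] at h
  linarith

theorem extd_zero_right (η : N.TB → ℝ) (y : N) (v : N.T y) : extd η y v 0 = 0 := by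
  rw [extd_antisymm, extd_zero_left, neg_zero]

end Mfd

namespace PfGroupoid

variable {X : Mfd.{u}} {G : PfGroupoid.{u, v} X} {C : ∀ g : G.Arr, Submodule ℝ (Vec g)}

/-- The right translation of an `s`-vertical vector to the unit. -/
def rt (g : G.Arr) (v : Vec g) : Vec (one G (tgt g)) :=
  fun k => (((G.lev k).Tm (tb v k) (zt ((G.lev k).inv (g.at k)))).2 : (G.lev k).arr.E)

theorem tb_rt (g : G.Arr) (v : Vec g) (k : ℕ) :
    tb (rt g v) k = (G.lev k).Tm (tb v k) (zt ((G.lev k).inv (g.at k))) :=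
  TB_ext (((G.lev k).mul_inv (g.at k)).trans (congrArg (G.lev k).one (tgt_at g k))).symm rfl

theorem rt_add (g : G.Arr) (v w : Vec g) : rt g (v + w) = rt g v + rt g w :=
  funext fun k => LieGroupoid.dmul_add_left _ _ (v k) (w k)

theorem rt_smul (g : G.Arr) (c : ℝ) (v : Vec g) : rt g (c • v) = c • rt g v :=
  funext fun k => LieGroupoid.dmul_smul_left _ _ c (v k)

theorem TM_src_vert {g : G.Arr} {v : Vec g} (hv : v ∈ Tan g) (h : dsrc g v = 0) (k : ℕ) :
    TM (G.lev k).src (tb v k) = zt (src g) := by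
  rw [TM_src hv, h]
  rfl

theorem comp_inv {g : G.Arr} {v : Vec g} (hv : v ∈ Tan g) (h : dsrc g v = 0) (k : ℕ) :
    TM (G.lev k).src (tb v k) = TM (G.lev k).tgt (zt ((G.lev k).inv (g.at k))) := by
  rw [TM_src_vert hv h, TM_zt, (G.lev k).tgt_inv, src_at]

theorem rt_mem_A {g : G.Arr} {v : Vec g} (hv : v ∈ Tan g) (h : dsrc g v = 0) :
    rt g v ∈ G.A (tgt g) := by
  refine (mem_A_iff 0).mpr ⟨mem_Tan_iff.mpr fun k => ?_, ?_⟩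
  · rw [tb_rt, tb_rt]
    refine (TM_proj_Tm k (comp_inv hv h _)).trans ?_
    rw [TM_zt, G.proj_inv]
    exact congrArg₂ (G.lev k).Tm (mem_Tan_iff.mp hv k)
      (congrArg (fun y => zt ((G.lev k).inv y)) (g.2 k))
  · rw [tb_rt, LieGroupoid.Tm_src (comp_inv hv h 0), TM_zt, (G.lev 0).src_inv]
    rfl

/-- An `s`-vertical vector is the right translation of its translation to the unit. -/
theorem Tm_rt {g : G.Arr} {v : Vec g} (hv : v ∈ Tan g) (h : dsrc g v = 0) (k : ℕ) :
    (G.lev k).Tm (tb (rt g v) k) (zt (g.at k)) = tb v k := by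
  rw [tb_rt, LieGroupoid.Tm_assoc (comp_inv hv h k) (by rw [TM_zt, TM_zt, (G.lev k).src_inv]),
    LieGroupoid.Tm_zt, (G.lev k).inv_mul]
  have h1 := LieGroupoid.Tm_one_right (G := G.lev k) (tb v k)
  rw [TM_src_vert hv h, TM_zt, ← src_at g k] at h1
  exact h1

theorem rt_Tm {x : X} (a : G.A x) {g : G.Arr} (hx : tgt g = x) {v : Vec g}
    (h : ∀ k, (G.lev k).Tm (tb a.1 k) (zt (g.at k)) = tb v k) (k : ℕ) :
    tb (rt g v) k = tb a.1 k := by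
  subst hx
  rw [tb_rt, ← h, LieGroupoid.Tm_assoc (comp_A_zt a (tgt_at g k))
    (by rw [TM_zt, TM_zt, (G.lev k).tgt_inv]), LieGroupoid.Tm_zt, (G.lev k).mul_inv]
  have h1 := LieGroupoid.Tm_one_right (G := G.lev k) (tb a.1 k)
  rw [((mem_A_iff k).mp a.2).2, TM_zt] at h1
  exact (congrArg (fun x => (G.lev k).Tm (tb a.1 k) (zt ((G.lev k).one x))) (tgt_at g k)).trans h1

theorem rt_rightInv (α : ∀ x, G.A x) (g : G.Arr) : rt g (rightInv α g) = (α (tgt g)).1 :=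
  vec_ext (rt_Tm _ rfl fun k => (tb_rightInv α g k).symm)

theorem tb_rt_one {x : X} {v : Vec (one G x)} (hv : v ∈ Tan (one G x)) (h : dsrc _ v = 0) (k : ℕ) :
    tb (rt (one G x) v) k = tb v k := by
  have h1 := LieGroupoid.Tm_one_right (G := G.lev k) (tb v k)
  rw [TM_src_vert hv h, TM_zt, src_one] at h1
  rw [tb_rt]
  exact (congrArg (fun y => (G.lev k).Tm (tb v k) (zt y)) (LieGroupoid.inv_one x)).trans h1

/-- The 1-form `dF ∘ (connection form of C)`, at level `n`. -/
structure IsConnForm (C : ∀ g : G.Arr, Submodule ℝ (Vec g)) {k : ℕ} (F : (G.lev k).arr → ℝ) (n : ℕ)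
    (ζ : (G.lev n).arr.TB → ℝ) : Prop where
  form : IsOneForm ζ
  eq : ∀ (g : G.Arr) (v : Vec g), v ∈ Tan g →
    ζ (tb v n) = D F (tb (rt g (v - horAt C g (dsrc g v))) k)

theorem IsCartan.exists_connForm (hC : IsCartan C) (k : ℕ) :
    ∃ m, ∀ n ≥ m, ∀ F : (G.lev k).arr → ℝ, SmoothFn F → ∃ ζ, IsConnForm C F n ζ := by
  obtain ⟨m, hm⟩ := hC.exists_horAt_smooth k
  refine ⟨max m k, fun n hn F hF => ?_⟩
  obtain ⟨Q, hQ, h⟩ := hm n (le_trans (le_max_left _ _) hn)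
  have hk : k ≤ n := le_trans (le_max_right _ _) hn
  let p : (G.lev n).arr → (G.lev k).arr := G.toTower.pr hk
  have hp : Smooth p := G.toTower.smooth_pr hk
  -- The part of `b` in ker(ds) along `C`, right-translated to the unit by the inverse arrow, and
  -- paired with dF.
  let ζ : (G.lev n).arr.TB → ℝ := fun b =>
    D F ((G.lev k).Tm (tsub (TM p b) (Q b)) (zt ((G.lev k).inv (p b.1))))
  have hlift : ∀ (g : G.Arr) (v : Vec g), v ∈ Tan g →
      tsub (TM p (tb v n)) (Q (tb v n)) = tb (v - horAt C g (dsrc g v)) k := by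
    intro g v hv
    rw [h g v hv, tb_sub]
    exact congrArg (fun a => tsub a _) (G.toTower.TM_pr hk hv)
  have hζ : ∀ (g : G.Arr) (v : Vec g), v ∈ Tan g →
      ζ (tb v n) = D F (tb (rt g (v - horAt C g (dsrc g v))) k) := by
    intro g v hv
    change D F ((G.lev k).Tm (tsub (TM p (tb v n)) (Q (tb v n))) (zt ((G.lev k).inv (p (g.at n))))) = _
    rw [hlift g v hv, tb_rt]
    exact congrArg (fun y => D F ((G.lev k).Tm _ (zt ((G.lev k).inv y)))) (G.toTower.pr_at hk g)
  have hsub : ∀ {g : G.Arr} {v : Vec g}, v ∈ Tan g → v - horAt C g (dsrc g v) ∈ Tan g ∧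
      dsrc g (v - horAt C g (dsrc g v)) = 0 := fun {g v} hv =>
    ⟨sub_mem hv (hC.horAt_mem_Tan g _), by rw [map_sub, hC.dsrc_horAt, sub_self]⟩
  refine ⟨ζ, isOneForm_of (T := G.toTower) ?_ (fun g v w hv hw => ?_) (fun g c v hv => ?_), hζ⟩
  · have hb : ContMDiff (𝓡 (G.lev n).arr.dim).tangent (𝓡 (G.lev n).arr.dim) ∞
        (fun b : (G.lev n).arr.TB => b.1) := contMDiff_proj contMDiff_id
    refine (SmoothFn.D hF).comp (LieGroupoid.contMDiff_Tm (contMDiff_tsub (hp.TM) hQ fun b => ?_)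
      (contMDiff_zt (((G.lev k).inv_smooth.comp hp).comp hb)) fun b => ?_)
    · obtain ⟨g, v, hv, rfl⟩ := G.toTower.exists_pt_tan n b
      rw [h g v hv]
      exact G.toTower.pr_at hk g
    · obtain ⟨g, v, hv, rfl⟩ := G.toTower.exists_pt_tan n b
      rw [hlift g v hv, comp_inv (hsub hv).1 (hsub hv).2]
      exact congrArg (fun y => TM (G.lev k).tgt (zt ((G.lev k).inv y))) (G.toTower.pr_at hk g).symm
  · rw [hζ g _ (add_mem hv hw), hζ g _ hv, hζ g _ hw, map_add, hC.horAt_add, add_sub_add_comm, rt_add]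
    exact D_add_vec F _ _ _
  · rw [hζ g _ (Submodule.smul_mem _ c hv), hζ g _ hv, map_smul, hC.horAt_smul, ← smul_sub, rt_smul]
    exact D_smul_vec F _ _ _

namespace IsConnForm

variable {k : ℕ} {F : (G.lev k).arr → ℝ} {n : ℕ} {ζ : (G.lev n).arr.TB → ℝ}

theorem vert (hζ : IsConnForm C F n ζ) (hC : IsCartan C) {g : G.Arr} {v : Vec g} (hv : v ∈ Tan g)
    (h : dsrc g v = 0) : ζ (tb v n) = D F (tb (rt g v) k) := by
  rw [hζ.eq g v hv, h, hC.horAt_zero, sub_zero]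

theorem hor (hζ : IsConnForm C F n ζ) (hC : IsCartan C) {g : G.Arr} {v : Vec g} (hv : v ∈ C g) :
    ζ (tb v n) = 0 := by
  rw [hζ.eq g v (hC.le_Tan g hv), hC.horAt_eq hv, sub_self]
  have h := hζ.vert hC (zero_mem (Tan g)) (map_zero _)
  rw [tb_zero, hζ.form.zero] at h
  exact h.symm

theorem rightInv (hζ : IsConnForm C F n ζ) (hC : IsCartan C) (α : ∀ x, G.A x) (g : G.Arr) :
    ζ (tb (rightInv α g) n) = D F (tb (α (tgt g)).1 k) := by
  rw [hζ.vert hC (rightInv_mem_Tan α g) (dsrc_rightInv α g), rt_rightInv]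

theorem unit (hζ : IsConnForm C F n ζ) (hC : IsCartan C) {x : X} {v : Vec (one G x)}
    (hv : v ∈ Tan (one G x)) (h : dsrc _ v = 0) : ζ (tb v n) = D F (tb v k) := by
  rw [hζ.vert hC hv h, tb_rt_one hv h]

end IsConnForm

theorem deriv_tgt {φ : X → ℝ} (hφ : SmoothFn φ) {g : G.Arr} {v : Vec g} (hv : v ∈ Tan g) :
    deriv (fun q : G.Arr => φ (tgt q)) v = D φ ⟨tgt g, dtgt g v⟩ := by
  have h1 : SmoothFn (φ ∘ (G.lev 0).tgt) := SmoothFn.comp hφ (G.lev 0).tgt_subm.smooth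
  exact (deriv_eq (T := G.toTower) (f := fun q : G.Arr => φ (tgt q)) (m := 0) h1 (fun _ => rfl) hv).trans
    ((D_comp hφ (G.lev 0).tgt_subm.smooth _).trans (congrArg (D φ) (TM_tgt hv 0)))

theorem deriv_src {φ : X → ℝ} (hφ : SmoothFn φ) {g : G.Arr} {v : Vec g} (hv : v ∈ Tan g) :
    deriv (fun q : G.Arr => φ (src q)) v = D φ ⟨src g, dsrc g v⟩ := by
  have h1 : SmoothFn (φ ∘ (G.lev 0).src) := SmoothFn.comp hφ (G.lev 0).src_subm.smooth
  exact (deriv_eq (T := G.toTower) (f := fun q : G.Arr => φ (src q)) (m := 0) h1 (fun _ => rfl) hv).trans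
    ((D_comp hφ (G.lev 0).src_subm.smooth _).trans (congrArg (D φ) (TM_src hv 0)))

/-- Fields that are s-projectable to U and to 0 have a bracket that is s-projectable to [U, 0] = 0.
So the brackets that define the connection and the algebroid bracket take values in `A` at the
units. -/
theorem dsrc_lieBracket {V W : ∀ g : G.Arr, Vec g} (hV : Tower.IsVectorField V)
    (hW : Tower.IsVectorField W) {U : ∀ x, X.T x} (hU : Mfd.IsVectorField U)
    (hVU : ∀ g, dsrc g (V g) = U (src g)) (hW0 : ∀ g, dsrc g (W g) = 0) (g : G.Arr) :
    dsrc g (lieBracket V W g : Vec g) = 0 := by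
  have hs := (G.lev 0).src_subm.smooth
  have hT := (lieBracket V W g).2
  refine (dsrc_eq_iff 0 hT 0).mpr (TB_ext_D rfl fun f hf => ?_)
  have hfs : SmoothFn (f ∘ (G.lev 0).src) := SmoothFn.comp hf hs
  have hφ : SmoothFn fun x => D f ⟨x, U x⟩ := (SmoothFn.D hf).comp hU
  have h1 : (fun q => D (f ∘ (G.lev 0).src) (tb (W q) 0)) = fun _ => 0 := funext fun q => by
    rw [D_comp hf hs, TM_src_vert (hW.1 q) (hW0 q), D_zt]
  have h2 : (fun q => D (f ∘ (G.lev 0).src) (tb (V q) 0)) =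
      fun q => (fun x => D f ⟨x, U x⟩) (src q) := funext fun q => by
    rw [D_comp hf hs, TM_src (hV.1 q), hVU]
  rw [← D_comp hf hs]
  refine (D_lieBracket (T := G.toTower) hV hW g hfs).trans ?_
  rw [h1, h2, deriv_const 0 (hV.1 g), deriv_src hφ (hW.1 g), hW0, D_zero_vec]
  exact (sub_self 0).trans (D_zero_vec f _).symm

theorem IsCartan.hor_one (hC : IsCartan C) (V : ∀ x, X.T x) (x : X) :
    hor C V (one G x) = done G x (V x) := by
  refine hC.eq_of_dsrc_eq (hC.horAt_mem _ _) (hC.done_mem x (V x)) ?_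
  rw [hor_eq, hC.dsrc_horAt]
  have h : (dsrc (one G x) (done G x (V x)) : X.E) = V (src (one G x)) := by
    rw [dsrc_done]
    exact congrArg (fun y => (V y : X.E)) (src_one x).symm
  exact h.symm

theorem smooth_D_section {α : ∀ x, G.A x} (hα : IsSection α) {k : ℕ} {F : (G.lev k).arr → ℝ}
    (hF : SmoothFn F) : SmoothFn fun x => D F (tb (α x).1 k) := (SmoothFn.D hF).comp (hα k)

theorem deriv_rightInv_form (hC : IsCartan C) {α : ∀ x, G.A x} (hα : IsSection α) {k : ℕ}
    {F : (G.lev k).arr → ℝ} (hF : SmoothFn F) {n : ℕ} {ζ : (G.lev n).arr.TB → ℝ}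
    (hζ : IsConnForm C F n ζ) {x : X} {v : Vec (one G x)} (hv : v ∈ Tan (one G x)) :
    deriv (fun q : G.Arr => ζ (tb (rightInv α q) n)) v
      = D (fun x => D F (tb (α x).1 k)) ⟨x, dtgt (one G x) v⟩ := by
  have h1 : (fun q : G.Arr => ζ (tb (rightInv α q) n))
      = fun q => (fun x => D F (tb (α x).1 k)) (tgt q) := funext fun q => hζ.rightInv hC α q
  rw [h1, deriv_tgt (smooth_D_section hα hF) hv]
  exact congrArg (D _) (TB_ext (tgt_one x) rfl)

/-- Cartan's formula for dζ on the horizontal lift of `V` and the right-invariant field of `α`: `ζ`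
kills the former, equals dF(α) ∘ t on the latter, and at the unit reads dF of their bracket. -/
theorem D_nabla (hC : IsCartan C) {V : ∀ x, X.T x} (hV : Mfd.IsVectorField V) {α : ∀ x, G.A x}
    (hα : IsSection α) {k : ℕ} {F : (G.lev k).arr → ℝ} (hF : SmoothFn F) {n : ℕ}
    {ζ : (G.lev n).arr.TB → ℝ} (hζ : IsConnForm C F n ζ) (x : X) :
    D F (tb (nabla C V α x : Vec (one G x)) k) = D (fun x => D F (tb (α x).1 k)) ⟨x, V x⟩
      - extd ζ ((one G x).at n) (done G x (V x) n) ((α x).1 n) := by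
  have h1 := hC.hor_isVectorField hV
  have h2 := rightInv_isVectorField hα
  have h3 := extd_eq (T := G.toTower) h1 h2 hζ.form (one G x)
  have h4 : (fun q => ζ (tb (hor C V q) n)) = fun _ : G.Arr => 0 :=
    funext fun q => hζ.hor hC (hC.horAt_mem q _)
  have h5 := hζ.unit hC (lieBracket (hor C V) (rightInv α) (one G x)).2
    (dsrc_lieBracket h1 h2 hV (fun g => hC.dsrc_horAt g _) (dsrc_rightInv α) _)
  have h6 := deriv_rightInv_form hC hα hF hζ (h1.1 (one G x))
  erw [h6, h4, deriv_const 0 (h2.1 _), h5, hC.hor_one, rightInv_one] at h3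
  rw [dtgt_done] at h3
  rw [nabla]
  linarith

/-- Cartan's formula for dζ on two right-invariant fields. The bracket itself does not involve `C`;
`ζ` is used so that it can be combined with `D_nabla`. -/
theorem D_bracket (hC : IsCartan C) {α β : ∀ x, G.A x} (hα : IsSection α) (hβ : IsSection β) {k : ℕ}
    {F : (G.lev k).arr → ℝ} (hF : SmoothFn F) {n : ℕ} {ζ : (G.lev n).arr.TB → ℝ}
    (hζ : IsConnForm C F n ζ) (x : X) :
    D F (tb (bracket α β x : Vec (one G x)) k) = D (fun x => D F (tb (β x).1 k)) ⟨x, anchor α x⟩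
      - D (fun x => D F (tb (α x).1 k)) ⟨x, anchor β x⟩
      - extd ζ ((one G x).at n) ((α x).1 n) ((β x).1 n) := by
  have h1 := rightInv_isVectorField hα
  have h2 := rightInv_isVectorField hβ
  have h3 := extd_eq (T := G.toTower) h1 h2 hζ.form (one G x)
  have h0 : Mfd.IsVectorField fun x : X => (0 : X.T x) := contMDiff_zt contMDiff_id
  have h5 := hζ.unit hC (lieBracket (rightInv α) (rightInv β) (one G x)).2
    (dsrc_lieBracket h1 h2 h0 (dsrc_rightInv α) (dsrc_rightInv β) _)
  have h6 := deriv_rightInv_form hC hα hF hζ (h2.1 (one G x))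
  have h7 := deriv_rightInv_form hC hβ hF hζ (h1.1 (one G x))
  erw [h6, h7, h5, rightInv_one, rightInv_one] at h3
  rw [bracket]
  change _ = D _ ⟨x, anchor α x⟩ - D _ ⟨x, anchor β x⟩ - _ at h3
  linarith

/-- The derivatives of dF(α) and dF(β) cancel between the three terms and only values at `x`
survive: this is the tensoriality of the pointwise bracket. -/
theorem D_ptBracket (hC : IsCartan C) {α β : ∀ x, G.A x} (hα : IsSection α) (hβ : IsSection β) {k : ℕ}
    {F : (G.lev k).arr → ℝ} (hF : SmoothFn F) {n : ℕ} {ζ : (G.lev n).arr.TB → ℝ}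
    (hζ : IsConnForm C F n ζ) (x : X) :
    D F (tb (ptBracket C α β x : Vec (one G x)) k)
      = extd ζ ((one G x).at n) (done G x (anchor α x) n) ((β x).1 n)
        - extd ζ ((one G x).at n) (done G x (anchor β x) n) ((α x).1 n)
        - extd ζ ((one G x).at n) ((α x).1 n) ((β x).1 n) := by
  have h1 := D_bracket hC hα hβ hF hζ x
  have h2 := D_nabla hC (anchor_isVectorField hα) hβ hF hζ x
  have h3 := D_nabla hC (anchor_isVectorField hβ) hα hF hζ x
  have h4 : D F (tb (ptBracket C α β x : Vec (one G x)) k)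
      = D F (tb (bracket α β x : Vec (one G x)) k) - D F (tb (nabla C (anchor α) β x : Vec (one G x)) k)
        + D F (tb (nabla C (anchor β) α x : Vec (one G x)) k) :=
    (D_add_vec F _ _ _).trans (congrArg (fun t => t + _) (D_sub_vec F _ _ _))
  rw [h4, h1, h2, h3]
  ring

theorem dtgt_eq_zero {x : X} {b : G.A x} {k : ℕ} (hb : b.1 k = 0) :
    dtgt (one G x) b.1 = 0 := by
  have h := TM_tgt b.2.1 k
  rw [tb, hb] at h
  exact (snd_eq_of_TB_eq h).symm.trans (map_zero (d (G.lev k).tgt ((one G x).at k)))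

/-- Although `ζ` lives at level `n`, on `A` its exterior derivative sees only the `k`-th components.
Extend `b` to a section that vanishes at level `k`: its right-invariant field vanishes there too,
hence so does dF of the bracket with `α`, and in `D_bracket` only dζ remains. This is what lets the
differential equation for transport close up at one level. -/
theorem IsConnForm.extd_eq_zero {k : ℕ} {F : (G.lev k).arr → ℝ} {n : ℕ} {ζ : (G.lev n).arr.TB → ℝ}
    (hζ : IsConnForm C F n ζ) (hC : IsCartan C) (hF : SmoothFn F) {x : X} (a b : G.A x)
    (hb : b.1 k = 0) : extd ζ ((one G x).at n) (b.1 n) (a.1 n) = 0 := by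
  obtain ⟨β, hβ, hβx, hβ0⟩ := exists_section k b
  obtain ⟨α, hα, hαx, -⟩ := exists_section k a
  have h0 := hβ0 hb
  have hz : ∀ x, tb (β x).1 k = zt ((G.lev k).one x) := fun x => TB_ext rfl (h0 x)
  have h1 := D_bracket hC hβ hα hF hζ x
  have h2 : (fun x => D F (tb (β x).1 k)) = fun _ => 0 := funext fun x => by rw [hz, D_zt]
  have h3 : anchor β x = 0 := dtgt_eq_zero (h0 x)
  rw [h2, h3, D_zero_vec, D_const, hβx, hαx] at h1
  have h4 : D F (tb (bracket β α x : Vec (one G x)) k) = 0 := by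
    refine (D_lieBracket (T := G.toTower) (rightInv_isVectorField hβ) (rightInv_isVectorField hα)
      (one G x) hF).trans ?_
    have h5 : (fun q : G.Arr => D F (tb (PfGroupoid.rightInv β q) k)) = fun _ => 0 := funext fun q => by
      rw [tb_rightInv, hz, LieGroupoid.Tm_zt, D_zt]
    have h6 : SmoothFn fun y => D F ((G.lev k).Tm (tb (α ((G.lev k).tgt y)).1 k) (zt y)) :=
      (SmoothFn.D hF).comp (LieGroupoid.contMDiff_Tm ((hα k).comp (G.lev k).tgt_subm.smooth)
        (contMDiff_zt contMDiff_id) fun y => comp_A_zt _ rfl)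
    have h7 : ∀ q : G.Arr, D F (tb (PfGroupoid.rightInv α q) k)
        = D F ((G.lev k).Tm (tb (α ((G.lev k).tgt (q.at k))).1 k) (zt (q.at k))) := fun q => by
      rw [tb_rightInv]
      exact congrArg (fun x => D F ((G.lev k).Tm (tb (α x).1 k) (zt (q.at k)))) (tgt_at q k).symm
    rw [h5]
    erw [deriv_const 0 (rightInv_mem_Tan α _), deriv_eq (T := G.toTower) h6 h7 (rightInv_mem_Tan β _)]
    rw [tb_rightInv_one, hz, D_zt, sub_zero]
  rw [h4] at h1
  linarith

end PfGroupoid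

end

/-! ### Fundamental vectors and the scalar components of a form. -/

section

open Mfd Tower

namespace PrincipalBundle

variable {X : Mfd.{u}} {G : LieGroupoid.{u, v} X} {M : Mfd.{w}} {P : PrincipalBundle.{u, v, w, z} G M}

theorem dact_add (g : G.arr) (p : P.tot) (a a' : G.arr.T g) (b b' : P.tot.T p) :
    P.dact g p (a + a') (b + b') = P.dact g p a b + P.dact g p a' b' := d₂_add _ _ a a' b b'

theorem dact_smul (g : G.arr) (p : P.tot) (c : ℝ) (a : G.arr.T g) (b : P.tot.T p) :
    P.dact g p (c • a) (c • b) = c • P.dact g p a b := d₂_smul _ _ c a b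

theorem div_self (p : P.tot) : P.div p p = G.one (P.mom p) := by
  have h := P.act_div (G.one (P.mom p)) p (G.src_one _)
  rwa [P.one_act] at h

end PrincipalBundle

namespace PfPrincipalBundle

open PfGroupoid (src tgt one dsrc dtgt done horAt IsCartan mem_A_iff)

variable {X : Mfd.{u}} {G : PfGroupoid.{u, v} X} {M : Mfd.{w}}
variable {P : PfPrincipalBundle.{u, v, w, z} G M}

theorem TM_mom {p : P.Pt} {v : Vec p} (hv : v ∈ Tan p) (k : ℕ) :
    TM (P.lev k).mom (tb v k) = ⟨mom p, dmom p v⟩ := by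
  induction k with
  | zero => rfl
  | succ k ih =>
    rw [← ih, ← mem_Tan_iff.mp hv k]
    refine Eq.trans ?_ (TM_comp (P.lev k).mom_smooth (P.proj_subm k).smooth _)
    rw [show (P.lev k).mom ∘ P.toTower.proj k = (P.lev (k + 1)).mom from funext (P.mom_proj k)]

theorem TM_pr {p : P.Pt} {v : Vec p} (hv : v ∈ Tan p) (k : ℕ) :
    TM (P.lev k).pr (tb v k) = ⟨(P.lev 0).pr (p.at 0), dpr p v⟩ := by
  induction k with
  | zero => rfl
  | succ k ih =>
    rw [← ih, ← mem_Tan_iff.mp hv k]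
    refine Eq.trans ?_ (TM_comp (P.lev k).pr_subm.smooth (P.proj_subm k).smooth _)
    rw [show (P.lev k).pr ∘ P.toTower.proj k = (P.lev (k + 1)).pr from funext (P.pr_proj k)]

theorem dmom_eq_iff {p : P.Pt} {v : Vec p} (k : ℕ) (hv : v ∈ Tan p) (x : X.T (mom p)) :
    dmom p v = x ↔ TM (P.lev k).mom (tb v k) = ⟨mom p, x⟩ := by
  rw [TM_mom hv k]
  exact ⟨fun h => by rw [h], fun h => snd_eq_of_TB_eq h⟩

theorem pr_at (p : P.Pt) (k : ℕ) : (P.lev k).pr (p.at k) = (P.lev 0).pr (p.at 0) :=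
  congrArg (fun u : M.TB => u.1) (TM_pr (zero_mem (Tan p)) k)

theorem comp_at {g : G.Arr} {p : P.Pt} (c : src g = mom p) {v : Vec g} {w : Vec p} (hv : v ∈ Tan g)
    (hw : w ∈ Tan p) (e : (dsrc g v : X.E) = dmom p w) (k : ℕ) :
    TM (G.lev k).src (tb v k) = TM (P.lev k).mom (tb w k) := by
  rw [PfGroupoid.TM_src hv, TM_mom hw]
  exact TB_ext c e

theorem tb_dact {g : G.Arr} {p : P.Pt} (c : src g = mom p) (v : Vec g) (w : Vec p) (k : ℕ) :
    tb (dact g p c v w) k = (P.lev k).Ta (tb v k) (tb w k) := rfl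

theorem dact_mem_Tan {g : G.Arr} {p : P.Pt} (c : src g = mom p) {v : Vec g} {w : Vec p}
    (hv : v ∈ Tan g) (hw : w ∈ Tan p) (e : (dsrc g v : X.E) = dmom p w) :
    dact g p c v w ∈ Tan (act g p c) := by
  refine mem_Tan_iff.mpr fun k => ?_
  rw [tb_dact, tb_dact, ← mem_Tan_iff.mp hv k, ← mem_Tan_iff.mp hw k]
  exact TM_proj_Ta k (comp_at c hv hw e (k + 1))

theorem mom_act {g : G.Arr} {p : P.Pt} (c : src g = mom p) : mom (act g p c) = tgt g :=
  (P.lev 0).mom_act _ _ c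

theorem dmom_dact {g : G.Arr} {p : P.Pt} (c : src g = mom p) {v : Vec g} {w : Vec p}
    (hv : v ∈ Tan g) (hw : w ∈ Tan p) (e : (dsrc g v : X.E) = dmom p w) :
    (dmom _ (dact g p c v w) : X.E) = dtgt g v := by
  have h := TM_mom (dact_mem_Tan c hv hw e) 0
  rw [tb_dact, PrincipalBundle.Ta_mom (comp_at c hv hw e 0), PfGroupoid.TM_tgt hv] at h
  exact (snd_eq_of_TB_eq h).symm

theorem comp_A_zt {x : X} (a : G.A x) {k : ℕ} {y : (P.lev k).tot} (h : (P.lev k).mom y = x) :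
    TM (G.lev k).src (tb a.1 k) = TM (P.lev k).mom (zt y) := by
  rw [((mem_A_iff k).mp a.2).2, TM_zt, h]

theorem tb_infAct (p : P.Pt) (a : G.A (mom p)) (k : ℕ) :
    tb (infAct p a) k = (P.lev k).Ta (tb a.1 k) (zt (p.at k)) := by
  refine TB_ext ?_ rfl
  have h := (P.lev k).one_act (p.at k)
  rw [mom_at] at h
  exact h.symm

theorem infAct_mem_Tan (p : P.Pt) (a : G.A (mom p)) : infAct p a ∈ Tan p := by
  refine mem_Tan_iff.mpr fun k => ?_
  rw [tb_infAct, tb_infAct]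
  refine (TM_proj_Ta k (comp_A_zt _ (mom_at p _))).trans ?_
  rw [TM_zt]
  exact congrArg₂ (P.lev k).Ta (mem_Tan_iff.mp a.2.1 k) (congrArg zt (p.2 k))

theorem dmom_infAct (p : P.Pt) (a : G.A (mom p)) :
    dmom p (infAct p a) = (dtgt (one G (mom p)) a.1 : X.E) := by
  have h := TM_mom (infAct_mem_Tan p a) 0
  rw [tb_infAct, PrincipalBundle.Ta_mom (comp_A_zt _ (mom_at p _)), PfGroupoid.TM_tgt a.2.1] at h
  exact (snd_eq_of_TB_eq h).symm

theorem infAct_mem_vert (p : P.Pt) (a : G.A (mom p)) : infAct p a ∈ P.vert p := by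
  refine ⟨infAct_mem_Tan p a, ?_⟩
  have h := TM_pr (infAct_mem_Tan p a) 0
  rw [tb_infAct, PrincipalBundle.Ta_pr (comp_A_zt _ (mom_at p _)), TM_zt] at h
  exact (snd_eq_of_TB_eq h).symm

theorem infAct_add (p : P.Pt) (a b : G.A (mom p)) : infAct p (a + b) = infAct p a + infAct p b :=
  funext fun k => by
    have h := PrincipalBundle.dact_add (P := P.lev k) ((one G (mom p)).at k) (p.at k) (a.1 k) (b.1 k)
      0 0
    rw [add_zero] at h
    exact h

theorem infAct_smul (p : P.Pt) (c : ℝ) (a : G.A (mom p)) : infAct p (c • a) = c • infAct p a :=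
  funext fun k => by
    have h := PrincipalBundle.dact_smul (P := P.lev k) ((one G (mom p)).at k) (p.at k) c (a.1 k) 0
    rw [smul_zero] at h
    exact h

theorem infAct_zero (p : P.Pt) : infAct p 0 = 0 := by
  have h := infAct_smul p 0 0
  rwa [zero_smul, zero_smul] at h

theorem Tdiv_infAct (p : P.Pt) (a : G.A (mom p)) (k : ℕ) :
    (P.lev k).Tdiv (tb (infAct p a) k) (zt (p.at k)) = tb a.1 k := by
  rw [tb_infAct, PrincipalBundle.Tdiv_Ta (comp_A_zt _ (mom_at p _))]

theorem infAct_injective (p : P.Pt) : Function.Injective (infAct (P := P) p) := fun a b h =>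
  Subtype.ext (vec_ext fun k => by rw [← Tdiv_infAct, h, Tdiv_infAct])

/-- A vertical vector and the zero vector at `p` have the same image in TM; the differential of the
division map at this pair is the generator. -/
theorem exists_infAct {p : P.Pt} {v : Vec p} (hv : v ∈ P.vert p) : ∃ a, infAct p a = v := by
  have hpr : ∀ k, TM (P.lev k).pr (tb v k) = TM (P.lev k).pr (zt (p.at k)) := fun k => by
    rw [TM_pr hv.1, show dpr p v = 0 from hv.2, TM_zt]
    exact TB_ext (pr_at p k).symm rfl
  have hs : ∀ k, TM (G.lev k).src ((P.lev k).Tdiv (tb v k) (zt (p.at k)))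
      = TM (P.lev k).mom (zt (p.at k)) := fun k => PrincipalBundle.Tdiv_src (hpr k)
  let a : Vec (one G (mom p)) := fun k =>
    (((P.lev k).Tdiv (tb v k) (zt (p.at k))).2 : (G.lev k).arr.E)
  have ha : ∀ k, tb a k = (P.lev k).Tdiv (tb v k) (zt (p.at k)) := fun k =>
    TB_ext ((PrincipalBundle.div_self (p.at k)).trans (congrArg (G.lev k).one (mom_at p k))).symm rfl
  have haA : a ∈ G.A (mom p) := by
    refine (mem_A_iff 0).mpr ⟨mem_Tan_iff.mpr fun k => ?_, ?_⟩
    -- The division maps are not assumed to be compatible with the tower. Compatibility of the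
    -- generators follows from that of the action, since division is determined by the action
    -- through `Tdiv_Ta`.
    · have h1 := PrincipalBundle.Ta_Tdiv (hpr (k + 1))
      rw [← ha] at h1
      have hs1 := hs (k + 1)
      rw [← ha] at hs1
      have h2 := TM_proj_Ta k hs1
      rw [h1, TM_zt] at h2
      have h3 : TM (G.lev k).src (TM (G.proj k) (tb a (k + 1))) = TM (P.lev k).mom (zt (p.at k)) := by
        rw [← TM_comp (G.lev k).src_subm.smooth (G.proj_subm k).smooth,
          show (G.lev k).src ∘ G.proj k = (G.lev (k + 1)).src from funext (G.src_proj k), hs1,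
          TM_zt, TM_zt, mom_at, mom_at]
      have h4 : tb v k = (P.lev k).Ta (TM (G.proj k) (tb a (k + 1))) (zt (p.at k)) := by
        refine (mem_Tan_iff.mp hv.1 k).symm.trans (h2.trans ?_)
        exact congrArg (fun y => (P.lev k).Ta (TM (G.proj k) (tb a (k + 1))) (zt y)) (p.2 k)
      rw [ha k, h4, PrincipalBundle.Tdiv_Ta h3]
    · rw [ha, hs, TM_zt]
      rfl
  refine ⟨⟨a, haA⟩, vec_ext fun k => ?_⟩
  rw [tb_infAct]
  exact (congrArg (fun b => (P.lev k).Ta b _) (ha k)).trans (PrincipalBundle.Ta_Tdiv (hpr k))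

theorem exists_A_cast {x y : X} (h : x = y) (a : G.A x) : ∃ b : G.A y, ∀ k, tb b.1 k = tb a.1 k := by
  subst h
  exact ⟨a, fun _ => rfl⟩

/-- Horizontal and vertical parts of the action of a tangent vector. -/
theorem exists_dact_eq {C : ∀ g : G.Arr, Submodule ℝ (Vec g)} (hC : IsCartan C) {g : G.Arr} {p : P.Pt}
    (c : src g = mom p) {v : Vec g} (hv : v ∈ Tan g) (w : Vec p) :
    ∃ b : G.A (mom (act g p c)),
      dact g p c v w = dact g p c (horAt C g (dsrc g v)) w + infAct (act g p c) b ∧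
      ∀ k, tb b.1 k = tb (PfGroupoid.rt g (v - horAt C g (dsrc g v))) k := by
  have hu : v - horAt C g (dsrc g v) ∈ Tan g := sub_mem hv (hC.horAt_mem_Tan g _)
  have hu0 : dsrc g (v - horAt C g (dsrc g v)) = 0 := by rw [map_sub, hC.dsrc_horAt, sub_self]
  obtain ⟨b, hb⟩ := exists_A_cast (mom_act c).symm ⟨_, PfGroupoid.rt_mem_A hu hu0⟩
  refine ⟨b, ?_, hb⟩
  -- The s-vertical part of `v` is the right translate b·0_g, and (b·0_g)·0_p = b·0_{gp} by
  -- associativity of the tangent action.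
  have h1 : infAct (act g p c) b = dact g p c (v - horAt C g (dsrc g v)) 0 := vec_ext fun k => by
    rw [tb_infAct, hb, tb_dact, ← PfGroupoid.Tm_rt hu hu0 k, tb_zero,
      PrincipalBundle.Ta_mul (PfGroupoid.comp_A_zt ⟨_, PfGroupoid.rt_mem_A hu hu0⟩
        (PfGroupoid.tgt_at g k)) (by rw [TM_zt, TM_zt, PfGroupoid.src_at, mom_at, c]),
      PrincipalBundle.Ta_zt]
    rfl
  rw [h1]
  funext k
  have h2 := PrincipalBundle.dact_add (P := P.lev k) (g.at k) (p.at k) (horAt C g (dsrc g v) k)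
    ((v - horAt C g (dsrc g v)) k) (w k) 0
  rw [add_zero, Pi.sub_apply, add_sub_cancel] at h2
  exact h2

/-- The 1-form `dF ∘ θ` at level `n`. -/
structure IsScalarForm (θ : P.PreForm) {k : ℕ} (F : (G.lev k).arr → ℝ) (n : ℕ)
    (η : (P.lev n).tot.TB → ℝ) : Prop where
  form : IsOneForm η
  eq : ∀ (p : P.Pt) (v : Tan p), η (tb v.1 n) = D F (tb (θ p v).1 k)

theorem IsForm.exists_smooth {θ : P.PreForm} (hθ : IsForm θ) (k : ℕ) :
    ∃ m, ∀ n ≥ m, ∃ Θ : (P.lev n).tot.TB → (G.lev k).arr.TB,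
      ContMDiff (𝓡 (P.lev n).tot.dim).tangent (𝓡 (G.lev k).arr.dim).tangent ∞ Θ ∧
      ∀ (p : P.Pt) (v : Tan p), Θ (tb v.1 n) = tb (θ p v).1 k := by
  obtain ⟨m, F, hF, h⟩ := hθ k
  refine ⟨m, fun n hn => ⟨F ∘ TM (P.toTower.pr hn), hF.comp (P.toTower.smooth_pr hn).TM,
    fun p v => ?_⟩⟩
  rw [Function.comp_apply, P.toTower.TM_pr hn v.2]
  exact h p v

theorem IsForm.exists_scalarForm {θ : P.PreForm} (hθ : IsForm θ) (k : ℕ) :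
    ∃ m, ∀ n ≥ m, ∀ F : (G.lev k).arr → ℝ, SmoothFn F → ∃ η, IsScalarForm θ F n η := by
  obtain ⟨m, hm⟩ := hθ.exists_smooth k
  refine ⟨m, fun n hn F hF => ?_⟩
  obtain ⟨Θ, hΘ, h⟩ := hm n hn
  have key : ∀ (p : P.Pt) (v : Tan p), (D F ∘ Θ) (tb v.1 n) = D F (tb (θ p v).1 k) :=
    fun p v => congrArg (D F) (h p v)
  refine ⟨D F ∘ Θ, isOneForm_of (T := P.toTower) ((SmoothFn.D hF).comp hΘ) (fun p v w hv hw => ?_)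
    (fun p c v hv => ?_), key⟩
  · rw [key p ⟨v, hv⟩, key p ⟨w, hw⟩, key p ⟨v + w, add_mem hv hw⟩,
      show (⟨v + w, add_mem hv hw⟩ : Tan p) = ⟨v, hv⟩ + ⟨w, hw⟩ from rfl, map_add]
    exact D_add_vec F _ _ _
  · rw [key p ⟨v, hv⟩, key p ⟨c • v, Submodule.smul_mem _ c hv⟩,
      show (⟨c • v, Submodule.smul_mem _ c hv⟩ : Tan p) = c • ⟨v, hv⟩ from rfl, map_smul]
    exact D_smul_vec F _ _ _

theorem Reproduces.eq {θ : P.PreForm} (hR : Reproduces θ) (p : P.Pt) (a : G.A (mom p)) :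
    θ p ⟨infAct p a, infAct_mem_Tan p a⟩ = a := (hR p a).choose_spec

/-- The s-vertical part of `v` acts as a fundamental vector, and `θ` returns its generator. The two
terms separate transport along `C` from a contribution that depends on `v` alone. -/
theorem IsScalarForm.dact_eq {C : ∀ g : G.Arr, Submodule ℝ (Vec g)} (hC : IsCartan C) {θ : P.PreForm}
    (hR : Reproduces θ) {k : ℕ} {F : (G.lev k).arr → ℝ} {n N : ℕ} {η : (P.lev n).tot.TB → ℝ}
    (hη : IsScalarForm θ F n η) {ζ : (G.lev N).arr.TB → ℝ} (hζ : PfGroupoid.IsConnForm C F N ζ)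
    {g : G.Arr} {p : P.Pt} (c : src g = mom p) {v : Vec g} (hv : v ∈ Tan g) {w : Vec p} :
    η (tb (dact g p c v w) n) = η (tb (dact g p c (horAt C g (dsrc g v)) w) n) + ζ (tb v N) := by
  obtain ⟨b, h1, h2⟩ := exists_dact_eq hC c hv w
  rw [h1, hζ.eq g v hv, ← h2 k, ← hR.eq _ b, ← hη.eq _ ⟨infAct _ b, infAct_mem_Tan _ b⟩, hR.eq]
  exact hη.form.add _ _ _

end PfPrincipalBundle

end

/-! ### The derivative of transport along `C`, from mixed second derivatives. -/

section

open Mfd Tower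

namespace PfPrincipalBundle

open PfGroupoid (src tgt one dsrc dtgt done horAt IsCartan mem_A_iff IsConnForm)

variable {X : Mfd.{u}} {G : PfGroupoid.{u, v} X} {M : Mfd.{w}}
variable {P : PfPrincipalBundle.{u, v, w, z} G M} {C : ∀ g : G.Arr, Submodule ℝ (Vec g)}

/-- Identities that are known for composable pairs in the limit can by this be used for compatible
vectors at levels `N` and `n`. -/
theorem exists_lift_pair {N n : ℕ} {a : (G.lev N).arr.TB} {b : (P.lev n).tot.TB}
    (h : TM (G.lev N).src a = TM (P.lev n).mom b) :
    ∃ (g : G.Arr) (p : P.Pt) (_ : src g = mom p) (v : Vec g) (w : Vec p), v ∈ Tan g ∧ w ∈ Tan p ∧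
      (dsrc g v : X.E) = dmom p w ∧ tb v N = a ∧ tb w n = b := by
  obtain ⟨g, v, hv, rfl⟩ := G.toTower.exists_pt_tan N a
  obtain ⟨p, w, hw, rfl⟩ := P.toTower.exists_pt_tan n b
  rw [PfGroupoid.TM_src hv, TM_mom hw] at h
  exact ⟨g, p, congrArg (fun u : X.TB => u.1) h, v, w, hv, hw, snd_eq_of_TB_eq h, rfl, rfl⟩

/-- The vectors tangent to the units act trivially, and `a` contributes its fundamental vector by
linearity of the differential of the action. -/
theorem tb_dact_one {p : P.Pt} {y : Vec p} (hy : y ∈ Tan p) (a : G.A (mom p)) (n : ℕ) :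
    (P.lev n).Ta (tb (done G (mom p) (dmom p y) + a.1) n) (tb y n) = tb (y + infAct p a) n := by
  have h1 := PrincipalBundle.Ta_one (tb y n)
  rw [TM_mom hy n] at h1
  have h2 := PrincipalBundle.dact_add (P := P.lev n) ((one G (mom p)).at n) (p.at n)
    (done G (mom p) (dmom p y) n) (a.1 n) (y n) 0
  rw [add_zero] at h2
  have h0 : (P.lev n).act ((G.lev n).one (mom p)) (p.at n) = p.at n :=
    congrArg (fun u : (P.lev n).tot.TB => u.1) h1
  refine TB_ext h0 (h2.trans ?_)
  exact congrArg (fun t : (P.lev n).tot.E => @HAdd.hAdd (P.lev n).tot.E (P.lev n).tot.E _ _ t (infAct p a n))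
    (snd_eq_of_TB_eq h1)

/-- The exterior derivative of `dF ∘ θ` on a fundamental vector, by means of the family
`e(s, ε) q(s)`. -/
theorem IsScalarForm.hasDerivAt_dact (hC : IsCartan C) {θ : P.PreForm} (hR : Reproduces θ) {k : ℕ}
    {F : (G.lev k).arr → ℝ} {n N : ℕ} (hN : n ≤ N) {η : (P.lev n).tot.TB → ℝ}
    (hη : IsScalarForm θ F n η) {ζ : (G.lev N).arr.TB → ℝ} (hζ : IsConnForm C F N ζ)
    {Q : (G.lev N).arr.TB → (G.lev n).arr.TB}
    (hQ : ContMDiff (𝓡 (G.lev N).arr.dim).tangent (𝓡 (G.lev n).arr.dim).tangent ∞ Q)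
    (hQC : ∀ (g : G.Arr) (v : Vec g), v ∈ Tan g → Q (tb v N) = tb (horAt C g (dsrc g v)) n)
    {p : P.Pt} {y : Vec p} (hy : y ∈ Tan p) (a b : G.A (mom p)) {c : ℝ → (G.lev N).arr} (hc : Fam c)
    (hcs : ∀ t, (G.lev N).src (c t) = mom p) (hcb : dir c 0 1 = tb b.1 N) {h : ℝ → ℝ}
    (hh : ∀ (t : ℝ) (g : G.Arr) (e : src g = mom p), g.at N = c t →
      h t = η (tb (dact g p e (horAt C g (dmom p y : X.E)) y) n)) :
    HasDerivAt h (extd ζ ((one G (mom p)).at N) ((done G (mom p) (dmom p y) + a.1) N) (b.1 N)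
      - extd η (p.at n) ((y + infAct p a) n) (infAct p b n)) 0 := by
  have hsN := (G.lev N).src_subm.smooth
  have hmn := (P.lev n).mom_smooth
  obtain ⟨q, hq, hqy⟩ := exists_curve (tb y n)
  set A₀ : Vec (one G (mom p)) := done G (mom p) (dmom p y) + a.1 with hA₀
  have hA₀T : A₀ ∈ Tan (one G (mom p)) := add_mem (PfGroupoid.done_mem_Tan _ _) a.2.1
  have hA₀s : (dsrc _ A₀ : X.E) = dmom p y := by
    have h1 : dsrc _ A₀ = dsrc _ (done G (mom p) (dmom p y)) + dsrc _ a.1 := map_add _ _ _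
    rw [show dsrc (one G (mom p)) a.1 = 0 from a.2.2, add_zero] at h1
    exact h1.trans (PfGroupoid.dsrc_done _ _)
  have hc0 : c 0 = (one G (mom p)).at N := congrArg (fun u : (G.lev N).arr.TB => u.1) hcb
  have hq0 : q 0 = p.at n := congrArg (fun u : (P.lev n).tot.TB => u.1) hqy
  have hb0 : (⟨c 0, A₀ N⟩ : (G.lev N).arr.TB) = tb A₀ N := TB_ext hc0 rfl
  have hsA₀ : TM (G.lev N).src (tb A₀ N) = TM (P.lev n).mom (tb y n) := by
    rw [PfGroupoid.TM_src hA₀T, TM_mom hy]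
    exact TB_ext (PfGroupoid.src_one _) hA₀s
  -- Here e(0, ε) follows `c` in the s-fibre, ∂ₛe at the origin is `A₀`, and the source of e(s, ε)
  -- is μ(q(s)), so that e(s, ε) q(s) is defined; all this up to the cut-off `r` of the parameters,
  -- which is the identity near `0`.
  obtain ⟨r, e, hr, hr1, hr0, he, h1, h2, h3⟩ := exists_family hsN (hq.comp hmn) hc
    (fun t => (hcs t).trans (by rw [Function.comp_apply, hq0, mom_at]))
    ((G.lev N).src_subm.submersion _) (A₀ N)
    (by rw [hb0, hsA₀, ← hqy, TM_dir hmn hq])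
  rw [hb0] at h3
  set q' : ℝ → (P.lev n).tot := q ∘ r
  have hq' : Fam q' := hq.comp_left hr
  have hq'y : dir q' 0 1 = tb y n := (dir_reparam hr1 hq).trans hqy
  have hse : ∀ z, (G.lev N).src (e z) = (P.lev n).mom (q' z.1) := h1
  let π : (G.lev N).arr → (G.lev n).arr := G.toTower.pr hN
  have hπ : Smooth π := G.toTower.smooth_pr hN
  have hsπ : ∀ x, (G.lev n).src (π x) = (G.lev N).src x := fun x => by
    obtain ⟨g, rfl⟩ := G.toTower.exists_pt N x
    rw [PfGroupoid.src_at]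
    exact (congrArg (G.lev n).src (G.toTower.pr_at hN g)).trans (PfGroupoid.src_at g n)
  have hfst : Fam (fun z : ℝ × ℝ => q' z.1) := hq'.comp_left contDiff_fst
  have hdfst : ∀ z w : ℝ × ℝ, dir (fun z : ℝ × ℝ => q' z.1) z w = dir q' z.1 w.1 := fun z w => by
    have h4 := dir_comp (z := z) hq' (g := Prod.fst) differentiableAt_fst w
    rw [fderiv_fst] at h4
    exact h4
  have hcomp : ∀ z w, TM (G.lev N).src (dir e z w) = TM (P.lev n).mom (dir q' z.1 w.1) := fun z w => by
    rw [← hdfst, TM_dir hsN he, TM_dir hmn hfst]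
    exact congrArg (fun f : ℝ × ℝ → X => dir f z w) (funext hse)
  have hsn : ∀ z, (G.lev n).src (π (e z)) = (P.lev n).mom (q' z.1) := fun z => (hsπ _).trans (hse z)
  have hσ : Fam fun z => (P.lev n).act (π (e z)) (q' z.1) :=
    PrincipalBundle.fam_act (he.comp hπ) hfst hsn
  have hdσ : ∀ z w, dir (fun z => (P.lev n).act (π (e z)) (q' z.1)) z w
      = (P.lev n).Ta (TM π (dir e z w)) (dir q' z.1 w.1) := fun z w => by
    rw [TM_dir hπ he, ← hdfst]
    exact PrincipalBundle.dir_act (he.comp hπ) hfst hsn z w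
  have hID : ∀ {a : (G.lev N).arr.TB} {b : (P.lev n).tot.TB}, TM (G.lev N).src a = TM (P.lev n).mom b →
      η ((P.lev n).Ta (TM π a) b) = η ((P.lev n).Ta (Q a) b) + ζ a := by
    intro a b hab
    obtain ⟨g, p, e, v, w, hv, hw, -, rfl, rfl⟩ := exists_lift_pair hab
    rw [hQC g v hv, ← tb_dact e, ← hη.dact_eq hC hR hζ e hv, tb_dact]
    exact congrArg (fun t => η ((P.lev n).Ta t (tb w n))) (G.toTower.TM_pr hN hv)
  have hQs : ∀ a, TM (G.lev n).src (Q a) = TM (G.lev N).src a := fun a => by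
    obtain ⟨g, v, hv, rfl⟩ := G.toTower.exists_pt_tan N a
    rw [hQC g v hv, PfGroupoid.TM_src hv, PfGroupoid.TM_src (hC.horAt_mem_Tan g _), hC.dsrc_horAt]
  -- The transport term of η(∂ₛσ); its derivative in ε is the quantity sought.
  let H : ℝ × ℝ → ℝ := fun z => η ((P.lev n).Ta (Q (dir e z (1, 0))) (dir q' z.1 1))
  have hH : ContDiff ℝ ∞ H := by
    refine (hη.form.smooth.comp (PrincipalBundle.contMDiff_Ta (hQ.comp (he.dir (1, 0)))
      ((hq'.dir 1).comp contDiff_fst.contMDiff) fun z => ?_)).contDiff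
    exact (hQs _).trans (hcomp z (1, 0))
  -- ∂_ε e is s-vertical and q(s) does not depend on ε, so this direction has no transport term.
  have hη0 : (fun z => η (dir (fun z => (P.lev n).act (π (e z)) (q' z.1)) z (0, 1)))
      = fun z => ζ (dir e z (0, 1)) := funext fun z => by
    rw [hdσ, hID (hcomp z _), dir_smul_zero]
    have h4 := hcomp z (0, 1)
    rw [dir_smul_zero] at h4
    have h5 : ∃ x, Q (dir e z (0, 1)) = zt x := by
      obtain ⟨g, v, hv, hva⟩ := G.toTower.exists_pt_tan N (dir e z (0, 1))
      rw [← hva, PfGroupoid.TM_src hv] at h4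
      have h6 : dsrc g v = 0 := (snd_eq_of_TB_eq h4).trans
        (map_zero (d (P.lev n).mom (q' z.1)))
      rw [← hva, hQC g v hv, h6, hC.horAt_zero]
      exact ⟨_, rfl⟩
    obtain ⟨x, hx⟩ := h5
    rw [hx]
    have h7 := PrincipalBundle.Ta_zt (P := P.lev n) x (q' z.1)
    rw [show (⟨q' z.1, 0⟩ : (P.lev n).tot.TB) = zt (q' z.1) from rfl, h7, hη.form.zero, zero_add]
  have hη1 : (fun z => η (dir (fun z => (P.lev n).act (π (e z)) (q' z.1)) z (1, 0)))
      = fun z => H z + ζ (dir e z (1, 0)) := funext fun z => by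
    rw [hdσ, hID (hcomp z _)]
  have hζs : ContDiff ℝ ∞ fun z => ζ (dir e z (1, 0)) := (hζ.form.smooth.comp (he.dir (1, 0))).contDiff
  have hπtb : ∀ {v : Vec (one G (mom p))}, v ∈ Tan _ → TM π (tb v N) = tb v n :=
    fun hv => G.toTower.TM_pr hN hv
  have he01 : dir e 0 (0, 1) = tb b.1 N := by
    have hL : HasFDerivAt (fun t : ℝ => ((0 : ℝ), t))
        ((0 : ℝ →L[ℝ] ℝ).prod (ContinuousLinearMap.id ℝ ℝ)) 0 :=
      (hasFDerivAt_const (0 : ℝ) (0 : ℝ)).prodMk (hasFDerivAt_id (0 : ℝ))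
    have h4 := dir_comp he hL.differentiableAt 1
    rw [hL.fderiv] at h4
    refine h4.symm.trans (Eq.trans ?_ ((dir_reparam hr1 hc).trans hcb))
    exact congrArg (fun f : ℝ → (G.lev N).arr => dir f 0 1) (funext h2)
  have hv : dir (fun z => (P.lev n).act (π (e z)) (q' z.1)) 0 (1, 0) = tb (y + infAct p a) n := by
    rw [hdσ, h3, hπtb hA₀T]
    exact (congrArg _ hq'y).trans (tb_dact_one hy a n)
  have hw : dir (fun z => (P.lev n).act (π (e z)) (q' z.1)) 0 (0, 1) = tb (infAct p b) n := by
    rw [hdσ, he01, hπtb b.2.1, tb_infAct]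
    refine congrArg ((P.lev n).Ta (tb b.1 n)) ((dir_smul_zero q' 0).trans ?_)
    exact congrArg zt (congrArg (fun u : (P.lev n).tot.TB => u.1) hq'y)
  -- The `ζ`-terms in `k1` are exactly the mixed derivatives in `k2`, so dη = dζ - ∂_ε H at the
  -- origin.
  have k1 := fderiv_family_eq_extd hη.form hσ (p.at n) _ _ hv hw
  have k2 := fderiv_family_eq_extd hζ.form he _ _ _ h3 he01
  have k3 : fderiv ℝ (fun z => H z + ζ (dir e z (1, 0))) 0 (0, 1)
      = fderiv ℝ H 0 (0, 1) + fderiv ℝ (fun z => ζ (dir e z (1, 0))) 0 (0, 1) := by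
    rw [fderiv_fun_add (hH.differentiable (by simp) 0) (hζs.differentiable (by simp) 0)]
    rfl
  rw [hη0, hη1, k3] at k1
  have k4 : extd ζ ((one G (mom p)).at N) (A₀ N) (b.1 N)
      - extd η (p.at n) ((y + infAct p a) n) (infAct p b n) = fderiv ℝ H 0 (0, 1) := by
    linarith
  rw [k4]
  have hL : HasDerivAt (fun t : ℝ => ((0 : ℝ), t)) ((0 : ℝ), (1 : ℝ)) 0 :=
    (hasDerivAt_const (0 : ℝ) (0 : ℝ)).prodMk (hasDerivAt_id (0 : ℝ))
  have k5 : HasDerivAt (fun t => H (0, t)) (fderiv ℝ H 0 (0, 1)) 0 :=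
    HasFDerivAt.comp_hasDerivAt (f := fun t : ℝ => ((0 : ℝ), t)) (0 : ℝ)
      (hH.differentiable (by simp) 0).hasFDerivAt hL
  refine k5.congr_of_eventuallyEq ?_
  -- The image of ∂ₛe(0, t) under ds is dμ(y) for every t, so its part in `C` is the horizontal
  -- vector that occurs in `h`.
  filter_upwards [hr1] with t ht
  obtain ⟨g, v, hvT, hva⟩ := G.toTower.exists_pt_tan N (dir e (0, t) (1, 0))
  have hgN : g.at N = c t := by
    have h4 : g.at N = e (0, t) := congrArg (fun u : (G.lev N).arr.TB => u.1) hva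
    rw [h4, h2, ht]
  have hgs : src g = mom p := by rw [← PfGroupoid.src_at g N, hgN, hcs]
  have h5 := hcomp (0, t) (1, 0)
  rw [← hva, PfGroupoid.TM_src hvT] at h5
  have h6 : (dsrc g v : X.E) = dmom p y := by
    have h7 := h5.trans ((congrArg (TM (P.lev n).mom) hq'y).trans (TM_mom hy n))
    exact snd_eq_of_TB_eq h7
  rw [hh t g hgs hgN, tb_dact]
  change _ = η ((P.lev n).Ta (Q (dir e (0, t) (1, 0))) (dir q' 0 1))
  rw [hq'y, ← hva, hQC g v hvT]
  exact congrArg (fun x : X.E => η ((P.lev n).Ta (tb (horAt C g x) n) (tb y n))) h6.symm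

end PfPrincipalBundle

end

/-! ### Complements of the vertical bundle and reproducing forms. -/

section

open Mfd Tower

namespace Tower

variable {T : Tower.{u}}

theorem IsVectorField.add {V W : ∀ p : T.Pt, Vec p} (hV : IsVectorField V) (hW : IsVectorField W) :
    IsVectorField fun p => V p + W p := by
  refine ⟨fun p => add_mem (hV.1 p) (hW.1 p), fun k => ?_⟩
  obtain ⟨m, F, hF, h⟩ := hV.2 k
  obtain ⟨n, F', hF', h'⟩ := hW.2 k
  have hf := hF.comp (T.smooth_pr (le_max_left m n))
  have hf' := hF'.comp (T.smooth_pr (le_max_right m n))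
  -- The sum is written as V - (0 - W), so that smoothness of differences suffices.
  refine ⟨max m n, _, contMDiff_tsub hf (contMDiff_tsub (contMDiff_zt (contMDiff_proj hf')) hf'
    fun _ => rfl) fun y => ?_, fun p => ?_⟩
  · obtain ⟨p, rfl⟩ := T.exists_pt (max m n) y
    change (F (T.pr _ (p.at _))).1 = (F' (T.pr _ (p.at _))).1
    rw [T.pr_at, T.pr_at, h, h']
  · change tsub (F (T.pr _ (p.at _))) (tsub (zt (F' (T.pr _ (p.at _))).1) (F' (T.pr _ (p.at _)))) = _
    rw [T.pr_at, T.pr_at, h, h']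
    exact TB_ext rfl (show (V p k : (T.M k).E) - (0 - W p k) = V p k + W p k by rw [zero_sub, sub_neg_eq_add])

variable {D K : ∀ p : T.Pt, Submodule ℝ (Vec p)}

theorem IsComplement.le_Tan (h : IsComplement D K) (p : T.Pt) : D p ≤ Tan p :=
  (h.1 p).2 ▸ le_sup_left

theorem IsComplement.exists_smooth (h : IsComplement D K) (k : ℕ) :
    ∃ m, ∀ n ≥ m, ∃ F : (T.M n).TB → (T.M k).TB,
      ContMDiff (𝓡 (T.M n).dim).tangent (𝓡 (T.M k).dim).tangent ∞ F ∧
      ∀ p, ∀ c ∈ D p, ∀ e ∈ K p, F (tb (c + e) n) = tb c k := by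
  obtain ⟨m, F, hF, hm⟩ := h.2 k
  refine ⟨m, fun n hn => ⟨F ∘ TM (T.pr hn), hF.comp (T.smooth_pr hn).TM, fun p c hc e he => ?_⟩⟩
  have hT : c + e ∈ Tan p := (h.1 p).2 ▸ Submodule.add_mem_sup hc he
  rw [Function.comp_apply, T.TM_pr hn hT]
  exact hm p c hc e he

/-- Vectors in a sub-bundle extend to vector fields with values in the sub-bundle. -/
theorem IsComplement.exists_vectorField (h : IsComplement D K) {p : T.Pt} {v : Vec p} (hv : v ∈ D p) :
    ∃ V : ∀ p : T.Pt, Vec p, IsVectorField V ∧ (∀ q, V q ∈ D q) ∧ V p = v := by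
  obtain ⟨W, hW, hWp⟩ := Tower.exists_vectorField (h.le_Tan p hv)
  have hex : ∀ q, ∃ c ∈ D q, ∃ e ∈ K q, c + e = W q := fun q => by
    have h1 := hW.1 q
    rw [← (h.1 q).2] at h1
    exact Submodule.mem_sup.mp h1
  choose c hc e he hce using hex
  refine ⟨c, ⟨fun q => h.le_Tan q (hc q), fun k => ?_⟩, hc, ?_⟩
  · obtain ⟨m, hm⟩ := h.exists_smooth k
    obtain ⟨F, hF, h1⟩ := hm m le_rfl
    obtain ⟨n, G, hG, h2⟩ := hW.2 m
    refine ⟨n, F ∘ G, hF.comp hG, fun q => ?_⟩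
    rw [Function.comp_apply, h2, ← hce q]
    exact h1 q (c q) (hc q) (e q) (he q)
  · have h1 : v - c p ∈ D p ⊓ K p := ⟨sub_mem hv (hc p), by
      rw [← hWp, ← hce p, add_sub_cancel_left]; exact he p⟩
    rw [(h.1 p).1, Submodule.mem_bot] at h1
    exact (sub_eq_zero.mp h1).symm

end Tower

namespace PfPrincipalBundle

open PfGroupoid (src tgt one dsrc dtgt done horAt IsCartan mem_A_iff IsConnForm)

variable {X : Mfd.{u}} {G : PfGroupoid.{u, v} X} {M : Mfd.{w}}
variable {P : PfPrincipalBundle.{u, v, w, z} G M} {C : ∀ g : G.Arr, Submodule ℝ (Vec g)}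

theorem mem_ker_iff {θ : P.PreForm} {p : P.Pt} {v : Vec p} :
    v ∈ ker θ p ↔ ∃ h : v ∈ Tan p, θ p ⟨v, h⟩ = 0 := by
  constructor
  · rintro ⟨⟨w, hw⟩, h1, rfl⟩
    exact ⟨hw, h1⟩
  · rintro ⟨h, h1⟩
    exact ⟨⟨v, h⟩, h1, rfl⟩

theorem Reproduces.sub_mem_ker {θ : P.PreForm} (hR : Reproduces θ) {p : P.Pt} (v : Tan p) :
    v.1 - infAct p (θ p v) ∈ ker θ p := by
  refine mem_ker_iff.mpr ⟨sub_mem v.2 (infAct_mem_Tan p _), ?_⟩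
  have h : θ p (v - ⟨infAct p (θ p v), infAct_mem_Tan p _⟩) = 0 := by
    rw [map_sub, hR.eq, sub_self]
  exact h

/-- The horizontal part v - a(θ v) lies in the common kernel, and `θ'` applied to it gives θ' v - θ
v. -/
theorem Reproduces.ext {θ θ' : P.PreForm} (hR : Reproduces θ) (hR' : Reproduces θ')
    (h : ker θ = ker θ') : θ = θ' := by
  funext p
  refine LinearMap.ext fun v => ?_
  have h1 := hR.sub_mem_ker v
  rw [h] at h1
  obtain ⟨h2, h3⟩ := mem_ker_iff.mp h1
  have h4 : θ' p (v - ⟨infAct p (θ p v), infAct_mem_Tan p _⟩) = 0 := h3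
  rw [map_sub, hR'.eq, sub_eq_zero] at h4
  exact h4.symm

/-- A complement of the vertical bundle is the kernel of a form. -/
theorem exists_form {D : ∀ p : P.Pt, Submodule ℝ (Vec p)} (hD : IsComplement D P.vert) :
    ∃ θ : P.PreForm, IsForm θ ∧ (∀ p, D p = ker θ p) ∧ Reproduces θ := by
  have hex : ∀ (p : P.Pt) (v : Tan p), ∃ a : G.A (mom p), v.1 - infAct p a ∈ D p := fun p v => by
    obtain ⟨v, h1⟩ := v
    have h2 := h1
    rw [← (hD.1 p).2] at h2
    obtain ⟨c, hc, e, he, rfl⟩ := Submodule.mem_sup.mp h2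
    obtain ⟨a, rfl⟩ := exists_infAct he
    exact ⟨a, by rw [add_sub_cancel_right]; exact hc⟩
  choose t ht using hex
  -- Uniqueness of the generator does double duty: it makes the choice `t` linear and it computes
  -- `t` on fundamental vectors.
  have huniq : ∀ (p : P.Pt) (v : Tan p) (a : G.A (mom p)), v.1 - infAct p a ∈ D p → t p v = a := by
    intro p v a ha
    have h1 : infAct p (t p v) - infAct p a ∈ D p ⊓ P.vert p :=
      ⟨by have := sub_mem ha (ht p v); rwa [sub_sub_sub_cancel_left] at this,
        sub_mem (infAct_mem_vert p _) (infAct_mem_vert p _)⟩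
    rw [(hD.1 p).1, Submodule.mem_bot] at h1
    exact infAct_injective p (sub_eq_zero.mp h1)
  let θ : P.PreForm := fun p =>
    { toFun := t p
      map_add' := fun v w => huniq p _ _ (by
        rw [infAct_add]
        have := add_mem (ht p v) (ht p w)
        rwa [← add_sub_add_comm] at this)
      map_smul' := fun c v => huniq p _ _ (by
        rw [RingHom.id_apply, infAct_smul]
        have := Submodule.smul_mem _ c (ht p v)
        rwa [smul_sub] at this) }
  refine ⟨θ, fun k => ?_, fun p => ?_, fun p a => ⟨infAct_mem_Tan p a, huniq p _ a ?_⟩⟩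
  · obtain ⟨m, hm⟩ := hD.exists_smooth k
    obtain ⟨n, hmn, hk⟩ : ∃ n, m ≤ n ∧ k ≤ n := ⟨max m k, le_max_left m k, le_max_right m k⟩
    obtain ⟨F, hF, h⟩ := hm n hmn
    let π : (P.lev n).tot → (P.lev k).tot := P.toTower.pr hk
    have hπ : Smooth π := P.toTower.smooth_pr hk
    have hπb : ∀ (p : P.Pt) (v : Tan p), TM π (tb v.1 n) = tb v.1 k :=
      fun p v => P.toTower.TM_pr hk v.2
    have hF1 : ∀ (p : P.Pt) (v : Tan p), F (tb v.1 n) = tb (v.1 - infAct p (t p v)) k := fun p v => by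
      rw [← h p _ (ht p v) _ (infAct_mem_vert p (t p v)), sub_add_cancel]
    have hsub : ∀ (p : P.Pt) (v : Tan p), tsub (TM π (tb v.1 n)) (F (tb v.1 n))
        = tb (infAct p (t p v)) k := fun p v => by
      rw [hπb, hF1, ← tb_sub, sub_sub_cancel]
    have hb : ContMDiff (𝓡 (P.lev n).tot.dim).tangent (𝓡 (P.lev k).tot.dim) ∞
        (fun b : (P.lev n).tot.TB => π b.1) := hπ.comp (contMDiff_proj contMDiff_id)
    -- The vertical part of `b` is `b` minus its projection; dividing it by the zero vector gives
    -- the generator, by smooth maps only.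
    refine ⟨n, fun b => (P.lev k).Tdiv (tsub (TM π b) (F b)) (zt (π b.1)),
      PrincipalBundle.contMDiff_Tdiv (contMDiff_tsub hπ.TM hF fun b => ?_) (contMDiff_zt hb) fun b => ?_,
      fun p v => ?_⟩
    · obtain ⟨p, v, hv, rfl⟩ := P.toTower.exists_pt_tan n b
      rw [hπb p ⟨v, hv⟩, hF1 p ⟨v, hv⟩]
      rfl
    · obtain ⟨p, v, hv, rfl⟩ := P.toTower.exists_pt_tan n b
      have h1 := TM_pr (infAct_mem_Tan p (t p ⟨v, hv⟩)) k
      rw [show dpr p (infAct p (t p ⟨v, hv⟩)) = 0 from (infAct_mem_vert p _).2] at h1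
      rw [hsub p ⟨v, hv⟩, h1, TM_zt]
      refine TB_ext ?_ rfl
      exact (pr_at p k).symm.trans (congrArg (P.lev k).pr (P.toTower.pr_at hk p).symm)
    · change (P.lev k).Tdiv (tsub (TM π (tb v.1 n)) (F (tb v.1 n))) (zt (π (p.at n))) = tb (t p v).1 k
      rw [hsub, ← Tdiv_infAct p (t p v) k]
      exact congrArg (fun y => (P.lev k).Tdiv _ (zt y)) (P.toTower.pr_at hk p)
  · ext v
    rw [mem_ker_iff]
    constructor
    · intro hv
      refine ⟨hD.le_Tan p hv, huniq p _ 0 ?_⟩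
      rw [infAct_zero, sub_zero]
      exact hv
    · rintro ⟨h, h0⟩
      have h1 := ht p ⟨v, h⟩
      rw [show t p ⟨v, h⟩ = 0 from h0, infAct_zero, sub_zero] at h1
      exact h1
  · rw [sub_self]
    exact zero_mem _

theorem deriv_mom {φ : X → ℝ} (hφ : SmoothFn φ) {p : P.Pt} {v : Vec p} (hv : v ∈ Tan p) :
    deriv (fun q : P.Pt => φ (mom q)) v = D φ ⟨mom p, dmom p v⟩ := by
  have h1 : SmoothFn (φ ∘ (P.lev 0).mom) := SmoothFn.comp hφ (P.lev 0).mom_smooth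
  exact (deriv_eq (T := P.toTower) (f := fun q : P.Pt => φ (mom q)) (m := 0) h1 (fun _ => rfl) hv).trans
    ((D_comp hφ (P.lev 0).mom_smooth _).trans (congrArg (D φ) (TM_mom hv 0)))

theorem infAct_isVectorField {α : ∀ x, G.A x} (hα : PfGroupoid.IsSection α) :
    Tower.IsVectorField fun p : P.Pt => infAct p (α (mom p)) := by
  refine ⟨fun p => infAct_mem_Tan p _, fun k => ⟨k,
    fun y => (P.lev k).Ta (tb (α ((P.lev k).mom y)).1 k) (zt y),
    PrincipalBundle.contMDiff_Ta ((hα k).comp (P.lev k).mom_smooth) (contMDiff_zt contMDiff_id)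
      fun y => comp_A_zt _ rfl, fun p => ?_⟩⟩
  refine Eq.trans ?_ (tb_infAct p _ k).symm
  exact congrArg (fun x => (P.lev k).Ta (tb (α x).1 k) (zt (p.at k))) (mom_at p k)

/-- The kernel of a form is a complement of the vertical bundle. -/
theorem isComplement_ker {θ : P.PreForm} (hθ : IsForm θ) (hR : Reproduces θ) :
    IsComplement (ker θ) P.vert := by
  refine ⟨fun p => ⟨?_, ?_⟩, fun k => ?_⟩
  · refine (Submodule.eq_bot_iff _).mpr ?_
    rintro v ⟨h1, h2⟩
    obtain ⟨a, rfl⟩ := exists_infAct h2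
    obtain ⟨h, h3⟩ := mem_ker_iff.mp h1
    rw [hR.eq] at h3
    rw [h3, infAct_zero]
  · refine le_antisymm (sup_le ?_ inf_le_left) fun v hv => ?_
    · intro v hv
      exact (mem_ker_iff.mp hv).1
    · have h1 := Submodule.add_mem_sup (hR.sub_mem_ker ⟨v, hv⟩) (infAct_mem_vert p (θ p ⟨v, hv⟩))
      rwa [sub_add_cancel] at h1
  · obtain ⟨m, hm⟩ := hθ.exists_smooth k
    obtain ⟨n, hmn, hk⟩ : ∃ n, m ≤ n ∧ k ≤ n := ⟨max m k, le_max_left m k, le_max_right m k⟩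
    obtain ⟨Θ, hΘ, h⟩ := hm n hmn
    let π : (P.lev n).tot → (P.lev k).tot := P.toTower.pr hk
    have hπ : Smooth π := P.toTower.smooth_pr hk
    have hπb : ∀ (p : P.Pt) (v : Tan p), TM π (tb v.1 n) = tb v.1 k :=
      fun p v => P.toTower.TM_pr hk v.2
    have hb : ContMDiff (𝓡 (P.lev n).tot.dim).tangent (𝓡 (P.lev k).tot.dim) ∞
        (fun b : (P.lev n).tot.TB => π b.1) := hπ.comp (contMDiff_proj contMDiff_id)
    have hT : ∀ (p : P.Pt) (v : Tan p), (P.lev k).Ta (Θ (tb v.1 n)) (zt (π (p.at n)))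
        = tb (infAct p (θ p v)) k := fun p v => by
      rw [h, tb_infAct]
      exact congrArg (fun y => (P.lev k).Ta _ (zt y)) (P.toTower.pr_at hk p)
    -- The projection onto the kernel is v ↦ v - a(θ v).
    refine ⟨n, fun b => tsub (TM π b) ((P.lev k).Ta (Θ b) (zt (π b.1))), contMDiff_tsub hπ.TM
      (PrincipalBundle.contMDiff_Ta hΘ (contMDiff_zt hb) fun b => ?_) fun b => ?_,
      fun p c hc e he => ?_⟩
    · obtain ⟨p, v, hv, rfl⟩ := P.toTower.exists_pt_tan n b
      rw [h p ⟨v, hv⟩]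
      exact comp_A_zt _ ((congrArg (P.lev k).mom (P.toTower.pr_at hk p)).trans (mom_at p k))
    · obtain ⟨p, v, hv, rfl⟩ := P.toTower.exists_pt_tan n b
      rw [hπb p ⟨v, hv⟩]
      exact (congrArg (fun u : (P.lev k).tot.TB => u.1) (hT p ⟨v, hv⟩)).symm
    · obtain ⟨a, rfl⟩ := exists_infAct he
      obtain ⟨hcT, hc0⟩ := mem_ker_iff.mp hc
      let v : Tan p := ⟨c, hcT⟩ + ⟨infAct p a, infAct_mem_Tan p a⟩
      have hv : θ p v = a := by rw [map_add, hR.eq, hc0, zero_add]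
      change tsub (TM π (tb v.1 n)) ((P.lev k).Ta (Θ (tb v.1 n)) (zt (π (p.at n)))) = tb c k
      rw [hT, hπb, hv, ← tb_sub]
      exact congrArg (fun t => tb t k) (add_sub_cancel_right c (infAct p a))

theorem dmom_lieBracket {V W : ∀ p : P.Pt, Vec p} (hV : Tower.IsVectorField V)
    (hW : Tower.IsVectorField W) (hV0 : ∀ p, dmom p (V p) = 0) (hW0 : ∀ p, dmom p (W p) = 0)
    (p : P.Pt) : dmom p (lieBracket V W p : Vec p) = 0 := by
  have hs := (P.lev 0).mom_smooth
  refine (dmom_eq_iff 0 (lieBracket V W p).2 0).mpr (TB_ext_D rfl fun f hf => ?_)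
  have hfs : SmoothFn (f ∘ (P.lev 0).mom) := SmoothFn.comp hf hs
  have h1 : ∀ {V : ∀ p : P.Pt, Vec p}, Tower.IsVectorField V → (∀ p, dmom p (V p) = 0) →
      (fun q => D (f ∘ (P.lev 0).mom) (tb (V q) 0)) = fun _ => 0 := fun hV hV0 => funext fun q => by
    rw [D_comp hf hs, TM_mom (hV.1 q), hV0]
    exact D_zt f _
  rw [← D_comp hf hs]
  refine (D_lieBracket (T := P.toTower) hV hW p hfs).trans ?_
  rw [h1 hV hV0, h1 hW hW0, deriv_const 0 (hV.1 p), deriv_const 0 (hW.1 p)]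
  exact (sub_self 0).trans (D_zero_vec f _).symm

end PfPrincipalBundle

end

/-! ### Existence of the pull-back connection. -/

section

open Mfd Tower

namespace Mfd

variable {L : Mfd.{u}} {N : Mfd.{v}}

/-- The vertical derivative of a vector field along a map at a zero. -/
theorem exists_vertical_deriv {S : N → L.TB} (hS : ContMDiff (𝓡 N.dim) (𝓡 L.dim).tangent ∞ S)
    {y₀ : N} {x₀ : L} (h0 : S y₀ = zt x₀) (b : N.T y₀) :
    ∃ u : L.T x₀, ∀ f : L → ℝ, SmoothFn f → D f ⟨x₀, u⟩ = D (fun y => D f (S y)) ⟨y₀, b⟩ := by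
  refine ⟨∑ i, D (fun y => D (crd x₀ i) (S y)) ⟨y₀, b⟩ • frm x₀ i x₀, fun f hf => ?_⟩
  have hb : Smooth fun y => (S y).1 := contMDiff_proj hS
  have hx : (S y₀).1 = x₀ := by rw [h0]; rfl
  have hc : ∀ i, SmoothFn fun y => coef (D f) x₀ i (S y).1 := fun i =>
    (hf.isOneForm.smooth_coef x₀ i).comp hb
  have hd : ∀ i, SmoothFn fun y => D (crd x₀ i) (S y) := fun i =>
    (SmoothFn.D (smooth_crd x₀ i)).comp hS
  have hloc : (fun y => D f (S y)) =ᶠ[nhds y₀]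
      fun y => ∑ i, coef (D f) x₀ i (S y).1 * D (crd x₀ i) (S y) := by
    have h1 : Filter.Tendsto (fun y => (S y).1) (nhds y₀) (nhds x₀) :=
      hx ▸ hb.continuous.tendsto y₀
    filter_upwards [h1.eventually (hf.isOneForm.local_form x₀)] with y hy
    exact hy _ rfl
  rw [D_congr (u := ⟨y₀, b⟩) hloc, D_sum _ fun i => (hc i).mul (hd i), hf.isOneForm.sum]
  refine Finset.sum_congr rfl fun i _ => ?_
  rw [D_mul (hc i) (hd i), hf.isOneForm.smul]
  -- The derivatives of the coefficients are multiplied by components of `S y₀`, which is zero; what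
  -- remains is linear in df at `x₀`.
  change _ = coef (D f) x₀ i (S y₀).1 * _ + D (crd x₀ i) (S y₀) * _
  rw [hx, h0, D_zt, zero_mul, add_zero, mul_comm]
  rfl

end Mfd

namespace PfPrincipalBundle

open PfGroupoid (src tgt one dsrc dtgt done horAt IsCartan mem_A_iff IsConnForm)

variable {X : Mfd.{u}} {G : PfGroupoid.{u, v} X} {M : Mfd.{w}}
variable {P : PfPrincipalBundle.{u, v, w, z} G M} {C : ∀ g : G.Arr, Submodule ℝ (Vec g)}

theorem IsSection.exists_smooth {σ : ∀ p : P.Pt, G.A (mom p)} (hσ : IsSection σ) (k : ℕ) :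
    ∃ m, ∀ n ≥ m, ∃ S : (P.lev n).tot → (G.lev k).arr.TB,
      ContMDiff (𝓡 (P.lev n).tot.dim) (𝓡 (G.lev k).arr.dim).tangent ∞ S ∧
      ∀ p : P.Pt, S (p.at n) = tb (σ p).1 k := by
  obtain ⟨m, F, hF, h⟩ := hσ k
  refine ⟨m, fun n hn => ⟨F ∘ P.toTower.pr hn, hF.comp (P.toTower.smooth_pr hn), fun p => ?_⟩⟩
  rw [Function.comp_apply]
  exact (congrArg F (P.toTower.pr_at hn p)).trans (h p)

theorem IsSection.isSmoothFun {σ : ∀ p : P.Pt, G.A (mom p)} (hσ : IsSection σ) {k : ℕ}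
    {F : (G.lev k).arr → ℝ} (hF : SmoothFn F) :
    IsSmoothFun (T := P.toTower) fun p => D F (tb (σ p).1 k) := by
  obtain ⟨m, S, hS, h⟩ := hσ k
  exact ⟨m, fun y => D F (S y), (SmoothFn.D hF).comp hS, fun p => congrArg (D F) (h p).symm⟩

theorem isSection_mom {α : ∀ x, G.A x} (hα : PfGroupoid.IsSection α) :
    IsSection fun p : P.Pt => α (mom p) := fun k =>
  ⟨k, fun y => tb (α ((P.lev k).mom y)).1 k, (hα k).comp (P.lev k).mom_smooth,
    fun p => congrArg (fun x => tb (α x).1 k) (mom_at p k)⟩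

theorem IsSection.sub {σ τ : ∀ p : P.Pt, G.A (mom p)} (hσ : IsSection σ) (hτ : IsSection τ) :
    IsSection fun p => σ p - τ p := by
  intro k
  obtain ⟨m, hm⟩ := hσ.exists_smooth k
  obtain ⟨m', hm'⟩ := hτ.exists_smooth k
  obtain ⟨S, hS, h⟩ := hm (max m m') (le_max_left _ _)
  obtain ⟨S', hS', h'⟩ := hm' (max m m') (le_max_right _ _)
  refine ⟨max m m', fun y => tsub (S y) (S' y), contMDiff_tsub hS hS' fun y => ?_, fun p => ?_⟩
  · obtain ⟨p, rfl⟩ := P.toTower.exists_pt _ y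
    rw [h, h']
    rfl
  · change tsub (S (p.at _)) (S' (p.at _)) = _
    rw [h, h']
    rfl

/-- At a zero of a section its derivative needs no connection. Compatibility of the levels and
membership in ker(ds) are inherited from `τ` by testing on functions. -/
theorem IsSection.exists_deriv_of_zero {τ : ∀ p : P.Pt, G.A (mom p)} (hτ : IsSection τ) {p : P.Pt}
    (h0 : τ p = 0) {v : Vec p} (hv : v ∈ Tan p) :
    ∃ u : G.A (mom p), ∀ (k : ℕ) (F : (G.lev k).arr → ℝ), SmoothFn F →
      D F (tb u.1 k) = deriv (fun q : P.Pt => D F (tb (τ q).1 k)) v := by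
  have hex : ∀ k, ∃ u : (G.lev k).arr.T ((one G (mom p)).at k), ∀ F : (G.lev k).arr → ℝ,
      SmoothFn F → D F ⟨(one G (mom p)).at k, u⟩ = deriv (fun q : P.Pt => D F (tb (τ q).1 k)) v := by
    intro k
    obtain ⟨m, S, hS, h⟩ := hτ k
    obtain ⟨u, hu⟩ := exists_vertical_deriv hS (y₀ := p.at m) (x₀ := (one G (mom p)).at k)
      (by rw [h p, h0]; rfl) (v m)
    refine ⟨u, fun F hF => (hu F hF).trans ?_⟩
    exact (deriv_eq (T := P.toTower) (f := fun q => D F (tb (τ q).1 k)) ((SmoothFn.D hF).comp hS)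
      (fun q => congrArg (D F) (h q).symm) hv).symm
  choose u hu using hex
  have hT : u ∈ Tan (one G (mom p)) := by
    refine mem_Tan_iff.mpr fun k => TB_ext_D ((one G (mom p)).2 k) fun F hF => ?_
    have hp := (G.proj_subm k).smooth
    rw [← D_comp hF (G.toTower.proj_subm k).smooth]
    refine (hu (k + 1) _ (SmoothFn.comp hF hp)).trans (Eq.trans ?_ (hu k F hF).symm)
    congr 1
    funext q
    rw [D_comp hF hp]
    exact congrArg (D F) (mem_Tan_iff.mp (τ q).2.1 k)
  refine ⟨⟨u, (mem_A_iff 0).mpr ⟨hT, TB_ext_D ((G.lev 0).src_one _) fun f hf => ?_⟩⟩, hu⟩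
  have hs := (G.lev 0).src_subm.smooth
  rw [← D_comp hf hs, D_zt]
  refine (hu 0 _ (SmoothFn.comp hf hs)).trans ?_
  have h1 : (fun q : P.Pt => D (f ∘ (G.lev 0).src) (tb (τ q).1 0)) = fun _ => 0 := funext fun q => by
    rw [D_comp hf hs, ((mem_A_iff 0).mp (τ q).2).2, D_zt]
  rw [h1, deriv_const 0 hv]

/-- The characterization of the pull-back connection through scalar functions. -/
def DeltaSpec (C : ∀ g : G.Arr, Submodule ℝ (Vec g)) (σ : ∀ p : P.Pt, G.A (mom p)) (p : P.Pt)
    (v : Tan p) (u : G.A (mom p)) : Prop :=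
  ∀ (k : ℕ) (F : (G.lev k).arr → ℝ), SmoothFn F → ∀ (n : ℕ) (ζ : (G.lev n).arr.TB → ℝ),
    IsConnForm C F n ζ → D F (tb u.1 k) = deriv (fun q : P.Pt => D F (tb (σ q).1 k)) v.1
      - extd ζ ((one G (mom p)).at n) (done G (mom p) (dmom p v.1) n) ((σ p).1 n)

/-- Every `F` has a connection form at some level, so the scalar equations determine all components.
-/
theorem DeltaSpec.unique (hC : IsCartan C) {σ : ∀ p : P.Pt, G.A (mom p)} {p : P.Pt} {v : Tan p}
    {u u' : G.A (mom p)} (h : DeltaSpec C σ p v u) (h' : DeltaSpec C σ p v u') : u = u' := by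
  refine Subtype.ext (tan_ext fun k F hF => ?_)
  obtain ⟨n, hn⟩ := hC.exists_connForm k
  obtain ⟨ζ, hζ⟩ := hn n le_rfl F hF
  rw [h k F hF n ζ hζ, h' k F hF n ζ hζ]

theorem nabla_mem_A (hC : IsCartan C) {V : ∀ x, X.T x} (hV : Mfd.IsVectorField V) {α : ∀ x, G.A x}
    (hα : PfGroupoid.IsSection α) (x : X) :
    (PfGroupoid.nabla C V α x : Vec (one G x)) ∈ G.A x :=
  ⟨(PfGroupoid.nabla C V α x).2, PfGroupoid.dsrc_lieBracket (hC.hor_isVectorField hV)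
    (PfGroupoid.rightInv_isVectorField hα) hV (fun g => hC.dsrc_horAt g _)
    (PfGroupoid.dsrc_rightInv α) _⟩

theorem deltaSpec_nabla (hC : IsCartan C) {V : ∀ x, X.T x} (hV : Mfd.IsVectorField V)
    {α : ∀ x, G.A x} (hα : PfGroupoid.IsSection α) {p : P.Pt} (v : Tan p)
    (hv : dmom p v.1 = V (mom p)) :
    DeltaSpec C (fun q : P.Pt => α (mom q)) p v
      ⟨PfGroupoid.nabla C V α (mom p), nabla_mem_A hC hV hα _⟩ := by
  intro k F hF n ζ hζ
  have h1 := PfGroupoid.D_nabla hC hV hα hF hζ (mom p)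
  have h2 := deriv_mom (P := P) (PfGroupoid.smooth_D_section hα hF) v.2
  rw [h2, hv]
  exact h1

/-- Subtract from `σ` a pulled-back section with the same value at `p`. The connection on `A`
differentiates the latter; the difference vanishes at `p` and has a derivative of its own. -/
theorem DeltaSpec.exists (hC : IsCartan C) {σ : ∀ p : P.Pt, G.A (mom p)} (hσ : IsSection σ) (p : P.Pt)
    (v : Tan p) : ∃ u, DeltaSpec C σ p v u := by
  obtain ⟨α, hα, hαp, -⟩ := PfGroupoid.exists_section 0 (σ p)
  obtain ⟨V, hV, hVp⟩ := Mfd.exists_vectorField (mom p) (dmom p v.1)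
  have h1 := deltaSpec_nabla hC hV hα v hVp.symm
  have hτ := hσ.sub (isSection_mom (P := P) hα)
  obtain ⟨u₂, h2⟩ := hτ.exists_deriv_of_zero (p := p) (by rw [hαp, sub_self]) v.2
  refine ⟨⟨PfGroupoid.nabla C V α (mom p), nabla_mem_A hC hV hα _⟩ + u₂, fun k F hF n ζ hζ => ?_⟩
  have h3 : (fun q : P.Pt => D F (tb (σ q).1 k)) = fun q : P.Pt =>
      D F (tb (σ q - α (mom q)).1 k) + D F (tb (α (mom q)).1 k) := funext fun q => by
    refine Eq.trans ?_ (D_add_vec F _ _ _)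
    exact congrArg (fun t => D F (tb t k)) (sub_add_cancel (σ q).1 (α (mom q)).1).symm
  rw [h3, deriv_add (hτ.isSmoothFun hF) ((isSection_mom (P := P) hα).isSmoothFun hF) v.2, ← h2 k F hF]
  have h4 := h1 k F hF n ζ hζ
  refine (D_add_vec F _ _ _).trans ?_
  change D F (tb (PfGroupoid.nabla C V α (mom p) : Vec (one G (mom p))) k) + D F (tb u₂.1 k) = _
  change D F (tb (PfGroupoid.nabla C V α (mom p) : Vec (one G (mom p))) k)
    = deriv (fun q : P.Pt => D F (tb (α (mom q)).1 k)) v.1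
      - extd ζ ((one G (mom p)).at n) (done G (mom p) (dmom p v.1) n) ((α (mom p)).1 n) at h4
  rw [hαp] at h4
  rw [h4]
  ring

theorem done_add (x : X) (a b : X.T x) : done G x (a + b) = done G x a + done G x b :=
  funext fun k => map_add (d (G.lev k).one x) a b

theorem done_smul (x : X) (c : ℝ) (a : X.T x) : done G x (c • a) = c • done G x a :=
  funext fun k => map_smul (d (G.lev k).one x) c a

theorem DeltaSpec.exists_linear (hC : IsCartan C) {σ : ∀ p : P.Pt, G.A (mom p)} (hσ : IsSection σ)
    (p : P.Pt) : ∃ l : Tan p →ₗ[ℝ] G.A (mom p), ∀ v, DeltaSpec C σ p v (l v) := by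
  choose t ht using DeltaSpec.exists hC hσ p
  refine ⟨{ toFun := t, map_add' := fun v w => ?_, map_smul' := fun c v => ?_ }, ht⟩
  · refine (ht (v + w)).unique hC fun k F hF n ζ hζ => ?_
    have h1 : deriv (fun q : P.Pt => D F (tb (σ q).1 k)) (v + w).1
        = deriv (fun q : P.Pt => D F (tb (σ q).1 k)) v.1
          + deriv (fun q : P.Pt => D F (tb (σ q).1 k)) w.1 :=
      deriv_vec_add (hσ.isSmoothFun hF) v.2 w.2
    have h2 : done G (mom p) (dmom p (v + w).1)
        = done G (mom p) (dmom p v.1) + done G (mom p) (dmom p w.1) := by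
      rw [← done_add]
      exact congrArg _ (map_add (dmom p) v.1 w.1)
    have h3 : D F (tb (t v + t w).1 k) = D F (tb (t v).1 k) + D F (tb (t w).1 k) := D_add_vec F _ _ _
    rw [h1, h2, h3, ht v k F hF n ζ hζ, ht w k F hF n ζ hζ, Pi.add_apply, extd_add_left]
    ring
  · refine (ht (c • v)).unique hC fun k F hF n ζ hζ => ?_
    have h1 : deriv (fun q : P.Pt => D F (tb (σ q).1 k)) (c • v).1
        = c * deriv (fun q : P.Pt => D F (tb (σ q).1 k)) v.1 :=
      deriv_vec_smul (hσ.isSmoothFun hF) v.2 c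
    have h2 : done G (mom p) (dmom p (c • v).1) = c • done G (mom p) (dmom p v.1) := by
      rw [← done_smul]
      exact congrArg _ (map_smul (dmom p) c v.1)
    have h3 : D F (tb (c • t v).1 k) = c * D F (tb (t v).1 k) := D_smul_vec F _ _ _
    rw [h1, h2, RingHom.id_apply, h3, ht v k F hF n ζ hζ, Pi.smul_apply, extd_smul_left]
    ring

open Classical in
/-- The pull-back connection. -/
def delta (C : ∀ g : G.Arr, Submodule ℝ (Vec g)) (σ : ∀ p : P.Pt, G.A (mom p)) : P.PreForm := fun p =>
  if h : ∃ l : Tan p →ₗ[ℝ] G.A (mom p), ∀ v, DeltaSpec C σ p v (l v) then h.choose else 0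

theorem delta_spec (hC : IsCartan C) {σ : ∀ p : P.Pt, G.A (mom p)} (hσ : IsSection σ) (p : P.Pt)
    (v : Tan p) : DeltaSpec C σ p v (delta C σ p v) := by
  have h := DeltaSpec.exists_linear hC hσ p
  have h1 : delta C σ p = h.choose := dif_pos h
  rw [h1]
  exact h.choose_spec v

theorem delta_eq (hC : IsCartan C) {σ : ∀ p : P.Pt, G.A (mom p)} {p : P.Pt}
    (l : Tan p →ₗ[ℝ] G.A (mom p)) (hl : ∀ v, DeltaSpec C σ p v (l v)) : delta C σ p = l := by
  have h : ∃ l : Tan p →ₗ[ℝ] G.A (mom p), ∀ v, DeltaSpec C σ p v (l v) := ⟨l, hl⟩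
  have h1 : delta C σ p = h.choose := dif_pos h
  rw [h1]
  exact LinearMap.ext fun v => (h.choose_spec v).unique hC (hl v)

/-- By the scalar formula the `k`-th component depends only on the `m`-th component of the tangent
vector, and smoothly. A vector at level `m` may therefore be lifted to the limit arbitrarily in
order to define the map between levels. -/
theorem isForm_delta (hC : IsCartan C) {σ : ∀ p : P.Pt, G.A (mom p)} (hσ : IsSection σ) :
    IsForm (delta C σ) := by
  intro k
  obtain ⟨N, hN⟩ := hC.exists_connForm k
  have hζ := hN N le_rfl
  obtain ⟨m₁, hm₁⟩ := hσ.exists_smooth k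
  obtain ⟨m₂, hm₂⟩ := hσ.exists_smooth N
  obtain ⟨m, h1, h2⟩ : ∃ m, m₁ ≤ m ∧ m₂ ≤ m := ⟨max m₁ m₂, le_max_left _ _, le_max_right _ _⟩
  obtain ⟨S, hS, hSp⟩ := hm₁ m h1
  obtain ⟨S', hS', hSp'⟩ := hm₂ m h2
  have hform : ∀ (F : (G.lev k).arr → ℝ), SmoothFn F → ∀ ζ, IsConnForm C F N ζ →
      ∀ (p : P.Pt) (v : Tan p), D F (tb (delta C σ p v).1 k)
        = D (fun y => D F (S y)) (tb v.1 m)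
          - extd ζ (TM (G.lev N).one (TM (P.lev m).mom (tb v.1 m))).1
              (TM (G.lev N).one (TM (P.lev m).mom (tb v.1 m))).2 (S' (tb v.1 m).1).2 := by
    intro F hF ζ hζ p v
    rw [delta_spec hC hσ p v k F hF N ζ hζ]
    congr 1
    · exact deriv_eq (T := P.toTower) (f := fun q => D F (tb (σ q).1 k)) ((SmoothFn.D hF).comp hS)
        (fun q => congrArg (D F) (hSp q).symm) v.2
    · rw [TM_mom v.2 m]
      exact congrArg (fun t : (G.lev N).arr.TB => extd ζ ((one G (mom p)).at N)
        (done G (mom p) (dmom p v.1) N) t.2) (hSp' p).symm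
  choose pt vec hvec hb using fun b : (P.lev m).tot.TB => P.toTower.exists_pt_tan m b
  have hwd : ∀ (b : (P.lev m).tot.TB) (p : P.Pt) (v : Tan p), tb v.1 m = b →
      tb (delta C σ (pt b) ⟨vec b, hvec b⟩).1 k = tb (delta C σ p v).1 k := by
    rintro b p v h
    have hmom : mom (pt b) = mom p := by
      have h3 : (pt b).at m = p.at m := congrArg (fun u : (P.lev m).tot.TB => u.1) ((hb b).trans h.symm)
      rw [← mom_at (pt b) m, h3, mom_at]
    refine TB_ext_D (congrArg (fun x => (one G x).at k) hmom) fun F hF => ?_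
    obtain ⟨ζ, hζF⟩ := hζ F hF
    rw [hform F hF ζ hζF, hform F hF ζ hζF]
    change D (fun y => D F (S y)) (tb (vec b) m) - extd ζ (TM _ (TM _ (tb (vec b) m))).1
      (TM _ (TM _ (tb (vec b) m))).2 (S' (tb (vec b) m).1).2 = _
    rw [hb b, h]
  refine ⟨m, fun b => tb (delta C σ (pt b) ⟨vec b, hvec b⟩).1 k, contMDiff_TB ?_ fun F hF => ?_,
    fun p v => hwd _ p v rfl⟩
  · have h3 : Smooth fun y => (G.lev k).one ((P.lev m).mom y) :=
      (G.lev k).one_smooth.comp (P.lev m).mom_smooth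
    refine (ContMDiff.comp h3 (contMDiff_proj contMDiff_id)).congr fun b => ?_
    have h4 : (pt b).at m = b.1 := congrArg (fun u : (P.lev m).tot.TB => u.1) (hb b)
    change (one G (mom (pt b))).at k = (G.lev k).one ((P.lev m).mom b.1)
    rw [← h4, mom_at]
    rfl
  · obtain ⟨ζ, hζF⟩ := hζ F hF
    have h3 : ContMDiff (𝓡 (P.lev m).tot.dim).tangent 𝓘(ℝ, ℝ) ∞ (fun b : (P.lev m).tot.TB =>
        D (fun y => D F (S y)) b - extd ζ (TM (G.lev N).one (TM (P.lev m).mom b)).1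
              (TM (G.lev N).one (TM (P.lev m).mom b)).2 (S' b.1).2) := by
      refine ContMDiff.sub (SmoothFn.D ((SmoothFn.D hF).comp hS))
        (contMDiff_extd hζF.form ((G.lev N).one_smooth.TM.comp (P.lev m).mom_smooth.TM)
          (hS'.comp (contMDiff_proj contMDiff_id)) fun b => ?_)
      obtain ⟨p, v, hv, rfl⟩ := P.toTower.exists_pt_tan m b
      refine Eq.trans ?_ (congrArg (fun u : (G.lev N).arr.TB => u.1) (hSp' p)).symm
      exact congrArg (G.lev N).one (mom_at p m)
    refine h3.congr fun b => ?_
    rw [hform F hF ζ hζF]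
    change D (fun y => D F (S y)) (tb (vec b) m) - extd ζ (TM _ (TM _ (tb (vec b) m))).1
      (TM _ (TM _ (tb (vec b) m))).2 (S' (tb (vec b) m).1).2 = _
    rw [hb b]

theorem isPullbackConnection_delta (hC : IsCartan C) :
    IsPullbackConnection (P := P) C (delta C) := by
  refine ⟨fun σ hσ => isForm_delta hC hσ, fun σ τ hσ hτ p => ?_, fun f σ hf hσ p v => ?_, fun k => ?_,
    fun α V hα hV p v hv => ?_⟩
  · refine delta_eq hC _ fun v k F hF n ζ hζ => ?_
    have h1 := delta_spec hC hσ p v k F hF n ζ hζ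
    have h2 := delta_spec hC hτ p v k F hF n ζ hζ
    have h3 : (fun q : P.Pt => D F (tb (σ q + τ q).1 k))
        = fun q => D F (tb (σ q).1 k) + D F (tb (τ q).1 k) := funext fun q => D_add_vec F _ _ _
    have h4 : extd ζ ((one G (mom p)).at n) (done G (mom p) (dmom p v.1) n) ((σ p + τ p).1 n)
        = _ := extd_add_right ζ _ _ _ _
    rw [h3, deriv_add (hσ.isSmoothFun hF) (hτ.isSmoothFun hF) v.2, h4]
    refine (D_add_vec F _ _ _).trans ?_
    change D F (tb (delta C σ p v).1 k) + D F (tb (delta C τ p v).1 k) = _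
    rw [h1, h2]
    ring
  · have hl : delta C (fun q => f q • σ q) p = f p • delta C σ p +
        LinearMap.toSpanSingleton ℝ _ (σ p) ∘ₗ
          { toFun := fun v : Tan p => deriv f v.1
            map_add' := fun v w => deriv_vec_add hf v.2 w.2
            map_smul' := fun c v => deriv_vec_smul hf v.2 c } := by
      refine delta_eq hC _ fun v k F hF n ζ hζ => ?_
      have h1 := delta_spec hC hσ p v k F hF n ζ hζ
      have h3 : (fun q : P.Pt => D F (tb (f q • σ q).1 k))
          = fun q => f q * D F (tb (σ q).1 k) := funext fun q => D_smul_vec F _ _ _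
      have h4 : extd ζ ((one G (mom p)).at n) (done G (mom p) (dmom p v.1) n) ((f p • σ p).1 n)
          = _ := extd_smul_right ζ _ _ _ _
      rw [h3, deriv_mul hf (hσ.isSmoothFun hF) v.2, h4]
      refine (D_add_vec F _ _ _).trans ?_
      refine (congrArg₂ (· + ·) (D_smul_vec F _ (f p) ((delta C σ p v).1 k))
        (D_smul_vec F _ (deriv f v.1) ((σ p).1 k))).trans ?_
      change f p * D F (tb (delta C σ p v).1 k) + deriv f v.1 * D F (tb (σ p).1 k) = _
      rw [h1]
      ring
    rw [hl]
    exact add_comm _ _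
  · obtain ⟨N, hN⟩ := hC.exists_connForm k
    -- If `σ` vanishes at this level, both terms of the scalar formula do: the derivative of the
    -- `k`-th component, and dζ with a zero argument.
    refine ⟨max N k, fun σ hσ h0 p v => ?_⟩
    have hz : ∀ (q : P.Pt), tb (σ q).1 k = zt ((one G (mom q)).at k) := fun q => by
      have h1 := G.toTower.TM_pr (le_max_right N k) (σ q).2.1
      rw [show tb (σ q).1 (max N k) = zt _ from TB_ext rfl (h0 q), TM_zt] at h1
      exact h1.symm.trans (congrArg zt (G.toTower.pr_at _ (one G (mom q))))
    refine snd_eq_of_TB_eq (u := tb (delta C σ p v).1 k) (u' := zt _) (TB_ext_D rfl fun F hF => ?_)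
    obtain ⟨ζ, hζ⟩ := hN (max N k) (le_max_left _ _) F hF
    rw [delta_spec hC hσ p v k F hF _ ζ hζ, h0 p, extd_zero_right, sub_zero, D_zt,
      show (fun q : P.Pt => D F (tb (σ q).1 k)) = fun _ => 0 from funext fun q => by rw [hz, D_zt],
      deriv_const 0 v.2]
  · exact congrArg Subtype.val ((delta_spec hC (isSection_mom hα) p v).unique hC
      (deltaSpec_nabla hC hV hα v hv))

end PfPrincipalBundle

end

/-! ### The Maurer-Cartan equation against invariance and involutivity. -/

section

open Mfd Tower

namespace PfPrincipalBundle

open PfGroupoid (src tgt one dsrc dtgt done horAt IsCartan mem_A_iff IsConnForm)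

variable {X : Mfd.{u}} {G : PfGroupoid.{u, v} X} {M : Mfd.{w}}
variable {P : PfPrincipalBundle.{u, v, w, z} G M} {C : ∀ g : G.Arr, Submodule ℝ (Vec g)}

theorem isSection_form {θ : P.PreForm} (hθ : IsForm θ) {Z : ∀ p : P.Pt, Tan p}
    (hZ : Tower.IsVectorField fun p => (Z p : Vec p)) : IsSection fun q => θ q (Z q) := by
  intro k
  obtain ⟨m, hm⟩ := hθ.exists_smooth k
  obtain ⟨Θ, hΘ, h⟩ := hm m le_rfl
  obtain ⟨n, S, hS, h'⟩ := hZ.2 m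
  exact ⟨n, Θ ∘ S, hΘ.comp hS, fun p => (congrArg Θ (h' p)).trans (h p (Z p))⟩

theorem exists_curve_src {x : X} {N : ℕ} (b : G.A x) : ∃ c : ℝ → (G.lev N).arr, Fam c ∧
    (∀ t, (G.lev N).src (c t) = x) ∧ dir c 0 1 = tb b.1 N := by
  obtain ⟨r, c, -, -, -, hc, h1, h2⟩ := exists_curve_lift (G.lev N).src_subm.smooth (fam_const x)
    (tb b.1 N) ((G.lev N).src_subm.submersion _) (by rw [((mem_A_iff N).mp b.2).2, dir_const]; rfl)
  exact ⟨c, hc, h1, h2⟩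

theorem IsScalarForm.zero_of_mem_ker {θ : P.PreForm} {k : ℕ} {F : (G.lev k).arr → ℝ} {n : ℕ}
    {η : (P.lev n).tot.TB → ℝ} (hη : IsScalarForm θ F n η) {p : P.Pt} {v : Vec p} (hv : v ∈ ker θ p) :
    η (tb v n) = 0 := by
  obtain ⟨h, h0⟩ := mem_ker_iff.mp hv
  rw [hη.eq p ⟨v, h⟩, h0]
  exact D_zero_vec F _

/-- Scalar forms, connection forms, and the projection to `C`, at suitable levels. -/
theorem exists_levels (hC : IsCartan C) {θ : P.PreForm} (hθ : IsForm θ) (k : ℕ) :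
    ∃ n N : ℕ, n ≤ N ∧ (∃ Q : (G.lev N).arr.TB → (G.lev n).arr.TB,
      ContMDiff (𝓡 (G.lev N).arr.dim).tangent (𝓡 (G.lev n).arr.dim).tangent ∞ Q ∧
      ∀ (g : G.Arr) (v : Vec g), v ∈ Tan g → Q (tb v N) = tb (horAt C g (dsrc g v)) n) ∧
      ∀ F : (G.lev k).arr → ℝ, SmoothFn F →
        ∃ η ζ, IsScalarForm θ F n η ∧ IsConnForm C F N ζ := by
  obtain ⟨n, hn⟩ := hθ.exists_scalarForm k
  obtain ⟨m₁, h₁⟩ := hC.exists_horAt_smooth n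
  obtain ⟨m₂, h₂⟩ := hC.exists_connForm k
  refine ⟨n, max n (max m₁ m₂), le_max_left _ _, h₁ _ (le_trans (le_max_left _ _) (le_max_right _ _)),
    fun F hF => ?_⟩
  obtain ⟨η, hη⟩ := hn n le_rfl F hF
  obtain ⟨ζ, hζ⟩ := h₂ _ (le_trans (le_max_right m₁ m₂) (le_max_right n _)) F hF
  exact ⟨η, ζ, hη, hζ⟩

/-- Both fields are split at `p` into kernel parts y, z and fundamental vectors of a, b. Invariance
under `C` determines dη on pairs with a fundamental argument and involutivity makes it vanish on (y,
z); bilinearity then gives dη(Y, Z) through dζ, which is what the connection and the pointwise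
bracket require. -/
theorem maurerCartan_of_flat (hC : IsCartan C) {θ : P.PreForm} (hθ : IsForm θ) (hR : Reproduces θ)
    (hD : IsFlatStructure C (ker θ)) : MaurerCartan C θ := by
  refine ⟨delta C, isPullbackConnection_delta hC, fun Y Z hY hZ p α β hα hβ hαp hβp => ?_⟩
  refine tan_ext fun k F hF => ?_
  obtain ⟨n, N, hnN, ⟨Q, hQ, hQC⟩, hex⟩ := exists_levels hC hθ k
  obtain ⟨η, ζ, hη, hζ⟩ := hex F hF
  set a : G.A (mom p) := θ p (Y p) with ha
  set b : G.A (mom p) := θ p (Z p) with hb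
  have hy := hR.sub_mem_ker (Y p)
  have hz := hR.sub_mem_ker (Z p)
  rw [← ha] at hy
  rw [← hb] at hz
  set y : Vec p := (Y p).1 - infAct p a with hydef
  set z : Vec p := (Z p).1 - infAct p b with hzdef
  have hyT := (mem_ker_iff.mp hy).1
  have hzT := (mem_ker_iff.mp hz).1
  -- Transport along `C` keeps `y` in the kernel, so the function differentiated in
  -- `hasDerivAt_dact` is identically zero.
  have star : ∀ {y : Vec p}, y ∈ ker θ p → ∀ a b : G.A (mom p),
      extd η (p.at n) ((y + infAct p a) n) (infAct p b n)
        = extd ζ ((one G (mom p)).at N) ((done G (mom p) (dmom p y) + a.1) N) (b.1 N) := by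
    intro y hy a b
    obtain ⟨c, hc, hcs, hcb⟩ := exists_curve_src (N := N) b
    have h1 := hη.hasDerivAt_dact hC hR hnN hζ hQ hQC (mem_ker_iff.mp hy).1 a b hc hcs hcb
      (h := fun _ => 0) fun t g e _ => (hη.zero_of_mem_ker (hD.dact_mem g p e _ (hC.horAt_mem g _) y hy
        (hC.dsrc_horAt g _))).symm
    have h2 := h1.unique (hasDerivAt_const (0 : ℝ) (0 : ℝ))
    linarith
  have k1 := star hy a b
  -- No fundamental part is added to `z`: the pair of two fundamental vectors is already accounted
  -- for in `k1`.
  have k2 := star hz 0 a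
  rw [infAct_zero, add_zero] at k2
  have k3 : extd η (p.at n) (y n) (z n) = 0 := by
    obtain ⟨V, hV, hVD, hVp⟩ := hD.ehresmann.exists_vectorField hy
    obtain ⟨W, hW, hWD, hWp⟩ := hD.ehresmann.exists_vectorField hz
    have h1 := extd_eq (T := P.toTower) hV hW hη.form p
    have h2 : ∀ {V : ∀ p : P.Pt, Vec p}, (∀ q, V q ∈ ker θ q) →
        (fun q => η (tb (V q) n)) = fun _ => 0 := fun hV => funext fun q => hη.zero_of_mem_ker (hV q)
    have h3 := hη.zero_of_mem_ker (hD.flat V W hV hW hVD hWD p)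
    rw [h2 hVD, h2 hWD, deriv_const 0 (hV.1 p), deriv_const 0 (hW.1 p), h3, hVp, hWp] at h1
    linarith
  have hYy : (Y p).1 = y + infAct p a := (sub_add_cancel _ _).symm
  have hZz : (Z p).1 = z + infAct p b := (sub_add_cancel _ _).symm
  have k4 : extd η (p.at n) ((Y p).1 n) ((Z p).1 n)
      = extd η (p.at n) ((y + infAct p a) n) (infAct p b n)
        - extd η (p.at n) (z n) (infAct p a n) + extd η (p.at n) (y n) (z n) := by
    rw [hYy, hZz, Pi.add_apply z, extd_add_right, Pi.add_apply y, extd_add_left η _ _ _ (z n),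
      extd_antisymm η _ (infAct p a n) (z n)]
    ring
  have hdone : ∀ {v y : Vec p} {a : G.A (mom p)}, v = y + infAct p a →
      done G (mom p) (dmom p v) = done G (mom p) (dmom p y) + done G (mom p) (dtgt _ a.1 : X.E) := by
    rintro v y a rfl
    exact (congrArg (done G (mom p)) ((map_add _ _ _).trans
      (congrArg (fun t => dmom p y + t) (dmom_infAct p a)))).trans (done_add ..)
  have k5 := extd_eq (T := P.toTower) hY hZ hη.form p
  have hηf : ∀ {Z : ∀ p : P.Pt, Tan p}, (fun q => η (tb (Z q).1 n))
      = fun q => D F (tb (θ q (Z q)).1 k) := funext fun q => hη.eq q _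
  have k6 := delta_spec hC (isSection_form hθ hZ) p (Y p) k F hF N ζ hζ
  have k7 := delta_spec hC (isSection_form hθ hY) p (Z p) k F hF N ζ hζ
  have k8 := PfGroupoid.D_ptBracket hC hα hβ hF hζ (mom p)
  have hanch : ∀ {α : ∀ x, G.A x} {a : G.A (mom p)}, α (mom p) = a →
      PfGroupoid.anchor α (mom p) = (dtgt _ a.1 : X.E) := by
    rintro α a rfl
    rfl
  rw [hηf, hηf, hη.eq p] at k5
  rw [hanch hαp, hanch hβp, hαp, hβp] at k8
  rw [hdone hYy, Pi.add_apply, extd_add_left] at k6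
  rw [hdone hZz, Pi.add_apply, extd_add_left] at k7
  rw [Pi.add_apply (done G (mom p) _), extd_add_left ζ] at k1
  rw [Pi.add_apply, extd_add_left, show ((0 : G.A (mom p)).1 N) = 0 from rfl, extd_zero_left] at k2
  refine Eq.trans ?_ (D_zero_vec F _).symm
  refine (D_add_vec F _ _ _).trans ?_
  refine (congrArg (fun t => t + _) ((D_sub_vec F _ _ _).trans
    (congrArg (fun t => t - _) (D_sub_vec F _ _ _)))).trans ?_
  change D F (tb (delta C (fun q => θ q (Z q)) p (Y p)).1 k)
    - D F (tb (delta C (fun q => θ q (Y q)) p (Z p)).1 k)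
    - D F (tb (θ p (Tower.lieBracket (fun q => (Y q : Vec q)) (fun q => (Z q : Vec q)) p)).1 k)
    + D F (tb (PfGroupoid.ptBracket C α β (mom p) : Vec (one G (mom p))) k) = 0
  rw [k6, k7, k8]
  beta_reduce
  rw [← ha, ← hb]
  linarith

/-- Vectors are extended to sums of a kernel field and a fundamental field, on which `θ` is a
section pulled back from `A`. Hence only the naturality of the connection `Δ` is used, and the
equation turns into a formula for dη at a point. -/
theorem MaurerCartan.extd_eq (hC : IsCartan C) {θ : P.PreForm} (hθ : IsForm θ) (hR : Reproduces θ)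
    (hM : MaurerCartan C θ) {k : ℕ} {F : (G.lev k).arr → ℝ} (hF : SmoothFn F) {n N : ℕ}
    {η : (P.lev n).tot.TB → ℝ} (hη : IsScalarForm θ F n η) {ζ : (G.lev N).arr.TB → ℝ}
    (hζ : IsConnForm C F N ζ) {p : P.Pt} (v w : Tan p) :
    extd η (p.at n) (v.1 n) (w.1 n)
      = extd ζ ((one G (mom p)).at N) (done G (mom p) (dmom p v.1) N) ((θ p w).1 N)
        - extd ζ ((one G (mom p)).at N) (done G (mom p) (dmom p w.1) N) ((θ p v).1 N)
        - extd ζ ((one G (mom p)).at N) (done G (mom p) (dtgt _ (θ p v).1 : X.E) N) ((θ p w).1 N)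
        + extd ζ ((one G (mom p)).at N) (done G (mom p) (dtgt _ (θ p w).1 : X.E) N) ((θ p v).1 N)
        + extd ζ ((one G (mom p)).at N) ((θ p v).1 N) ((θ p w).1 N) := by
  obtain ⟨Δ, hΔ, hMC⟩ := hM
  have hext : ∀ v : Tan p, ∃ (α : ∀ x, G.A x) (Y : ∀ p : P.Pt, Tan p), PfGroupoid.IsSection α ∧
      Tower.IsVectorField (fun p => (Y p : Vec p)) ∧ Y p = v ∧ ∀ q, θ q (Y q) = α (mom q) := by
    intro v
    obtain ⟨α, hα, hαp, -⟩ := PfGroupoid.exists_section 0 (θ p v)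
    obtain ⟨V, hV, hVk, hVp⟩ := (isComplement_ker hθ hR).exists_vectorField (hR.sub_mem_ker v)
    refine ⟨α, fun q => ⟨V q + infAct q (α (mom q)), add_mem (hV.1 q) (infAct_mem_Tan q _)⟩, hα,
      hV.add (infAct_isVectorField hα), Subtype.ext ?_, fun q => ?_⟩
    · change V p + infAct p (α (mom p)) = v.1
      rw [hVp, hαp, sub_add_cancel]
    · obtain ⟨h1, h2⟩ := mem_ker_iff.mp (hVk q)
      have h3 : θ q (⟨V q, h1⟩ + ⟨infAct q (α (mom q)), infAct_mem_Tan q _⟩) = α (mom q) := by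
        rw [map_add, h2, hR.eq, zero_add]
      exact h3
  obtain ⟨α, Y, hα, hY, hYp, hYα⟩ := hext v
  obtain ⟨β, Z, hβ, hZ, hZp, hZβ⟩ := hext w
  have hαp : α (mom p) = θ p v := by rw [← hYα, hYp]
  have hβp : β (mom p) = θ p w := by rw [← hZβ, hZp]
  obtain ⟨V, hV, hVp⟩ := Mfd.exists_vectorField (mom p) (dmom p v.1)
  obtain ⟨W, hW, hWp⟩ := Mfd.exists_vectorField (mom p) (dmom p w.1)
  have k0 := hMC Y Z hY hZ p α β hα hβ (hYα p).symm (hZβ p).symm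
  have hfZ : (fun q => θ q (Z q)) = fun q => β (mom q) := funext hZβ
  have hfY : (fun q => θ q (Y q)) = fun q => α (mom q) := funext hYα
  have k1 := hΔ.natural β V hβ hV p v hVp.symm
  have k2 := hΔ.natural α W hα hW p w hWp.symm
  rw [hfZ, hfY, hYp, hZp] at k0
  have k3 : D F (tb (Δ (fun q => β (mom q)) p v).1 k) - D F (tb (Δ (fun q => α (mom q)) p w).1 k)
      - D F (tb (θ p (Tower.lieBracket (fun q => (Y q : Vec q)) (fun q => (Z q : Vec q)) p)).1 k)
      + D F (tb (PfGroupoid.ptBracket C α β (mom p) : Vec (one G (mom p))) k) = 0 := by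
    have h1 := congrArg (fun t : Vec (one G (mom p)) => D F (tb t k)) k0
    refine Eq.trans ?_ (h1.trans (D_zero_vec F _))
    symm
    refine (D_add_vec F _ _ _).trans ?_
    exact congrArg (fun t => t + _) ((D_sub_vec F _ _ _).trans
      (congrArg (fun t => t - _) (D_sub_vec F _ _ _)))
  have k4 := PfGroupoid.D_nabla hC hV hβ hF hζ (mom p)
  have k5 := PfGroupoid.D_nabla hC hW hα hF hζ (mom p)
  have k6 := PfGroupoid.D_ptBracket hC hα hβ hF hζ (mom p)
  rw [k1, k2, k4, k5, k6, hVp, hWp, hαp, hβp] at k3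
  have hanch : ∀ {α : ∀ x, G.A x} {a : G.A (mom p)}, α (mom p) = a →
      PfGroupoid.anchor α (mom p) = (dtgt _ a.1 : X.E) := by
    rintro α a rfl
    rfl
  rw [hanch hαp, hanch hβp] at k3
  have k7 := Tower.extd_eq (T := P.toTower) hY hZ hη.form p
  have hηf : ∀ {Z : ∀ p : P.Pt, Tan p} {β : ∀ x, G.A x}, PfGroupoid.IsSection β →
      (∀ q, θ q (Z q) = β (mom q)) → ∀ v : Tan p,
      deriv (fun q => η (tb (Z q).1 n)) v.1
        = D (fun x => D F (tb (β x).1 k)) ⟨mom p, dmom p v.1⟩ := fun {Z β} hβ h v => by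
    rw [show (fun q => η (tb (Z q).1 n)) = fun q => D F (tb (β (mom q)).1 k) from
      funext fun q => by rw [hη.eq q, h]]
    exact deriv_mom (PfGroupoid.smooth_D_section hβ hF) v.2
  rw [hηf hβ hZβ (Y p), hηf hα hYα (Z p), hη.eq p, hYp, hZp] at k7
  linarith

/-- On kernel vectors every term of the formula for dη contains a zero argument; Cartan's formula
then leaves η([V, W]) = 0 for all `η`. -/
theorem isInvolutive_ker (hC : IsCartan C) {θ : P.PreForm} (hθ : IsForm θ) (hR : Reproduces θ)
    (hM : MaurerCartan C θ) : IsInvolutive (ker θ) := by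
  intro V W hV hW hVk hWk p
  refine mem_ker_iff.mpr ⟨(lieBracket V W p).2, Subtype.ext (tan_ext fun k F hF => ?_)⟩
  obtain ⟨n, N, -, -, hex⟩ := exists_levels hC hθ k
  obtain ⟨η, ζ, hη, hζ⟩ := hex F hF
  obtain ⟨h1, h2⟩ := mem_ker_iff.mp (hVk p)
  obtain ⟨h3, h4⟩ := mem_ker_iff.mp (hWk p)
  have k1 := hM.extd_eq hC hθ hR hF hη hζ ⟨V p, h1⟩ ⟨W p, h3⟩
  rw [h2, h4] at k1
  have k2 := Tower.extd_eq (T := P.toTower) hV hW hη.form p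
  have h5 : ∀ {V : ∀ p : P.Pt, Vec p}, (∀ q, V q ∈ ker θ q) →
      (fun q => η (tb (V q) n)) = fun _ => 0 := fun hV => funext fun q => hη.zero_of_mem_ker (hV q)
  rw [h5 hVk, h5 hWk, deriv_const 0 (hV.1 p), deriv_const 0 (hW.1 p), hη.eq p] at k2
  have h6 : ((0 : G.A (mom p)).1 N) = 0 := rfl
  simp only [h6, extd_zero_right] at k1
  refine Eq.trans ?_ (D_zero_vec F _).symm
  linarith

/-- The bracket of fields killed by dμ is killed by dμ, so the first involutivity condition is a
consequence of the second. -/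
theorem isInvolutive_momKer {D : ∀ p : P.Pt, Submodule ℝ (Vec p)} (hD : IsInvolutive D) :
    IsInvolutive fun p => P.momKer p ⊓ D p := fun V W hV hW hVk hWk p =>
  ⟨⟨(lieBracket V W p).2, dmom_lieBracket hV hW (fun q => (hVk q).1.2) (fun q => (hWk q).1.2) p⟩,
    hD V W hV hW (fun q => (hVk q).2) (fun q => (hWk q).2) p⟩

end PfPrincipalBundle

end

/-! ### Linear differential equations, and curves in the fibres of a submersion. -/

section

open Mfd Tower

/-- The zeros of a solution of a linear differential equation. -/
theorem linear_ode_zero_iff {m : ℕ} {u : ℝ → Fin m → ℝ} {a : Fin m → Fin m → ℝ → ℝ}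
    (ha : ∀ i j, Continuous (a i j))
    (hu : ∀ t i, HasDerivAt (fun t => u t i) (∑ j, a i j t * u t j) t) : u 0 = 0 ↔ u 1 = 0 := by
  let L : ℝ → ((Fin m → ℝ) →L[ℝ] (Fin m → ℝ)) := fun t =>
    ContinuousLinearMap.pi fun i => ∑ j, a i j t • ContinuousLinearMap.proj j
  have hL : ∀ t x i, L t x i = ∑ j, a i j t * x j := fun t x i => by
    simp [L]
  have hcont : Continuous fun t => ∑ i, ∑ j, |a i j t| :=
    continuous_finsetSum _ fun i _ => continuous_finsetSum _ fun j _ => (ha i j).abs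
  -- The interval [-1, 2] contains `0` and `1` in its interior, as uniqueness of solutions, here
  -- against the zero solution, has to be started from either time.
  obtain ⟨K, hK⟩ := (isCompact_Icc (a := (-1 : ℝ)) (b := 2)).bddAbove_image hcont.continuousOn
  have hK' : ∀ t ∈ Icc (-1 : ℝ) 2, ∑ i, ∑ j, |a i j t| ≤ K := fun t ht => hK ⟨t, ht, rfl⟩
  have hlip : ∀ t ∈ Ioo (-1 : ℝ) 2, LipschitzOnWith K.toNNReal (fun x => L t x) univ := by
    intro t ht
    refine (LipschitzWith.of_dist_le_mul fun x y => ?_).lipschitzOnWith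
    have hKt := hK' t (Ioo_subset_Icc_self ht)
    have hK0 : 0 ≤ K := le_trans (Finset.sum_nonneg fun i _ => Finset.sum_nonneg fun j _ => abs_nonneg _) hKt
    rw [Real.coe_toNNReal _ hK0, dist_eq_norm, dist_eq_norm, ← map_sub]
    refine (pi_norm_le_iff_of_nonneg (by positivity)).mpr fun i => ?_
    rw [hL]
    refine (Finset.abs_sum_le_sum_abs _ _).trans (le_trans ?_ (mul_le_mul_of_nonneg_right hKt (norm_nonneg _)))
    refine le_trans ?_ (mul_le_mul_of_nonneg_right (Finset.single_le_sum
      (f := fun i => ∑ j, |a i j t|) (fun i _ => Finset.sum_nonneg fun j _ => abs_nonneg _)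
      (Finset.mem_univ i)) (norm_nonneg _))
    rw [Finset.sum_mul]
    refine Finset.sum_le_sum fun j _ => ?_
    rw [abs_mul]
    exact mul_le_mul_of_nonneg_left (norm_le_pi_norm (x - y) j) (abs_nonneg _)
  have hu' : ∀ t, HasDerivAt u (L t (u t)) t := fun t => hasDerivAt_pi.mpr fun i => by
    rw [hL]
    exact hu t i
  have key : ∀ t₀ ∈ Ioo (-1 : ℝ) 2, u t₀ = 0 → ∀ t ∈ Icc (-1 : ℝ) 2, u t = 0 := by
    intro t₀ ht₀ h0
    refine ODE_solution_unique_of_mem_Icc (v := fun t x => L t x) (s := fun _ => univ)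
      (g := fun _ => 0) hlip ht₀ (fun t _ => (hu' t).continuousAt.continuousWithinAt)
      (fun t _ => hu' t) (fun _ _ => mem_univ _) continuousOn_const (fun t _ => ?_)
      (fun _ _ => mem_univ _) h0
    simpa using hasDerivAt_const t (0 : Fin m → ℝ)
  exact ⟨fun h => key 0 (by norm_num) h 1 (by norm_num), fun h => key 1 (by norm_num) h 0 (by norm_num)⟩

namespace Mfd

variable {M : Mfd.{u}} {N : Mfd.{v}}

/-- Nearby points of a fibre of a submersion are joined by small curves in the fibre. -/
theorem exists_fibre_curve {f : M → N} (hf : Smooth f) {x₀ : M} (hs : Function.Surjective (d f x₀))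
    {W : Set M} (hW : W ∈ nhds x₀) :
    ∀ᶠ y in nhds x₀, f y = f x₀ → ∃ γ : ℝ → M, Fam γ ∧ γ 0 = x₀ ∧ γ 1 = y ∧
      ∀ t, f (γ t) = f x₀ ∧ γ t ∈ W := by
  obtain ⟨U, R, hU, hU0, hR, hR1, hR2⟩ := exists_retraction hf hs
  set ψ := extChartAt (𝓡 M.dim) x₀ with hψ
  have hRx : R (f x₀, x₀) = x₀ := hR2 x₀ hU0
  have hRc : ContinuousAt R (f x₀, x₀) := (hR.continuousOn.continuousAt (hU.mem_nhds hU0))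
  have h1 : ∀ᶠ y in nhds x₀, (f x₀, y) ∈ U ∧ R (f x₀, y) ∈ W := by
    have hc : ContinuousAt (fun y : M => (f x₀, y)) x₀ := by fun_prop
    refine (hc.eventually (hU.mem_nhds hU0)).and ?_
    have h2 : ContinuousAt (fun y : M => R (f x₀, y)) x₀ := ContinuousAt.comp (g := R) hRc hc
    exact h2.eventually (show W ∈ nhds (R (f x₀, x₀)) by rw [hRx]; exact hW)
  have h2 : ∀ᶠ a in nhds (ψ x₀), a ∈ ψ.target ∧ (f x₀, ψ.symm a) ∈ U ∧ R (f x₀, ψ.symm a) ∈ W := by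
    refine Filter.Eventually.and ((isOpen_extChartAt_target (I := 𝓡 M.dim) x₀).mem_nhds
      (mem_extChartAt_target x₀)) ?_
    have h3 := continuousAt_extChartAt_symm (I := 𝓡 M.dim) x₀
    refine h3.eventually (p := fun y => (f x₀, y) ∈ U ∧ R (f x₀, y) ∈ W) ?_
    rw [extChartAt_to_inv x₀]
    exact h1
  obtain ⟨ε, hε, hball⟩ := Metric.eventually_nhds_iff_ball.mp h2
  have h3 : ∀ᶠ y in nhds x₀, y ∈ ψ.source ∧ ψ y ∈ Metric.ball (ψ x₀) ε :=
    Filter.Eventually.and ((isOpen_extChartAt_source (I := 𝓡 M.dim) x₀).mem_nhds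
      (mem_extChartAt_source x₀)) ((continuousAt_extChartAt x₀).eventually (Metric.ball_mem_nhds _ hε))
  filter_upwards [h3, h1] with y hy hyU hfy
  -- The smooth transition has values in [0, 1], so the segment is defined for all times without
  -- leaving the convex ball.
  let l : ℝ → M.E := fun t => ψ x₀ + Real.smoothTransition t • (ψ y - ψ x₀)
  have hl : ∀ t, l t ∈ Metric.ball (ψ x₀) ε := fun t =>
    (convex_ball (ψ x₀) ε).add_smul_sub_mem (Metric.mem_ball_self hε) hy.2
      ⟨Real.smoothTransition.nonneg t, Real.smoothTransition.le_one t⟩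
  have hls : ContDiff ℝ ∞ l := contDiff_const.add (Real.smoothTransition.contDiff.smul contDiff_const)
  refine ⟨fun t => R (f x₀, ψ.symm (l t)), ?_, ?_, ?_, fun t => ⟨hR1 _ (hball _ (hl t)).2.1, (hball _ (hl t)).2.2⟩⟩
  · have h4 : ContMDiff 𝓘(ℝ, ℝ) (𝓡 M.dim) ∞ fun t => ψ.symm (l t) :=
      (contMDiffOn_extChartAt_symm x₀).comp_contMDiff hls.contMDiff fun t => (hball _ (hl t)).1
    exact hR.comp_contMDiff (contMDiff_const.prodMk h4) fun t => (hball _ (hl t)).2.1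
  · have h5 : l 0 = ψ x₀ := by simp [l]
    simp only [h5]
    rw [extChartAt_to_inv x₀, hRx]
  · have h5 : l 1 = ψ y := by simp [l]
    simp only [h5]
    rw [ψ.left_inv hy.1, ← hfy]
    exact hR2 y (by rw [hfy]; exact hyU.1)

end Mfd

end

/-! ### Infinitesimal transport, its finite-level form, and multiplicativity. -/

section

open Mfd Tower

namespace PfPrincipalBundle

open PfGroupoid (src tgt one dsrc dtgt done horAt IsCartan mem_A_iff IsConnForm)

variable {X : Mfd.{u}} {G : PfGroupoid.{u, v} X} {M : Mfd.{w}}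
variable {P : PfPrincipalBundle.{u, v, w, z} G M} {C : ∀ g : G.Arr, Submodule ℝ (Vec g)}

/-- The derivative in the direction `a` of the transport of `b`, in terms of a connection form. -/
def transportDeriv {N : ℕ} (ζ : (G.lev N).arr.TB → ℝ) {x : X} (a : G.A x) : G.A x →ₗ[ℝ] ℝ where
  toFun b := extd ζ ((one G x).at N) ((done G x (dtgt _ b.1 : X.E) - b.1) N) (a.1 N)
  map_add' b c := by
    rw [← extd_add_left]
    refine congrArg (fun t => extd ζ ((one G x).at N) t (a.1 N)) ?_
    have h : done G x (dtgt _ (b + c).1 : X.E)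
        = done G x (dtgt _ b.1 : X.E) + done G x (dtgt _ c.1 : X.E) :=
      (congrArg (done G x) (map_add (dtgt (one G x)) b.1 c.1)).trans (done_add ..)
    rw [h, ← Pi.add_apply]
    exact congrFun (add_sub_add_comm (done G x (dtgt _ b.1 : X.E)) (done G x (dtgt _ c.1 : X.E)) b.1 c.1) N
  map_smul' r b := by
    rw [RingHom.id_apply, smul_eq_mul, ← extd_smul_left]
    refine congrArg (fun t => extd ζ ((one G x).at N) t (a.1 N)) ?_
    have h : done G x (dtgt _ (r • b).1 : X.E) = r • done G x (dtgt _ b.1 : X.E) :=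
      (congrArg (done G x) (map_smul (dtgt (one G x)) r b.1)).trans (done_smul ..)
    rw [h, ← Pi.smul_apply]
    exact congrFun (smul_sub r (done G x (dtgt _ b.1 : X.E)) b.1).symm N

theorem transportDeriv_apply {N : ℕ} (ζ : (G.lev N).arr.TB → ℝ) {x : X} (a b : G.A x) :
    transportDeriv ζ a b = extd ζ ((one G x).at N) (done G x (dtgt _ b.1 : X.E) N) (a.1 N)
      - extd ζ ((one G x).at N) (b.1 N) (a.1 N) := by
  rw [sub_eq_add_neg, ← neg_one_mul, ← extd_smul_left, ← extd_add_left]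
  refine congrArg (fun t => extd ζ ((one G x).at N) t (a.1 N)) ?_
  rw [neg_one_smul, ← sub_eq_add_neg]
  rfl

/-- By `extd_eq_zero` the functional factors through the `k`-th component of `b`, so an expansion
that holds only at this level can be inserted. -/
theorem transportDeriv_eq_sum (hC : IsCartan C) {k : ℕ} {F : (G.lev k).arr → ℝ} (hF : SmoothFn F)
    {N : ℕ} {ζ : (G.lev N).arr.TB → ℝ} (hζ : IsConnForm C F N ζ) {x : X} (a b : G.A x) {m : ℕ}
    (c : Fin m → ℝ) (β : Fin m → G.A x) (h : b.1 k = ∑ j, c j • (β j).1 k) :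
    transportDeriv ζ a b = ∑ j, transportDeriv ζ a (β j) * c j := by
  have h0 : (b - ∑ j, c j • β j).1 k = 0 := by
    have h1 : (∑ j, c j • β j : G.A x).1 = ∑ j, c j • (β j).1 := by simp
    have h2 : (b - ∑ j, c j • β j).1 k = b.1 k - (∑ j, c j • β j : G.A x).1 k := rfl
    rw [h2, h1, Finset.sum_apply, h]
    exact sub_self _
  have h1 : transportDeriv ζ a (b - ∑ j, c j • β j) = 0 := by
    set b' := b - ∑ j, c j • β j
    have h3 : done G x (dtgt _ b'.1 : X.E) N = 0 := by
      rw [PfGroupoid.dtgt_eq_zero h0]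
      exact map_zero (d (G.lev N).one x)
    rw [transportDeriv_apply, h3, extd_zero_left, hζ.extd_eq_zero hC hF a b' h0, sub_zero]
  rw [map_sub, sub_eq_zero, map_sum] at h1
  rw [h1]
  exact Finset.sum_congr rfl fun j _ => by rw [map_smul, smul_eq_mul, mul_comm]

/-- `transportDeriv` at a finite level. -/
def levTransportDeriv {H : LieGroupoid.{u, v} X} (ζ : H.arr.TB → ℝ) (a b : H.arr.TB) : ℝ :=
  extd ζ (tsub (TM H.one (TM H.tgt b)) b).1 (tsub (TM H.one (TM H.tgt b)) b).2 a.2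

theorem transportDeriv_eq {N : ℕ} (ζ : (G.lev N).arr.TB → ℝ) {x : X} (a b : G.A x) :
    transportDeriv ζ a b = levTransportDeriv ζ (tb a.1 N) (tb b.1 N) := by
  have h : TM (G.lev N).one (TM (G.lev N).tgt (tb b.1 N)) = tb (done G x (dtgt _ b.1 : X.E)) N := by
    rw [PfGroupoid.TM_tgt b.2.1]
    exact congrArg (TM (G.lev N).one) (TB_ext (u := (⟨tgt (one G x), dtgt _ b.1⟩ : X.TB))
      (u' := (⟨x, (dtgt _ b.1 : X.E)⟩ : X.TB)) (PfGroupoid.tgt_one x) rfl)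
  rw [levTransportDeriv, h]
  rfl

theorem contMDiff_levTransportDeriv {H : LieGroupoid.{u, v} X} {ζ : H.arr.TB → ℝ} (hζ : IsOneForm ζ)
    {EK : Type*} [NormedAddCommGroup EK]
    [NormedSpace ℝ EK] {HK : Type*} [TopologicalSpace HK] {I : ModelWithCorners ℝ EK HK} {K : Type*}
    [TopologicalSpace K] [ChartedSpace HK K] {a b : K → H.arr.TB} {x : K → X}
    (ha : ContMDiff I (𝓡 H.arr.dim).tangent ∞ a) (hb : ContMDiff I (𝓡 H.arr.dim).tangent ∞ b)
    (hax : ∀ k, (a k).1 = H.one (x k)) (hbx : ∀ k, (b k).1 = H.one (x k)) :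
    ContMDiff I 𝓘(ℝ, ℝ) ∞ fun k => levTransportDeriv ζ (a k) (b k) := by
  have h : ∀ k, (TM H.one (TM H.tgt (b k))).1 = H.one (x k) := fun k => by
    change H.one (H.tgt (b k).1) = _
    rw [hbx, H.tgt_one]
  exact contMDiff_extd hζ (contMDiff_tsub (H.one_smooth.TM.comp (H.tgt_subm.smooth.TM.comp hb)) hb
    fun k => (h k).trans (hbx k).symm) ha fun k => (h k).trans (hax k).symm

/-- Coordinates and a spanning family of sections for the `k`-th component of `A`. -/
theorem exists_local_frame (G : PfGroupoid.{u, v} X) (k : ℕ) (x₀ : X) :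
    ∃ (m : ℕ) (Φ : Fin m → (G.lev k).arr → ℝ) (β : Fin m → ∀ x, G.A x), (∀ j, SmoothFn (Φ j)) ∧
      (∀ j, PfGroupoid.IsSection (β j)) ∧ ∀ᶠ x in nhds x₀, ∀ b : G.A x,
        b.1 k = ∑ j, D (Φ j) (tb b.1 k) • (β j x).1 k := by
  obtain ⟨Φ, V, hΦ, hV, hc⟩ := exists_coords ((G.lev k).one x₀)
  have hV1 : ∀ j, ContMDiff (𝓡 X.dim) (𝓡 (G.lev k).arr.dim).tangent ∞
      fun x => (⟨(G.lev k).one x, V j ((G.lev k).one x)⟩ : (G.lev k).arr.TB) := fun j =>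
    ContMDiff.comp (hV j) (G.lev k).one_smooth
  have hex : ∀ j, ∃ β : ∀ x, G.A x, PfGroupoid.IsSection β ∧ ∀ x, (β x).1 k
      = ((PfGroupoid.srcVert (G.lev k) ⟨(G.lev k).one x, V j ((G.lev k).one x)⟩).2 : (G.lev k).arr.E) := by
    intro j
    have hs : ∀ x, TM (G.lev k).src (PfGroupoid.srcVert (G.lev k)
        ⟨(G.lev k).one x, V j ((G.lev k).one x)⟩) = zt x := fun x =>
      PfGroupoid.TM_src_srcVert (H := G.lev k) (a := ⟨(G.lev k).one x, V j ((G.lev k).one x)⟩) rfl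
    obtain ⟨a, ha, hak⟩ := exists_tan (one G x₀) k
      (PfGroupoid.srcVert (G.lev k) ⟨(G.lev k).one x₀, V j ((G.lev k).one x₀)⟩).2
    obtain ⟨β, h1, h2, -⟩ := PfGroupoid.exists_section_of k
      (fun x => (PfGroupoid.srcVert (G.lev k) ⟨(G.lev k).one x, V j ((G.lev k).one x)⟩).2)
      (PfGroupoid.contMDiff_srcVert (hV1 j) (x := id) fun _ => rfl) hs x₀
      ⟨a, (mem_A_iff k).mpr ⟨ha, (congrArg (TM (G.lev k).src) (TB_ext (u := tb a k)
        (u' := PfGroupoid.srcVert (G.lev k) ⟨(G.lev k).one x₀, V j ((G.lev k).one x₀)⟩)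
        rfl hak)).trans (hs x₀)⟩⟩ hak
    exact ⟨β, h1, h2⟩
  choose β hβ hβk using hex
  refine ⟨_, Φ, β, hΦ, hβ, ?_⟩
  filter_upwards [(G.lev k).one_smooth.continuous.continuousAt.eventually hc] with x hx b
  -- `L` is the identity minus the differential of 1 ∘ s, a projection to ker(ds). It takes the
  -- coordinate fields to the sections `β` and fixes elements of `A`, so these sections span.
  let L : (G.lev k).arr.E →L[ℝ] (G.lev k).arr.E := ContinuousLinearMap.id ℝ _
    - (d (G.lev k).one ((G.lev k).src ((G.lev k).one x)) : X.E →L[ℝ] (G.lev k).arr.E).comp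
      (d (G.lev k).src ((G.lev k).one x) : (G.lev k).arr.E →L[ℝ] X.E)
  have hL : ∀ v : (G.lev k).arr.T ((G.lev k).one x),
      L v = ((PfGroupoid.srcVert (G.lev k) ⟨(G.lev k).one x, v⟩).2 : (G.lev k).arr.E) := fun v => rfl
  have h1 : L (b.1 k) = b.1 k :=
    (hL (b.1 k)).trans (snd_eq_of_TB_eq (PfGroupoid.srcVert_eq ((mem_A_iff k).mp b.2).2))
  have h2 : (b.1 k : (G.lev k).arr.E) = ∑ j, D (Φ j) (tb b.1 k) • (V j ((G.lev k).one x) : (G.lev k).arr.E) :=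
    hx (b.1 k)
  have hsum : ∀ (c : Fin (G.lev k).arr.dim → ℝ) (v : Fin (G.lev k).arr.dim → (G.lev k).arr.E),
      L (∑ j, c j • v j) = ∑ j, c j • L (v j) := fun c v => by simp_rw [map_sum, map_smul]
  refine h1.symm.trans ((congrArg L h2).trans ((hsum _ _).trans ?_))
  refine Finset.sum_congr rfl fun j _ => ?_
  exact congrArg (fun t : (G.lev k).arr.E => D (Φ j) (tb b.1 k) • t) ((hL _).trans (hβk j x).symm)

/-- A horizontal lift at level `n` is a function of the arrow at level `N`, by means of `Q`; any
arrow of the limit over a given one of level `N` may then represent it. -/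
theorem tb_horAt_congr (hC : IsCartan C) {n N : ℕ} {Q : (G.lev N).arr.TB → (G.lev n).arr.TB}
    (hQC : ∀ (g : G.Arr) (v : Vec g), v ∈ Tan g → Q (tb v N) = tb (horAt C g (dsrc g v)) n)
    {g g' : G.Arr} (h : g.at N = g'.at N) {V : X.T (src g)} {V' : X.T (src g')} (hV : (V : X.E) = V') :
    tb (horAt C g V) n = tb (horAt C g' V') n := by
  obtain ⟨v, hv, hvN⟩ := exists_tan g' N (horAt C g V N : (G.lev N).arr.E)
  have h1 : tb v N = tb (horAt C g V) N := TB_ext h.symm hvN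
  have h2 := congrArg (TM (G.lev N).src) h1
  rw [PfGroupoid.TM_src hv, PfGroupoid.TM_src (hC.horAt_mem_Tan g V), hC.dsrc_horAt] at h2
  have h3 := hQC g _ (hC.horAt_mem_Tan g V)
  rw [hC.dsrc_horAt, ← h1, hQC g' v hv] at h3
  rw [← h3]
  exact congrArg (fun t : X.T (src g') => tb (horAt C g' t) n) ((snd_eq_of_TB_eq h2).trans hV)

/-- The product lies in `C` by multiplicativity, and an element of `C` is determined by its image
under ds. -/
theorem horAt_mul (hC : IsCartan C) {g h : G.Arr} (c : src g = tgt h) (V : X.T (src h)) :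
    horAt C (PfGroupoid.mul g h c) ((V : X.E))
      = PfGroupoid.dmul g h c (horAt C g (dtgt h (horAt C h V) : X.E)) (horAt C h V) := by
  have e : (dsrc g (horAt C g (dtgt h (horAt C h V) : X.E)) : X.E) = dtgt h (horAt C h V) :=
    hC.dsrc_horAt g _
  refine hC.eq_of_dsrc_eq (hC.horAt_mem _ _) (hC.dmul_mem g h c _ (hC.horAt_mem g _) _
    (hC.horAt_mem h _) e) ((hC.dsrc_horAt _ _).trans ?_)
  have h1 := PfGroupoid.TM_src (PfGroupoid.dmul_mem_Tan c (hC.horAt_mem_Tan g _) (hC.horAt_mem_Tan h V) e) 0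
  rw [PfGroupoid.tb_dmul, LieGroupoid.Tm_src (PfGroupoid.comp_at c (hC.horAt_mem_Tan g _)
    (hC.horAt_mem_Tan h V) e 0), PfGroupoid.TM_src (hC.horAt_mem_Tan h V), hC.dsrc_horAt] at h1
  exact snd_eq_of_TB_eq h1

/-- Transport along `C` is an action because `C` is multiplicative. This moves the derivative of
transport from an arbitrary arrow to a unit. -/
theorem tb_dact_horAt_mul (hC : IsCartan C) {p : P.Pt} {w : Vec p} (hw : w ∈ Tan p) {g h : G.Arr}
    (c : src g = tgt h) (c₁ : src h = mom p) (c₂ : src g = mom (act h p c₁))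
    (c₃ : src (PfGroupoid.mul g h c) = mom p) {y : Vec (act h p c₁)}
    (hy : y = dact h p c₁ (horAt C h (dmom p w : X.E)) w) (n : ℕ) :
    tb (dact g (act h p c₁) c₂ (horAt C g (dmom _ y : X.E)) y) n
      = tb (dact (PfGroupoid.mul g h c) p c₃ (horAt C (PfGroupoid.mul g h c) (dmom p w : X.E)) w) n := by
  have hh := hC.horAt_mem_Tan h (dmom p w : X.E)
  have e₁ : (dsrc h (horAt C h (dmom p w : X.E)) : X.E) = dmom p w := hC.dsrc_horAt h _
  have h1 : (dmom _ y : X.E) = dtgt h (horAt C h (dmom p w : X.E)) := by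
    rw [hy]
    exact dmom_dact c₁ hh hw e₁
  have h2 := horAt_mul hC c (dmom p w : X.E)
  have h3 : horAt C g (dmom _ y : X.E) = horAt C g (dtgt h (horAt C h (dmom p w : X.E)) : X.E) :=
    congrArg (fun t : X.E => horAt C g t) h1
  rw [h2, h3, hy, tb_dact, tb_dact, tb_dact, PfGroupoid.tb_dmul]
  exact (PrincipalBundle.Ta_mul (PfGroupoid.comp_at c (hC.horAt_mem_Tan g _) hh (hC.dsrc_horAt g _) n)
    (comp_at c₁ hh hw e₁ n)).symm

end PfPrincipalBundle

end

/-! ### Invariance of the kernel along connected s-fibres, and the theorem. -/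

section

open Mfd Tower

namespace PfPrincipalBundle

open PfGroupoid (src tgt one dsrc dtgt done horAt IsCartan mem_A_iff IsConnForm)

variable {X : Mfd.{u}} {G : PfGroupoid.{u, v} X} {M : Mfd.{w}}
variable {P : PfPrincipalBundle.{u, v, w, z} G M} {C : ∀ g : G.Arr, Submodule ℝ (Vec g)}

/-- The action of the vector of `C` at `g` that is composable with `w`. -/
def horAct (hC : IsCartan C) {p : P.Pt} (w : Tan p) (g : G.Arr) (e : src g = mom p) : Tan (act g p e) :=
  ⟨dact g p e (horAt C g (dmom p w.1 : X.E)) w.1,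
    dact_mem_Tan e (hC.horAt_mem_Tan g _) w.2 (hC.dsrc_horAt g _)⟩

/-- Transport by `g (t₀ + t)` is transport by c(t) = γ(t₀ + t) γ(t₀)⁻¹ after transport by `g t₀`,
and `c` starts at a unit, so `hasDerivAt_dact` applies at the transported point. The Maurer-Cartan
formula for dη(y, a(α)) cancels the term with dμ(y); what is left is linear in θ(y). -/
theorem hasDerivAt_transport (hC : IsCartan C) {θ : P.PreForm} (hθ : IsForm θ) (hR : Reproduces θ)
    (hM : MaurerCartan C θ) {k : ℕ} {F : (G.lev k).arr → ℝ} (hF : SmoothFn F) {n N : ℕ} (hnN : n ≤ N)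
    {η : (P.lev n).tot.TB → ℝ} (hη : IsScalarForm θ F n η) {ζ : (G.lev N).arr.TB → ℝ}
    (hζ : IsConnForm C F N ζ) {Q : (G.lev N).arr.TB → (G.lev n).arr.TB}
    (hQ : ContMDiff (𝓡 (G.lev N).arr.dim).tangent (𝓡 (G.lev n).arr.dim).tangent ∞ Q)
    (hQC : ∀ (g : G.Arr) (v : Vec g), v ∈ Tan g → Q (tb v N) = tb (horAt C g (dsrc g v)) n)
    {p : P.Pt} (w : Tan p) {γ : ℝ → (G.lev N).arr} (hγ : Fam γ) (g : ℝ → G.Arr)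
    (hg : ∀ t, (g t).at N = γ t) (e : ∀ t, src (g t) = mom p) (t₀ : ℝ)
    (α : G.A (mom (act (g t₀) p (e t₀))))
    (hα : tb α.1 N = (G.lev N).Tm (dir γ t₀ 1) (zt ((G.lev N).inv (γ t₀)))) :
    HasDerivAt (fun t => D F (tb (θ _ (horAct hC w (g t) (e t))).1 k))
      (transportDeriv ζ α (θ _ (horAct hC w (g t₀) (e t₀)))) t₀ := by
  set u : ℝ → ℝ := fun t => D F (tb (θ _ (horAct hC w (g t) (e t))).1 k) with hu
  set y := horAct hC w (g t₀) (e t₀) with hydef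
  have hsγ : ∀ t, (G.lev N).src (γ t) = mom p := fun t => by
    rw [← hg, PfGroupoid.src_at, e]
  have hcomp : ∀ t, (G.lev N).src (γ (t₀ + t)) = (G.lev N).tgt ((G.lev N).inv (γ t₀)) := fun t => by
    rw [(G.lev N).tgt_inv, hsγ, hsγ]
  let c : ℝ → (G.lev N).arr := fun t => (G.lev N).mul (γ (t₀ + t)) ((G.lev N).inv (γ t₀))
  have hγ' : Fam fun t => γ (t₀ + t) := hγ.comp_left (contDiff_const.add contDiff_id)
  have hc : Fam c := LieGroupoid.fam_mul hγ' (fam_const _) hcomp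
  have hcs : ∀ t, (G.lev N).src (c t) = mom (act (g t₀) p (e t₀)) := fun t => by
    rw [(G.lev N).src_mul _ _ (hcomp t), (G.lev N).src_inv, mom_act, ← hg, PfGroupoid.tgt_at]
  have hcb : dir c 0 1 = tb α.1 N := by
    have h1 : HasFDerivAt (fun t : ℝ => t₀ + t) (ContinuousLinearMap.id ℝ ℝ) 0 :=
      (hasFDerivAt_id (0 : ℝ)).const_add t₀
    have h2 := dir_comp hγ h1.differentiableAt 1
    rw [h1.fderiv, add_zero] at h2
    rw [hα]
    refine (LieGroupoid.dir_mul hγ' (fam_const _) hcomp 0 1).trans ?_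
    exact congrArg₂ (G.lev N).Tm h2 (dir_const _ _ _)
  have hh : ∀ (t : ℝ) (g₁ : G.Arr) (e₁ : src g₁ = mom (act (g t₀) p (e t₀))), g₁.at N = c t →
      u (t₀ + t) = η (tb (dact g₁ (act (g t₀) p (e t₀)) e₁ (horAt C g₁ (dmom _ y.1 : X.E)) y.1) n) := by
    intro t g₁ e₁ h₁
    have c₀ : src g₁ = tgt (g t₀) := e₁.trans (mom_act (e t₀))
    have c₃ : src (PfGroupoid.mul g₁ (g t₀) c₀) = mom p :=
      ((G.lev 0).src_mul _ _ c₀).trans (e t₀)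
    have h2 : (PfGroupoid.mul g₁ (g t₀) c₀).at N = (g (t₀ + t)).at N := by
      change (G.lev N).mul (g₁.at N) ((g t₀).at N) = _
      rw [h₁, hg, hg]
      change (G.lev N).mul ((G.lev N).mul _ _) _ = _
      rw [(G.lev N).mul_assoc _ _ _ (hcomp t) ((G.lev N).src_inv _), (G.lev N).inv_mul, hsγ,
        ← hsγ (t₀ + t), (G.lev N).mul_one]
    refine Eq.trans ?_ (congrArg η (tb_dact_horAt_mul hC w.2 c₀ (e t₀) e₁ c₃ rfl n)).symm
    refine Eq.trans ?_ (congrArg (fun a => η ((P.lev n).Ta a (tb w.1 n)))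
      (tb_horAt_congr hC hQC h2 (V := (dmom p w.1 : X.E)) (V' := (dmom p w.1 : X.E)) rfl)).symm
    exact (hη.eq _ (horAct hC w (g (t₀ + t)) (e (t₀ + t)))).symm
  have h1 := hη.hasDerivAt_dact hC hR hnN hζ hQ hQC y.2 0 α hc hcs hcb (h := fun t => u (t₀ + t)) hh
  have h2 := hM.extd_eq hC hθ hR hF hη hζ y ⟨infAct _ α, infAct_mem_Tan _ α⟩
  have h3 : done G (mom (act (g t₀) p (e t₀))) (dmom _ (infAct (act (g t₀) p (e t₀)) α))
      = done G (mom (act (g t₀) p (e t₀))) (dtgt _ α.1 : X.E) := congrArg (done G _) (dmom_infAct _ α)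
  have h4 : done G (mom (act (g t₀) p (e t₀))) (dmom _ y.1)
      + (0 : G.A (mom (act (g t₀) p (e t₀)))).1 = done G _ (dmom _ y.1) := add_zero _
  rw [hR.eq, h3] at h2
  rw [infAct_zero, add_zero, h4] at h1
  have h5 : HasDerivAt (fun t => u (t₀ + t)) (transportDeriv ζ α (θ _ y)) (t₀ - t₀) := by
    rw [sub_self]
    convert h1 using 1
    rw [transportDeriv_apply]
    linarith
  have h6 := h5.comp_sub_const t₀ t₀
  simp only [add_sub_cancel] at h6
  exact h6

theorem exists_A_of_tb {x : X} {N : ℕ} {a : (G.lev N).arr.TB} (h : a.1 = (G.lev N).one x)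
    (hs : TM (G.lev N).src a = zt x) : ∃ α : G.A x, tb α.1 N = a := by
  obtain ⟨b, a⟩ := a
  obtain rfl : b = (G.lev N).one x := h
  obtain ⟨v, hv, rfl⟩ := exists_tan (one G x) N a
  exact ⟨⟨v, (mem_A_iff N).mpr ⟨hv, hs⟩⟩, rfl⟩

/-- The vanishing of the `k`-th component of `θ` is locally constant along the action of `C`. -/
theorem eventually_form_eq_zero_iff (hC : IsCartan C) {θ : P.PreForm} (hθ : IsForm θ)
    (hR : Reproduces θ) (hM : MaurerCartan C θ) {k n N : ℕ} (hnN : n ≤ N)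
    {Q : (G.lev N).arr.TB → (G.lev n).arr.TB}
    (hQ : ContMDiff (𝓡 (G.lev N).arr.dim).tangent (𝓡 (G.lev n).arr.dim).tangent ∞ Q)
    (hQC : ∀ (g : G.Arr) (v : Vec g), v ∈ Tan g → Q (tb v N) = tb (horAt C g (dsrc g v)) n)
    (hex : ∀ F : (G.lev k).arr → ℝ, SmoothFn F → ∃ η ζ, IsScalarForm θ F n η ∧ IsConnForm C F N ζ)
    {p : P.Pt} (w : Tan p) {g₀ : (G.lev N).arr} (hg₀ : (G.lev N).src g₀ = mom p) :
    ∀ᶠ g in nhds g₀, (G.lev N).src g = mom p → ∀ (a b : G.Arr) (ea : src a = mom p)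
      (eb : src b = mom p), a.at N = g₀ → b.at N = g →
        ((θ _ (horAct hC w a ea)).1 k = 0 ↔ (θ _ (horAct hC w b eb)).1 k = 0) := by
  obtain ⟨m, Φ, β, hΦ, hβ, hfr⟩ := exists_local_frame G k ((G.lev N).tgt g₀)
  have hW := (G.lev N).tgt_subm.smooth.continuous.continuousAt.eventually hfr
  filter_upwards [exists_fibre_curve (G.lev N).src_subm.smooth ((G.lev N).src_subm.submersion g₀) hW]
    with g hg hgs a b ea eb ha hb
  obtain ⟨γ, hγ, hγ0, hγ1, hγt⟩ := hg (hgs.trans hg₀.symm)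
  -- The lifts to the limit are chosen time by time without continuity, since the quantities below
  -- depend on the arrow at level `N` only. At times `0` and `1` they are the given `a` and `b`.
  have hlift : ∀ t, ∃ l : G.Arr, l.at N = γ t ∧ (t = 0 → l = a) ∧ (t = 1 → l = b) := fun t => by
    by_cases h0 : t = 0
    · subst h0
      exact ⟨a, ha.trans hγ0.symm, fun _ => rfl, fun h => absurd h zero_ne_one⟩
    by_cases h1 : t = 1
    · subst h1
      exact ⟨b, hb.trans hγ1.symm, fun h => absurd h one_ne_zero, fun _ => rfl⟩
    obtain ⟨l, hl⟩ := G.toTower.exists_pt N (γ t)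
    exact ⟨l, hl, fun h => absurd h h0, fun h => absurd h h1⟩
  choose l hl hl0 hl1 using hlift
  have hsγ : ∀ t, (G.lev N).src (γ t) = mom p := fun t => (hγt t).1.trans hg₀
  have e : ∀ t, src (l t) = mom p := fun t => by
    rw [← PfGroupoid.src_at _ N, hl, hsγ]
  have hx : ∀ t, mom (act (l t) p (e t)) = (G.lev N).tgt (γ t) := fun t => by
    rw [mom_act, ← hl, PfGroupoid.tgt_at]
  let A : ℝ → (G.lev N).arr.TB := fun t => (G.lev N).Tm (dir γ t 1) (zt ((G.lev N).inv (γ t)))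
  have hsrc : ∀ t, TM (G.lev N).src (dir γ t 1)
      = TM (G.lev N).tgt (zt ((G.lev N).inv (γ t))) := fun t => by
    rw [TM_dir (G.lev N).src_subm.smooth hγ, TM_zt, (G.lev N).tgt_inv, hsγ,
      show (G.lev N).src ∘ γ = fun _ => mom p from funext hsγ, dir_const]
    rfl
  have hA : ContMDiff 𝓘(ℝ, ℝ) (𝓡 (G.lev N).arr.dim).tangent ∞ A :=
    LieGroupoid.contMDiff_Tm (hγ.dir 1) (contMDiff_zt ((G.lev N).inv_smooth.comp hγ)) hsrc
  have hA1 : ∀ t, (A t).1 = (G.lev N).one ((G.lev N).tgt (γ t)) := fun t => (G.lev N).mul_inv (γ t)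
  have hAs : ∀ t, TM (G.lev N).src (A t) = zt ((G.lev N).tgt (γ t)) := fun t => by
    rw [LieGroupoid.Tm_src (hsrc t), TM_zt, (G.lev N).src_inv]
  have hα : ∀ t, ∃ α : G.A (mom (act (l t) p (e t))), tb α.1 N = A t := fun t =>
    exists_A_of_tb ((hA1 t).trans (congrArg _ (hx t).symm)) ((hAs t).trans (congrArg zt (hx t).symm))
  choose α hα using hα
  choose η ζ hη hζ using fun i => hex (Φ i) (hΦ i)
  let u : ℝ → Fin m → ℝ := fun t i => D (Φ i) (tb (θ _ (horAct hC w (l t) (e t))).1 k)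
  have hfr' : ∀ t, (θ _ (horAct hC w (l t) (e t))).1 k
      = ∑ j, u t j • (β j (mom (act (l t) p (e t)))).1 k := fun t => by
    have h1 := (hγt t).2
    have h2 : ∀ b : G.A (mom (act (l t) p (e t))),
        b.1 k = ∑ j, D (Φ j) (tb b.1 k) • (β j (mom (act (l t) p (e t)))).1 k := by
      rw [hx t]
      exact h1
    exact h2 _
  -- The unknowns are the coordinates of the `k`-th component of `θ` on the transported vector. The
  -- coefficients are values of `transportDeriv` on the frame, continuous because they are computed
  -- at level `N`.
  have key := linear_ode_zero_iff (u := u)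
    (a := fun i j t => transportDeriv (ζ i) (α t) (β j (mom (act (l t) p (e t)))))
    (fun i j => by
      have h1 : (fun t => transportDeriv (ζ i) (α t) (β j (mom (act (l t) p (e t)))))
          = fun t => levTransportDeriv (ζ i) (A t) (tb (β j ((G.lev N).tgt (γ t))).1 N) := funext fun t => by
        rw [transportDeriv_eq, hα, hx t]
      rw [h1]
      exact (contMDiff_levTransportDeriv (hζ i).form hA
        ((hβ j N).comp ((G.lev N).tgt_subm.smooth.comp hγ)) hA1 fun t => rfl).continuous)
    fun t i => by
      have h1 := hasDerivAt_transport hC hθ hR hM (hΦ i) hnN (hη i) (hζ i) hQ hQC w hγ l hl e t (α t) (hα t)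
      rw [transportDeriv_eq_sum hC (hΦ i) (hζ i) (α t) _ (u t) (fun j => β j _) (hfr' t)] at h1
      exact h1
  have hz : ∀ t, u t = 0 ↔ (θ _ (horAct hC w (l t) (e t))).1 k = 0 := fun t => by
    constructor
    · intro h
      rw [hfr' t, h]
      simp
    · intro h
      funext i
      change D (Φ i) ⟨_, (θ _ (horAct hC w (l t) (e t))).1 k⟩ = 0
      rw [h]
      exact D_zero_vec _ _
  rw [hz, hz] at key
  have hc : ∀ {g g' : G.Arr} (e : src g = mom p) (e' : src g' = mom p), g = g' →
      ((θ _ (horAct hC w g e)).1 k = 0 ↔ (θ _ (horAct hC w g' e')).1 k = 0) := by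
    rintro g g' e e' rfl
    rfl
  exact (hc ea (e 0) (hl0 0 rfl).symm).trans (key.trans (hc (e 1) eb (hl1 1 rfl)))

/-- At a unit the vector of `C` over dμ(w) is tangent to the units, so it acts trivially on `w`. -/
theorem horAct_one_mem_ker (hC : IsCartan C) {θ : P.PreForm} {p : P.Pt} {w : Vec p} (hw : w ∈ ker θ p) :
    dact (one G (mom p)) p (PfGroupoid.src_one _) (horAt C (one G (mom p)) (dmom p w : X.E)) w
      ∈ ker θ (act (one G (mom p)) p (PfGroupoid.src_one _)) := by
  have hwT := (mem_ker_iff.mp hw).1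
  refine mem_of_tb_eq (fun k => ?_) hw
  have h1 : horAt C (one G (mom p)) (dmom p w : X.E) = done G (mom p) (dmom p w) := by
    refine Eq.trans ?_ (hC.horAt_eq (hC.done_mem _ (dmom p w)))
    exact congrArg (fun t : X.E => horAt C (one G (mom p)) t) (PfGroupoid.dsrc_done _ _).symm
  rw [h1, tb_dact, PfGroupoid.tb_done, ← TM_mom hwT k]
  exact (PrincipalBundle.Ta_one _).symm

/-- For each `k`, the vanishing of the `k`-th component is locally constant on the s-fibre of a
single level `N`, which is connected, and it holds at the unit. -/
theorem dact_mem_ker (hC : IsCartan C)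
    (hconn : ∀ (k : ℕ) (x : X), IsConnected ((G.lev k).src ⁻¹' {x}))
    {θ : P.PreForm} (hθ : IsForm θ) (hR : Reproduces θ) (hM : MaurerCartan C θ)
    (g : G.Arr) (p : P.Pt) (c : src g = mom p) (v : Vec g) (hv : v ∈ C g) (w : Vec p)
    (hw : w ∈ ker θ p) (e : (dsrc g v : X.E) = dmom p w) :
    dact g p c v w ∈ ker θ (act g p c) := by
  have hwT := (mem_ker_iff.mp hw).1
  obtain rfl : horAt C g (dmom p w : X.E) = v :=
    (congrArg (fun t : X.E => horAt C g t) e).symm.trans (hC.horAt_eq hv)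
  refine mem_ker_iff.mpr ⟨(horAct hC ⟨w, hwT⟩ g c).2, Subtype.ext (funext fun k => ?_)⟩
  change (θ _ (horAct hC ⟨w, hwT⟩ g c)).1 k = 0
  obtain ⟨n, N, hnN, ⟨Q, hQ, hQC⟩, hex⟩ := exists_levels hC hθ k
  let S : Set (G.lev N).arr := (G.lev N).src ⁻¹' {mom p}
  let f : S → Prop := fun s => ∀ (a : G.Arr) (ea : src a = mom p), a.at N = s.1 →
    (θ _ (horAct hC ⟨w, hwT⟩ a ea)).1 k = 0
  have hev := fun (s : S) =>
    eventually_form_eq_zero_iff hC hθ hR hM hnN hQ hQC hex ⟨w, hwT⟩ (show (G.lev N).src s.1 = mom p from s.2)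
  have hsrc : ∀ {s : S} {a : G.Arr}, a.at N = s.1 → src a = mom p := fun {s a} h => by
    rw [← PfGroupoid.src_at a N, h]
    exact s.2
  -- The local statement with both arrows over the same point of level `N` says that vanishing does
  -- not depend on the chosen lift.
  have hiff : ∀ {s : S} {a : G.Arr} (ea : src a = mom p), a.at N = s.1 →
      (f s ↔ (θ _ (horAct hC ⟨w, hwT⟩ a ea)).1 k = 0) := fun {s a} ea ha =>
    ⟨fun h => h a ea ha, fun h b eb hb => ((hev s).self_of_nhds s.2 a b ea eb ha hb).mp h⟩
  have hloc : IsLocallyConstant f := (IsLocallyConstant.iff_eventually_eq f).mpr fun s => by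
    filter_upwards [continuous_subtype_val.continuousAt.eventually (hev s)] with s' hs'
    obtain ⟨a, ha⟩ := G.toTower.exists_pt N s.1
    obtain ⟨b, hb⟩ := G.toTower.exists_pt N s'.1
    rw [hiff (hsrc ha) ha, hiff (hsrc hb) hb]
    exact propext (hs' s'.2 a b _ _ ha hb).symm
  have : PreconnectedSpace S := Subtype.preconnectedSpace (hconn N (mom p)).isPreconnected
  have hgS : (G.lev N).src (g.at N) = mom p := (PfGroupoid.src_at g N).trans c
  have h1 := hloc.apply_eq_of_preconnectedSpace ⟨g.at N, hgS⟩ ⟨(one G (mom p)).at N, (G.lev N).src_one _⟩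
  rw [hiff c rfl, hiff (PfGroupoid.src_one _) rfl] at h1
  rw [h1]
  obtain ⟨_, h2⟩ := mem_ker_iff.mp (horAct_one_mem_ker hC hw)
  exact congrFun (congrArg Subtype.val h2) k

theorem isFlatStructure_ker (hC : IsCartan C)
    (hconn : ∀ (k : ℕ) (x : X), IsConnected ((G.lev k).src ⁻¹' {x}))
    {θ : P.PreForm} (hθ : IsForm θ) (hR : Reproduces θ) (hM : MaurerCartan C θ) :
    IsFlatStructure C (ker θ) where
  ehresmann := isComplement_ker hθ hR
  dact_mem := dact_mem_ker hC hconn hθ hR hM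
  momKer_involutive := isInvolutive_momKer (isInvolutive_ker hC hθ hR hM)
  flat := isInvolutive_ker hC hθ hR hM

end PfPrincipalBundle

end

end

theorem mainTheorem8 {X : Mfd.{u}} {M : Mfd.{w}} (G : PfGroupoid.{u, v} X)
    (C : ∀ g : G.Arr, Submodule ℝ (Tower.Vec g)) (hC : PfGroupoid.IsCartan C)
    (P : PfPrincipalBundle.{u, v, w, z} G M) :
    (∀ D : ∀ p : P.Pt, Submodule ℝ (Tower.Vec p), PfPrincipalBundle.IsFlatStructure C D →
      ∃ θ : P.PreForm, PfPrincipalBundle.IsForm θ ∧ (∀ p, D p = PfPrincipalBundle.ker θ p) ∧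
        PfPrincipalBundle.Reproduces θ ∧ PfPrincipalBundle.MaurerCartan C θ) ∧
    ((∀ (k : ℕ) (x : X), IsConnected ((G.lev k).src ⁻¹' {x})) →
      Set.BijOn (fun θ : P.PreForm => PfPrincipalBundle.ker θ)
        {θ | PfPrincipalBundle.IsForm θ ∧ PfPrincipalBundle.Reproduces θ ∧
          PfPrincipalBundle.MaurerCartan C θ}
        {D | PfPrincipalBundle.IsFlatStructure C D}) := by
  refine ⟨fun D hD => ?_, fun hconn => ⟨fun θ hθ => ?_, fun θ hθ θ' hθ' h => hθ.2.1.ext hθ'.2.1 h,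
    fun D hD => ?_⟩⟩
  · obtain ⟨θ, hθ, hk, hR⟩ := PfPrincipalBundle.exists_form hD.ehresmann
    obtain rfl : D = PfPrincipalBundle.ker θ := funext hk
    exact ⟨θ, hθ, hk, hR, PfPrincipalBundle.maurerCartan_of_flat hC hθ hR hD⟩
  · exact PfPrincipalBundle.isFlatStructure_ker hC hconn hθ.1 hθ.2.1 hθ.2.2
  · obtain ⟨θ, hθ, hk, hR⟩ := PfPrincipalBundle.exists_form hD.ehresmann
    obtain rfl : D = PfPrincipalBundle.ker θ := funext hk
    exact ⟨θ, ⟨hθ, hR, PfPrincipalBundle.maurerCartan_of_flat hC hθ hR hD⟩, rfl⟩
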